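/- Let $N^{n+1}(K)$ be a smooth Riemannian manifold of constant sectional curvature $K$, let $\Sigma^n$ be a compact smooth manifold without boundary, and let $X:\Sigma\times[0,T)\to N^{n+1}(K)$ be a smooth family of immersions satisfying $$\frac{\partial X}{\partial t}=f\nu ,$$ where $\nu$ is a smooth field of unit normals along $X$ and $f$ is a real function on $\Sigma\times[0,T)$. Let $g(t)$ be the metric induced on $\Sigma$ by $X(\cdot,t)$, $d\mu_t$ its Riemannian volume, $h_{ij}=-\langle\nabla_i\partial_jX,\nu\rangle=\langle\nabla_i\nu,\partial_jX\rangle$ the second fundamental form and $H=g^{ij}h_{ij}$ the mean curvature; write $M_t=(\Sigma,g(t))$. The gradient $\nabla u$, its norm and the raising of indices are taken with respect to $g(t)$. For $p>1$, a number $\lambda$ is an eigenvalue of the $p$-Laplace operator of $M_t$, with eigenfunction $0\neq u\in C^1(\Sigma)$, if $\Delta_pu+\lambda|u|^{p-2}u=0$ weakly, that is, $$\int_{M_t}|\nabla u|^{p-2}\langle\nabla u,\nabla\varphi\rangle\,d\mu_t=\lambda\int_{M_t}|u|^{p-2}u\,\varphi\,d\mu_t\qquad\text{for all }\varphi\in C^1(\Sigma)$$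 (with $|\nabla u|^{p-2}\nabla u:=0$ where $\nabla u=0$, and $|u|^{p-2}u:=0$ where $u=0$). Let $\lambda_{1,p}(t)$ be the first nonzero (least positive) eigenvalue, and $\lambda_1(t)=\lambda_{1,2}(t)$ the first nonzero eigenvalue of the Laplace operator of $M_t$. Below, $u=u(x,t)$ is a function on $\Sigma\times[0,T)$ such that $u$ and $\partial u/\partial t$ are of class $C^1$ (for instance, a smooth function); derivatives in $t$ at $t=0$ are one-sided. (1) Let $p>1$, let $\int_{M_t}|u|^p\,d\mu_t=1$ for all $t\in[0,T)$, and put $\lambda_{1,p}(u,t)=\int_{M_t}|\nabla u(\cdot,t)|^p\,d\mu_t$. At every time $t\in[0,T)$ at which $u(\cdot,t)$ is an eigenfunction for $\lambda_{1,p}(t)$, the function $\lambda_{1,p}(u,\cdot)$ is differentiable and $$\frac{d}{dt}\lambda_{1,p}(u,t)=-p\int_{M_t}f|\nabla u|^{p-2}h^{ij}u_iu_j\,d\mu_t+\int_{M_t}fH|\nabla u|^p\,d\mu_t-\lambda_{1,p}(t)\int_{M_t}fH|u|^p\,d\mu_t .$$ (2) Let $p=2$, and suppose that for every $t\in[0,T)$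 the function $u(\cdot,t)$ is an eigenfunction for $\lambda_1(t)$ with $\int_{M_t}|u|^2\,d\mu_t=1$. Then $\lambda_1$ is differentiable on $[0,T)$ and $$\frac{d}{dt}\lambda_1(t)=-2\int_{M_t}f\,h^{ij}u_iu_j\,d\mu_t+\int_{M_t}fH|\nabla u|^2\,d\mu_t-\lambda_1(t)\int_{M_t}fH|u|^2\,d\mu_t .$$ -/

import Mathlib

open Set MeasureTheory Filter Topology
open scoped Manifold ContDiff

noncomputable section

namespace EigenvalueFlow

/-! ### Riemannian geometry in local coordinates -/

/-- The `i`-th coordinate vector. -/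
def coordVec {m : ℕ} (i : Fin m) : EuclideanSpace ℝ (Fin m) := EuclideanSpace.single i 1

/-- The partial derivative `∂F/∂yᵢ` at `y`. -/
def partialDeriv {m : ℕ} (i : Fin m) (F : EuclideanSpace ℝ (Fin m) → ℝ)
    (y : EuclideanSpace ℝ (Fin m)) : ℝ :=
  fderiv ℝ F y (coordVec i)

/-- The Christoffel symbol
`Γᵏᵢⱼ = ½ ∑ₗ gᵏˡ (∂ᵢ gⱼₗ + ∂ⱼ gᵢₗ - ∂ₗ gᵢⱼ)` of a matrix-valued metric `G`. -/
def christoffel {m : ℕ} (G : EuclideanSpace ℝ (Fin m) → Matrix (Fin m) (Fin m) ℝ)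
    (k i j : Fin m) (y : EuclideanSpace ℝ (Fin m)) : ℝ :=
  (1 / 2) * ∑ l, (G y)⁻¹ k l *
    (partialDeriv i (fun z => G z j l) y + partialDeriv j (fun z => G z i l) y
      - partialDeriv l (fun z => G z i j) y)

/-- The component of `R(∂ᵢ, ∂ⱼ)∂ₖ = ∇ᵢ∇ⱼ∂ₖ - ∇ⱼ∇ᵢ∂ₖ` along `∂ₗ`:
`∂ᵢ Γˡⱼₖ - ∂ⱼ Γˡᵢₖ + ∑ₘ (Γˡᵢₘ Γᵐⱼₖ - Γˡⱼₘ Γᵐᵢₖ)`. -/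
def curvatureCoeff {m : ℕ} (G : EuclideanSpace ℝ (Fin m) → Matrix (Fin m) (Fin m) ℝ)
    (l i j k : Fin m) (y : EuclideanSpace ℝ (Fin m)) : ℝ :=
  partialDeriv i (christoffel G l j k) y - partialDeriv j (christoffel G l i k) y
    + ∑ r, (christoffel G l i r y * christoffel G r j k y
      - christoffel G l j r y * christoffel G r i k y)

/-- The quantity `⟨R(a, b)b, a⟩` for coordinate vectors `a`, `b`. -/
def curvatureQuad {m : ℕ} (G : EuclideanSpace ℝ (Fin m) → Matrix (Fin m) (Fin m) ℝ)
    (y : EuclideanSpace ℝ (Fin m)) (a b : EuclideanSpace ℝ (Fin m)) : ℝ :=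
  ∑ s, ∑ l, ∑ i, ∑ j, ∑ k, G y s l * curvatureCoeff G l i j k y * a i * b j * b k * a s

section Manifold

variable {m : ℕ} {M : Type*} [TopologicalSpace M] [ChartedSpace (EuclideanSpace ℝ (Fin m)) M]

/-- A field of bilinear forms on the tangent spaces of `M`. -/
abbrev TensorField (m : ℕ) (M : Type*) [TopologicalSpace M]
    [ChartedSpace (EuclideanSpace ℝ (Fin m)) M] : Type _ :=
  (x : M) → TangentSpace (𝓡 m) x → TangentSpace (𝓡 m) x → ℝ

/-- A smooth Riemannian metric as a field of bilinear forms. -/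
def metricField [IsManifold (𝓡 m) ∞ M]
    (g : Bundle.ContMDiffRiemannianMetric (𝓡 m) ∞ (EuclideanSpace ℝ (Fin m))
      (fun x : M => TangentSpace (𝓡 m) x)) : TensorField m M :=
  fun x v w => g.inner x v w

/-- The matrix `g(∂ᵢ, ∂ⱼ)` of `g` in the preferred chart at `x₀`, as a function of the
coordinates `y` of that chart. -/
def chartMatrix (g : TensorField m M) (x₀ : M) (y : EuclideanSpace ℝ (Fin m)) :
    Matrix (Fin m) (Fin m) ℝ :=
  Matrix.of fun i j =>
    g ((extChartAt (𝓡 m) x₀).symm y)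
      (mfderiv 𝓘(ℝ, EuclideanSpace ℝ (Fin m)) (𝓡 m) (extChartAt (𝓡 m) x₀).symm y (coordVec i))
      (mfderiv 𝓘(ℝ, EuclideanSpace ℝ (Fin m)) (𝓡 m) (extChartAt (𝓡 m) x₀).symm y (coordVec j))

/-- Every sectional curvature of `g` equals `K`: at every point,
`⟨R(a, b)b, a⟩ = K (|a|²|b|² - ⟨a, b⟩²)` for all tangent vectors `a`, `b`. The tangent space at `y`
is identified with the coordinate space through the preferred chart at `y`, as in Mathlib. -/
def HasConstantSectionalCurvature (g : TensorField m M) (K : ℝ) : Prop :=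
  ∀ (y : M) (a b : TangentSpace (𝓡 m) y),
    curvatureQuad (chartMatrix g y) (extChartAt (𝓡 m) y y) a b
      = K * (g y a a * g y b b - g y a b ^ 2)

/-- The matrix `gᵢⱼ` of `g` at `x`, with respect to the coordinates of the preferred chart
at `x`. -/
def metricMatrix (g : TensorField m M) (x : M) : Matrix (Fin m) (Fin m) ℝ :=
  Matrix.of fun i j => g x (coordVec i : EuclideanSpace ℝ (Fin m))
    (coordVec j : EuclideanSpace ℝ (Fin m))

/-- The partial derivative `uᵢ` at `x`, in the coordinates of the preferred chart at `x`. -/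
def partialAt (u : M → ℝ) (x : M) (i : Fin m) : ℝ :=
  mfderiv (𝓡 m) 𝓘(ℝ, ℝ) u x (coordVec i : EuclideanSpace ℝ (Fin m))

/-- `⟨∇u, ∇φ⟩ = gⁱʲ uᵢ φⱼ`. -/
def gradInner (g : TensorField m M) (u φ : M → ℝ) (x : M) : ℝ :=
  ∑ i, ∑ j, (metricMatrix g x)⁻¹ i j * partialAt (m := m) u x i * partialAt (m := m) φ x j

/-- `|∇u|`. -/
def gradNorm (g : TensorField m M) (u : M → ℝ) (x : M) : ℝ := √(gradInner g u u x)

/-- The trace `gⁱʲ hᵢⱼ`. -/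
def traceWith (g h : TensorField m M) (x : M) : ℝ :=
  ∑ i, ∑ j, (metricMatrix g x)⁻¹ i j * metricMatrix h x i j

/-- `hⁱʲ uᵢ uⱼ`, where `hⁱʲ = gⁱᵏ gʲˡ hₖₗ`. -/
def raisedQuad (g h : TensorField m M) (u : M → ℝ) (x : M) : ℝ :=
  ∑ i, ∑ j, (∑ k, ∑ l, (metricMatrix g x)⁻¹ i k * (metricMatrix g x)⁻¹ j l * metricMatrix h x k l)
    * partialAt (m := m) u x i * partialAt (m := m) u x j

/-! ### The Riemannian volume and the eigenvalues of the `p`-Laplace operator -/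

variable [MeasurableSpace M]

/-- The measure `√det(gᵢⱼ) dy` of the preferred chart at `x₀`, carried over to `M`. -/
def chartVolume (g : TensorField m M) (x₀ : M) : Measure M :=
  ((volume.restrict (extChartAt (𝓡 m) x₀).target).withDensity
    fun y => ENNReal.ofReal √(chartMatrix g x₀ y).det).map (extChartAt (𝓡 m) x₀).symm

variable (m M) in
/-- A smooth partition of unity subordinate to the domains of the preferred charts. -/
def chartPartition [IsManifold (𝓡 m) ∞ M] [T2Space M] [SigmaCompactSpace M] :
    SmoothPartitionOfUnity M (𝓡 m) M univ :=
  (SmoothPartitionOfUnity.exists_isSubordinate_chartAt_source (𝓡 m) M).choose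

/-- The Riemannian volume `dμ` of `g`, glued from the charts by a partition of unity: on every
chart domain it is `√det(gᵢⱼ) dy`. -/
def riemVolume [IsManifold (𝓡 m) ∞ M] [T2Space M] [SigmaCompactSpace M] (g : TensorField m M) :
    Measure M :=
  Measure.sum fun x₀ : M =>
    (chartVolume g x₀).withDensity fun x => ENNReal.ofReal (chartPartition m M x₀ x)

/-- `u` is a nontrivial solution of `Δₚ u + lam |u|ᵖ⁻² u = 0` on the closed manifold `M`, in the
usual weak sense: `∫ |∇u|ᵖ⁻² ⟨∇u, ∇φ⟩ dμ = lam ∫ |u|ᵖ⁻² u φ dμ` for all test functions `φ`. -/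
structure IsEigenfunction [IsManifold (𝓡 m) ∞ M] [T2Space M] [SigmaCompactSpace M]
    (g : TensorField m M) (p lam : ℝ) (u : M → ℝ) : Prop where
  contMDiff : ContMDiff (𝓡 m) 𝓘(ℝ, ℝ) 1 u
  ne_zero : u ≠ 0
  equation : ∀ φ : M → ℝ, ContMDiff (𝓡 m) 𝓘(ℝ, ℝ) 1 φ →
    ∫ x, gradNorm g u x ^ (p - 2) * gradInner g u φ x ∂riemVolume g
      = lam * ∫ x, |u x| ^ (p - 2) * u x * φ x ∂riemVolume g

/-- The first nonzero eigenvalue `λ₁,ₚ` of the `p`-Laplace operator: the least positive one. -/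
def firstEigenvalue [IsManifold (𝓡 m) ∞ M] [T2Space M] [SigmaCompactSpace M]
    (g : TensorField m M) (p : ℝ) : ℝ :=
  sInf {lam : ℝ | 0 < lam ∧ ∃ u : M → ℝ, IsEigenfunction g p lam u}

/-- The energy `∫ |∇u|ᵖ dμ`. -/
def pEnergy [IsManifold (𝓡 m) ∞ M] [T2Space M] [SigmaCompactSpace M]
    (g : TensorField m M) (p : ℝ) (u : M → ℝ) : ℝ :=
  ∫ x, gradNorm g u x ^ p ∂riemVolume g

end Manifold

/-! ### Immersed hypersurfaces and normal flows -/

section Hypersurface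

variable {n : ℕ}
  {S : Type*} [TopologicalSpace S] [ChartedSpace (EuclideanSpace ℝ (Fin n)) S]
  {N : Type*} [TopologicalSpace N] [ChartedSpace (EuclideanSpace ℝ (Fin (n + 1))) N]

/-- The metric `g(v, w) = ⟨dX v, dX w⟩` induced by a map `X` into a manifold with metric `gN`. -/
def inducedMetric (gN : TensorField (n + 1) N) (X : S → N) : TensorField n S := fun x v w =>
  gN (X x) (mfderiv (𝓡 n) (𝓡 (n + 1)) X x v) (mfderiv (𝓡 n) (𝓡 (n + 1)) X x w)

/-- `X` read in the preferred charts at `x` and `X x`. -/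
def chartRep (X : S → N) (x : S) :
    EuclideanSpace ℝ (Fin n) → EuclideanSpace ℝ (Fin (n + 1)) :=
  fun y => extChartAt (𝓡 (n + 1)) (X x) (X ((extChartAt (𝓡 n) x).symm y))

/-- The covariant second derivative `∇_v (dX w)` of `X` at `x`, a vector of the ambient tangent space
with components `(∂ᵢ∂ⱼXᵏ + Γᵏₐᵦ ∂ᵢXᵃ ∂ⱼXᵇ) vⁱ wʲ`. -/
def covSecondDeriv (gN : TensorField (n + 1) N) (X : S → N) (x : S)
    (v w : EuclideanSpace ℝ (Fin n)) : EuclideanSpace ℝ (Fin (n + 1)) :=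
  fderiv ℝ (fun z => fderiv ℝ (chartRep X x) z w) (extChartAt (𝓡 n) x x) v
    + WithLp.toLp 2 fun k => ∑ a, ∑ b,
        christoffel (chartMatrix gN (X x)) k a b (extChartAt (𝓡 (n + 1)) (X x) (X x))
          * fderiv ℝ (chartRep X x) (extChartAt (𝓡 n) x x) v a
          * fderiv ℝ (chartRep X x) (extChartAt (𝓡 n) x x) w b

/-- The second fundamental form `h(v, w) = -⟨∇_v (dX w), ν⟩ = ⟨∇_v ν, dX w⟩`, positive for round
spheres with respect to the outward normal. -/
def secondFundamentalForm (gN : TensorField (n + 1) N) (X : S → N)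
    (ν : (x : S) → TangentSpace (𝓡 (n + 1)) (X x)) : TensorField n S := fun x v w =>
  -gN (X x) (covSecondDeriv gN X x v w) (ν x)

/-- The mean curvature `H = gⁱʲ hᵢⱼ`. -/
def meanCurvature (gN : TensorField (n + 1) N) (X : S → N)
    (ν : (x : S) → TangentSpace (𝓡 (n + 1)) (X x)) (x : S) : ℝ :=
  traceWith (inducedMetric gN X) (secondFundamentalForm gN X ν) x

/-- `X : S × [0, T) → N` is a smooth family of immersions with `∂X/∂t = f ν`, where `ν` is a
smooth field of unit normals. -/
structure IsNormalFlow [IsManifold (𝓡 (n + 1)) ∞ N] (gN : TensorField (n + 1) N) (T : ℝ) (X : ℝ → S → N) (f : ℝ → S → ℝ)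
    (ν : (t : ℝ) → (x : S) → TangentSpace (𝓡 (n + 1)) (X t x)) : Prop where
  smooth : ContMDiffOn ((𝓡 n).prod 𝓘(ℝ, ℝ)) (𝓡 (n + 1)) ∞
    (fun q : S × ℝ => X q.2 q.1) (univ ×ˢ Ico 0 T)
  immersion : ∀ t ∈ Ico 0 T, ∀ x, Function.Injective (mfderiv (𝓡 n) (𝓡 (n + 1)) (X t) x)
  smooth_normal : ContMDiffOn ((𝓡 n).prod 𝓘(ℝ, ℝ)) (𝓡 (n + 1)).tangent ∞
    (fun q : S × ℝ => (⟨X q.2 q.1, ν q.2 q.1⟩ : TangentBundle (𝓡 (n + 1)) N)) (univ ×ˢ Ico 0 T)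
  unit : ∀ t ∈ Ico 0 T, ∀ x, gN (X t x) (ν t x) (ν t x) = 1
  normal : ∀ t ∈ Ico 0 T, ∀ x, ∀ v : TangentSpace (𝓡 n) x,
    gN (X t x) (ν t x) (mfderiv (𝓡 n) (𝓡 (n + 1)) (X t) x v) = 0
  evolution : ∀ t ∈ Ico 0 T, ∀ x,
    mfderivWithin 𝓘(ℝ, ℝ) (𝓡 (n + 1)) (fun s => X s x) (Ico 0 T) t (1 : ℝ) = f t x • ν t x

/-- `u` and `∂u/∂t` are of class `C¹` on `S × [0, T)`. -/
structure IsRegularFamily (n : ℕ) {S : Type*} [TopologicalSpace S]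
    [ChartedSpace (EuclideanSpace ℝ (Fin n)) S] (T : ℝ) (u : ℝ → S → ℝ) : Prop where
  contMDiffOn : ContMDiffOn ((𝓡 n).prod 𝓘(ℝ, ℝ)) 𝓘(ℝ, ℝ) 1
    (fun q : S × ℝ => u q.2 q.1) (univ ×ˢ Ico 0 T)
  contMDiffOn_deriv : ContMDiffOn ((𝓡 n).prod 𝓘(ℝ, ℝ)) 𝓘(ℝ, ℝ) 1
    (fun q : S × ℝ => derivWithin (fun s => u s q.1) (Ico 0 T) q.2) (univ ×ˢ Ico 0 T)

end Hypersurface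

end EigenvalueFlow

end

/-! The proof is a first-variation computation in which the unknown term, the one containing the
time derivative `v` of `u`, is removed by using `v` as a test function. Let `k` be the time
derivative of the induced metric. Differentiating the energy density and the volume gives the
integrand `p|∇u|^(p-2)(⟨∇u,∇v⟩ - ½ k(∇u,∇u)) + ½ |∇u|^p tr k`. Differentiating the normalisation
`∫|u|^p = 1` gives `p∫|u|^(p-2) u v + ½∫|u|^p tr k = 0`. The weak equation tested with `v` (a `C¹`
function) says `∫|∇u|^(p-2)⟨∇u,∇v⟩ = λ∫|u|^(p-2) u v`, so the energy term with `∇v` equals `-½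
λ∫|u|^p tr k`. Substituting `k = 2fh` yields the formula. Only the equation at time `t` enters, so
`λ` may be any eigenvalue: `IsMetricFlow.hasDerivWithinAt_pEnergy_of_isEigenfunction`.

The geometric input is `hasDerivWithinAt_metricMatrix`: the velocity `V = fν` is orthogonal to the
hypersurface at every point, and differentiating this orthogonality in space turns the time
derivative of the metric into second derivatives of the immersion paired with `V`.

The analytic difficulty is `1 < p < 2`, where `|∇u|^(p-2)` is singular at critical points of `u`.
Two facts deal with it. Pointwise, `|∇u|^p` stays differentiable in time at a critical point,
because it is `O(|s-t|^p)` there (`hasDerivWithinAt_inv_quadratic_rpow`). Uniformly, both `⟨∇u,∇v⟩`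
and `k(∇u,∇u)` contain a factor `|∇u|`, so the derivative is dominated by `|∇u|^(p-1)` times a
continuous function. The moving measure is written as a density against the volume at the fixed time
(`riemVolume_eq_withDensity`), after which one differentiates under the integral over a finite
measure.

For `p = 2`, testing the equation with `u` itself shows that the eigenvalue is the energy of `u` at
every time, so the derivative of the energy is that of the eigenvalue. -/

noncomputable section

namespace EigenvalueFlow

/-! ### One-sided calculus: mixed derivatives, integrals with a parameter, uniform bounds -/

section Calculus

/-- Exchange of the derivatives in `s` and `y`: if `∂ₛu` is `C¹` in `y`, then `∂ₛ∂ᵧu = ∂ᵧ∂ₛu`. -/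
theorem hasDerivWithinAt_fderiv_of_mixed {E F : Type*} [NormedAddCommGroup E] [NormedSpace ℝ E]
    [NormedAddCommGroup F] [NormedSpace ℝ F] {u v : ℝ → E → F} {b : ℝ → E → E →L[ℝ] F}
    {J : Set ℝ} (hJ : Convex ℝ J) {t : ℝ} (ht : t ∈ J) {y₀ : E}
    (hu : ∀ᶠ s in 𝓝[J] t, DifferentiableAt ℝ (u s) y₀)
    (hv : ∀ᶠ z in 𝓝[J] t ×ˢ 𝓝 y₀, HasDerivWithinAt (fun s => u s z.2) (v z.1 z.2) J z.1)
    (hb : ∀ᶠ z in 𝓝[J] t ×ˢ 𝓝 y₀, HasFDerivAt (v z.1) (b z.1 z.2) z.2)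
    (hbc : Tendsto (fun z : ℝ × E => b z.1 z.2) (𝓝[J] t ×ˢ 𝓝 y₀) (𝓝 (b t y₀))) :
    HasDerivWithinAt (fun s => fderiv ℝ (u s) y₀) (b t y₀) J t := by
  rw [hasDerivWithinAt_iff_isLittleO, Asymptotics.isLittleO_iff]
  intro ε hε
  have hclose : ∀ᶠ z in 𝓝[J] t ×ˢ 𝓝 y₀, ‖b z.1 z.2 - b t y₀‖ ≤ ε := by
    have := Metric.tendsto_nhds.1 hbc ε hε
    filter_upwards [this] with z hz
    rw [dist_eq_norm] at hz
    exact hz.le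
  have hall := (hv.and hb).and hclose
  rw [Filter.eventually_prod_iff] at hall
  obtain ⟨P, hP, Q, hQ, hPQ⟩ := hall
  obtain ⟨δ, hδ, hδP⟩ := Metric.mem_nhdsWithin_iff.1 hP
  obtain ⟨r, hr, hrQ⟩ := Metric.mem_nhds_iff.1 hQ
  have hut : DifferentiableAt ℝ (u t) y₀ := hu.self_of_nhdsWithin ht
  have hmem : ∀ᶠ s in 𝓝[J] t, s ∈ Metric.ball t δ ∩ J :=
    inter_mem (mem_nhdsWithin_of_mem_nhds (Metric.ball_mem_nhds t hδ)) self_mem_nhdsWithin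
  filter_upwards [hu, hmem] with s hs hsm
  have hconv : Convex ℝ (Metric.ball t δ ∩ J) := (convex_ball t δ).inter hJ
  have htm : t ∈ Metric.ball t δ ∩ J := ⟨Metric.mem_ball_self hδ, ht⟩
  -- The remainder of the difference quotient is `ε|s - t|`-Lipschitz near `y₀`, hence so is bounded
  -- the norm of its derivative at `y₀`. The Lipschitz bound comes from two mean value inequalities,
  -- one in time and one in space.
  have key : ∀ y ∈ Metric.ball y₀ r, ∀ w ∈ Metric.ball y₀ r,
      ‖(u s y - u t y - (s - t) • b t y₀ y) - (u s w - u t w - (s - t) • b t y₀ w)‖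
        ≤ ε * |s - t| * ‖y - w‖ := by
    intro y hy w hw
    have hderiv : ∀ τ ∈ Metric.ball t δ ∩ J,
        HasDerivWithinAt (fun τ => (u τ y - u τ w) - τ • (b t y₀ y - b t y₀ w))
          ((v τ y - v τ w) - (b t y₀ y - b t y₀ w)) (Metric.ball t δ ∩ J) τ := by
      intro τ hτ
      have h1 := (hPQ (hδP hτ) (hrQ hy)).1.1
      have h2 := (hPQ (hδP hτ) (hrQ hw)).1.1
      have h3 := ((h1.sub h2).sub ((hasDerivWithinAt_id τ J).smul_const
        (b t y₀ y - b t y₀ w))).mono (inter_subset_right : Metric.ball t δ ∩ J ⊆ J)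
      rw [one_smul] at h3
      exact h3
    -- The time derivative is the difference between `y` and `w` of `v τ - b t y₀`, whose spatial
    -- derivative has norm at most `ε`.
    have hbound : ∀ τ ∈ Metric.ball t δ ∩ J,
        ‖(v τ y - v τ w) - (b t y₀ y - b t y₀ w)‖ ≤ ε * ‖y - w‖ := by
      intro τ hτ
      have := (convex_ball y₀ r).norm_image_sub_le_of_norm_hasFDerivWithin_le
        (f := fun z => v τ z - b t y₀ z) (f' := fun z => b τ z - b t y₀) (C := ε)
        (fun z hz => (((hPQ (hδP hτ) (hrQ hz)).1.2).sub (b t y₀).hasFDerivAt).hasFDerivWithinAt)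
        (fun z hz => (hPQ (hδP hτ) (hrQ hz)).2) hw hy
      convert! this using 2
      abel
    have := hconv.norm_image_sub_le_of_norm_hasDerivWithin_le hderiv hbound htm hsm
    calc _ = ‖(u s y - u s w - s • (b t y₀ y - b t y₀ w))
          - (u t y - u t w - t • (b t y₀ y - b t y₀ w))‖ := by
            congr 1
            simp only [sub_smul, smul_sub]
            abel
      _ ≤ ε * ‖y - w‖ * ‖s - t‖ := this
      _ = _ := by rw [Real.norm_eq_abs]; ring
  have hd : HasFDerivAt (fun y => u s y - u t y - (s - t) • b t y₀ y)
      (fderiv ℝ (u s) y₀ - fderiv ℝ (u t) y₀ - (s - t) • b t y₀) y₀ :=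
    (hs.hasFDerivAt.sub hut.hasFDerivAt).sub ((b t y₀).hasFDerivAt.const_smul (s - t))
  have hnn : 0 ≤ ε * |s - t| := by positivity
  refine hd.le_of_lip' hnn ?_
  filter_upwards [Metric.ball_mem_nhds y₀ hr] with y hy
  exact key y hy y₀ (Metric.mem_ball_self hr)

/-- One-sided differentiation under the integral sign over a finite measure. -/
theorem hasDerivWithinAt_integral_of_bounded {α : Type*} [MeasurableSpace α] {μ : Measure α}
    [IsFiniteMeasure μ] {J : Set ℝ} (hJ : Convex ℝ J) {t : ℝ} (ht : t ∈ J)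
    {F F' : ℝ → α → ℝ} {C : ℝ}
    (hmeas : ∀ s ∈ J, AEStronglyMeasurable (F s) μ)
    (hint : ∀ s ∈ J, Integrable (F s) μ)
    (hderiv : ∀ s ∈ J, ∀ x, HasDerivWithinAt (fun s => F s x) (F' s x) J s)
    (hbound : ∀ᶠ s in 𝓝[J] t, ∀ x, |F' s x| ≤ C) :
    HasDerivWithinAt (fun s => ∫ x, F s x ∂μ) (∫ x, F' t x ∂μ) J t := by
  rw [hasDerivWithinAt_iff_tendsto_slope]
  obtain ⟨δ, hδ, hδP⟩ := Metric.mem_nhdsWithin_iff.1 hbound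
  have hconv : Convex ℝ (Metric.ball t δ ∩ J) := (convex_ball t δ).inter hJ
  have htm : t ∈ Metric.ball t δ ∩ J := ⟨Metric.mem_ball_self hδ, ht⟩
  have hmem : ∀ᶠ s in 𝓝[J \ {t}] t, s ∈ Metric.ball t δ ∩ J ∧ s ≠ t := by
    have h1 : ∀ᶠ s in 𝓝[J \ {t}] t, s ∈ J \ {t} := self_mem_nhdsWithin
    have h2 : ∀ᶠ s in 𝓝[J \ {t}] t, s ∈ Metric.ball t δ :=
      mem_nhdsWithin_of_mem_nhds (Metric.ball_mem_nhds t hδ)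
    filter_upwards [h1, h2] with s h1 h2
    exact ⟨⟨h2, h1.1⟩, h1.2⟩
  have hslope : (fun s => ∫ x, slope (fun s => F s x) t s ∂μ)
      =ᶠ[𝓝[J \ {t}] t] slope (fun s => ∫ x, F s x ∂μ) t := by
    filter_upwards [hmem] with s hs
    simp only [slope_def_field]
    rw [integral_div, integral_sub (hint s hs.1.2) (hint t ht)]
  refine Tendsto.congr' hslope ?_
  refine tendsto_integral_filter_of_dominated_convergence (fun _ => C) ?_ ?_
    (integrable_const C) ?_
  · filter_upwards [hmem] with s hs
    simp only [slope_def_field]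
    exact (((hmeas s hs.1.2).sub (hmeas t ht)).mul_const (s - t)⁻¹).congr
      (Eventually.of_forall fun x => (div_eq_mul_inv _ _).symm)
  · filter_upwards [hmem] with s hs
    -- The slopes inherit the bound on the derivative through the mean value inequality; this is
    -- where convexity of `J` is needed.
    refine Eventually.of_forall fun x => ?_
    have := hconv.norm_image_sub_le_of_norm_hasDerivWithin_le (f := fun s => F s x)
      (f' := fun s => F' s x) (C := C)
      (fun τ hτ => (hderiv τ hτ.2 x).mono inter_subset_right)
      (fun τ hτ => hδP hτ x) htm hs.1
    rw [slope_def_field, norm_div, div_le_iff₀ (norm_pos_iff.2 (sub_ne_zero.2 hs.2))]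
    exact this
  · refine Eventually.of_forall fun x => ?_
    exact (hasDerivWithinAt_iff_tendsto_slope.1 (hderiv t ht x))

/-- Local bounds near `(t, x)` for all `x` in a compact space give a uniform bound. -/
theorem eventually_forall_le_of_locally_bounded {X : Type*} [TopologicalSpace X] [CompactSpace X]
    {l : Filter ℝ} {P : ℝ → X → ℝ → Prop} (hmono : ∀ s x C C', C ≤ C' → P s x C → P s x C')
    (h : ∀ x₀ : X, ∃ C, ∀ᶠ z in l ×ˢ 𝓝 x₀, P z.1 z.2 C) :
    ∃ C, ∀ᶠ s in l, ∀ x, P s x C := by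
  choose C hC using h
  choose a ha b hb hab using fun x₀ => Filter.eventually_prod_iff.1 (hC x₀)
  obtain ⟨I, hI⟩ := isCompact_univ.elim_nhds_subcover (fun x₀ => {x | b x₀ x}) (fun x _ => hb x)
  -- The sum of absolute values is a common upper bound for the finitely many local constants, also
  -- when the cover is empty.
  refine ⟨∑ i ∈ I, |C i|, ?_⟩
  have : ∀ᶠ s in l, ∀ i ∈ I, a i s := (Filter.eventually_all_finset I).2 fun i _ => ha i
  filter_upwards [this] with s hs x
  obtain ⟨i, hi, hxi⟩ := Set.mem_iUnion₂.1 (hI.2 (mem_univ x))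
  refine hmono _ _ _ _ ?_ (hab i (hs i hi) hxi)
  exact (le_abs_self _).trans (Finset.single_le_sum (f := fun i => |C i|)
    (fun _ _ => abs_nonneg _) hi)

end Calculus

/-! ### Derivatives and estimates for determinants, inverses and inverse quadratic forms -/

section MatrixCalculus

open Matrix

variable {ι : Type*} [Fintype ι] [DecidableEq ι]

/-- Jacobi's formula. -/
theorem hasDerivWithinAt_det {A : ℝ → Matrix ι ι ℝ} {A' : Matrix ι ι ℝ} {J : Set ℝ} {t : ℝ}
    (hA : ∀ i j, HasDerivWithinAt (fun s => A s i j) (A' i j) J t) :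
    HasDerivWithinAt (fun s => (A s).det) ((A t).adjugate * A').trace J t := by
  -- The determinant is multilinear in the rows, so its derivative is the sum over `i` of
  -- determinants with row `i` replaced by that of `A'`; Cramer's rule recognises these as the
  -- diagonal entries of `A' * adjugate`.
  let D : ContinuousMultilinearMap ℝ (fun _ : ι => ι → ℝ) ℝ :=
    ⟨(detRowAlternating (n := ι) (R := ℝ)).toMultilinearMap, by
      change Continuous fun M : Matrix ι ι ℝ => M.det
      exact continuous_id.matrix_det⟩
  have hrow : HasDerivWithinAt (fun s => (A s : ι → ι → ℝ)) A' J t :=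
    hasDerivWithinAt_pi.2 fun i => hasDerivWithinAt_pi.2 fun j => hA i j
  have h := (D.hasFDerivAt (A t)).comp_hasDerivWithinAt t hrow
  convert! h using 1
  refine Eq.trans ?_ (ContinuousMultilinearMap.linearDeriv_apply D (A t) A').symm
  have hD : ∀ i, D (Function.update (A t : ι → ι → ℝ) i (A' i))
      = ((A t).updateRow i (A' i)).det := fun i => rfl
  refine Eq.trans ?_ (Finset.sum_congr rfl fun i _ => (hD i).symm)
  rw [trace_mul_comm]
  simp only [trace, diag_apply, mul_apply]
  refine Finset.sum_congr rfl fun i _ => ?_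
  rw [← cramer_transpose_apply, cramer_eq_adjugate_mulVec, ← adjugate_transpose]
  simp [mulVec, dotProduct, mul_comm]

/-- An entry of the adjugate is a determinant with one row replaced by a constant unit vector, so
Jacobi's formula applies to it. -/
theorem differentiableWithinAt_adjugate {A : ℝ → Matrix ι ι ℝ} {J : Set ℝ} {t : ℝ}
    (hA : ∀ i j, DifferentiableWithinAt ℝ (fun s => A s i j) J t) (i j : ι) :
    DifferentiableWithinAt ℝ (fun s => (A s).adjugate i j) J t := by
  simp only [adjugate_apply]
  refine (hasDerivWithinAt_det (A' := Matrix.of fun k l =>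
    derivWithin (fun s => (A s).updateRow j (Pi.single i 1) k l) J t)
    fun k l => ?_).differentiableWithinAt
  refine DifferentiableWithinAt.hasDerivWithinAt ?_
  by_cases hk : k = j
  · subst hk
    simpa using differentiableWithinAt_const _
  · simpa [updateRow_ne hk] using hA k l

theorem differentiableWithinAt_inv {A : ℝ → Matrix ι ι ℝ} {J : Set ℝ} {t : ℝ}
    (hA : ∀ i j, DifferentiableWithinAt ℝ (fun s => A s i j) J t) (h0 : (A t).det ≠ 0) (i j : ι) :
    DifferentiableWithinAt ℝ (fun s => (A s)⁻¹ i j) J t := by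
  have hdet : DifferentiableWithinAt ℝ (fun s => (A s).det) J t :=
    (hasDerivWithinAt_det (A' := Matrix.of fun k l => derivWithin (fun s => A s k l) J t)
      fun k l => (hA k l).hasDerivWithinAt).differentiableWithinAt
  have := (hdet.inv h0).mul (differentiableWithinAt_adjugate hA i j)
  refine this.congr (fun s _ => ?_) ?_ <;> simp [inv_def, Ring.inverse_eq_inv']

omit [DecidableEq ι] in
theorem hasDerivWithinAt_dotProduct {ξ η : ℝ → ι → ℝ} {ξ' η' : ι → ℝ} {J : Set ℝ} {t : ℝ}
    (hξ : ∀ i, HasDerivWithinAt (fun s => ξ s i) (ξ' i) J t)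
    (hη : ∀ i, HasDerivWithinAt (fun s => η s i) (η' i) J t) :
    HasDerivWithinAt (fun s => ξ s ⬝ᵥ η s) (ξ' ⬝ᵥ η t + ξ t ⬝ᵥ η') J t := by
  have h := HasDerivWithinAt.fun_sum (u := Finset.univ) fun i _ => (hξ i).mul (hη i)
  simpa [dotProduct, Finset.sum_add_distrib] using h

/-- The derivative of `s ↦ ⟨ξ, A⁻¹ ξ⟩`. -/
theorem hasDerivWithinAt_inv_quadratic {A : ℝ → Matrix ι ι ℝ} {A' : Matrix ι ι ℝ}
    {ξ : ℝ → ι → ℝ} {ξ' : ι → ℝ} {J : Set ℝ} {t : ℝ} (ht : t ∈ J)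
    (hJ : UniqueDiffWithinAt ℝ J t)
    (hA : ∀ i j, HasDerivWithinAt (fun s => A s i j) (A' i j) J t)
    (hξ : ∀ i, HasDerivWithinAt (fun s => ξ s i) (ξ' i) J t)
    (hpos : ∀ s ∈ J, (A s).PosDef) :
    HasDerivWithinAt (fun s => ξ s ⬝ᵥ (A s)⁻¹ *ᵥ ξ s)
      (2 * (ξ' ⬝ᵥ (A t)⁻¹ *ᵥ ξ t)
        - ((A t)⁻¹ *ᵥ ξ t) ⬝ᵥ A' *ᵥ ((A t)⁻¹ *ᵥ ξ t)) J t := by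
  -- No formula for the derivative of the inverse matrix is needed: differentiability of `ζ`
  -- suffices, and its derivative is then determined by differentiating `A ζ = ξ`.
  set ζ : ℝ → ι → ℝ := fun s => (A s)⁻¹ *ᵥ ξ s with hζ
  have hζd : ∀ i, DifferentiableWithinAt ℝ (fun s => ζ s i) J t := by
    intro i
    simp only [hζ, mulVec, dotProduct]
    exact DifferentiableWithinAt.fun_sum fun j _ =>
      (differentiableWithinAt_inv (fun i j => (hA i j).differentiableWithinAt)
        (hpos t ht).det_pos.ne' i j).mul (hξ j).differentiableWithinAt
  set ζ' : ι → ℝ := fun i => derivWithin (fun s => ζ s i) J t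
  have hζ' : ∀ i, HasDerivWithinAt (fun s => ζ s i) (ζ' i) J t :=
    fun i => (hζd i).hasDerivWithinAt
  have hAζ : ∀ s ∈ J, A s *ᵥ ζ s = ξ s := by
    intro s hs
    simp only [hζ]
    rw [mulVec_mulVec, mul_nonsing_inv _ (hpos s hs).det_pos.ne'.isUnit, one_mulVec]
  have hrel : ξ' = A' *ᵥ ζ t + A t *ᵥ ζ' := by
    funext i
    have h1 := hasDerivWithinAt_dotProduct (hA i) hζ'
    have h2 : HasDerivWithinAt (fun s => ξ s i) (A' i ⬝ᵥ ζ t + A t i ⬝ᵥ ζ') J t :=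
      h1.congr (fun s hs => (congrFun (hAζ s hs) i).symm) (congrFun (hAζ t ht) i).symm
    exact hJ.eq_deriv _ (hξ i) h2
  have hfin := hasDerivWithinAt_dotProduct hξ hζ'
  convert! hfin using 1
  -- Symmetry of `A` brings the unknown `ζ'` into the combination `A ζ'`, which the relation above
  -- expresses through `ξ'` and `A'`.
  have hsymm : ξ t ⬝ᵥ ζ' = ζ t ⬝ᵥ A t *ᵥ ζ' := by
    have hT : (A t)ᵀ = A t := by simpa using (hpos t ht).isHermitian.eq
    rw [dotProduct_mulVec, ← mulVec_transpose, hT, hAζ t ht]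
  have h3 : A t *ᵥ ζ' = ξ' - A' *ᵥ ζ t := by rw [hrel]; simp
  rw [hsymm, h3, dotProduct_sub, dotProduct_comm (ζ t) ξ']
  ring

theorem inv_quadratic_nonneg {A : Matrix ι ι ℝ} (hA : A.PosDef) (ξ : ι → ℝ) :
    0 ≤ ξ ⬝ᵥ A⁻¹ *ᵥ ξ := by
  simpa using hA.inv.posSemidef.dotProduct_mulVec_nonneg ξ

theorem inv_quadratic_eq_zero {A : Matrix ι ι ℝ} (hA : A.PosDef) {ξ : ι → ℝ}
    (h : ξ ⬝ᵥ A⁻¹ *ᵥ ξ = 0) : ξ = 0 := by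
  by_contra hne
  have := hA.inv.dotProduct_mulVec_pos hne
  simp [h] at this

/-- Cauchy-Schwarz for the inverse of a positive definite matrix. -/
theorem abs_inv_bilin_le {A : Matrix ι ι ℝ} (hA : A.PosDef) (ξ η : ι → ℝ) :
    |ξ ⬝ᵥ A⁻¹ *ᵥ η| ≤ √(ξ ⬝ᵥ A⁻¹ *ᵥ ξ) * √(η ⬝ᵥ A⁻¹ *ᵥ η) := by
  have hT : (A⁻¹)ᵀ = A⁻¹ := by simpa using hA.inv.isHermitian.eq
  have hsymm : η ⬝ᵥ A⁻¹ *ᵥ ξ = ξ ⬝ᵥ A⁻¹ *ᵥ η := by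
    rw [dotProduct_mulVec, ← mulVec_transpose, hT, dotProduct_comm]
  have hq : ∀ x : ℝ, 0 ≤ (η ⬝ᵥ A⁻¹ *ᵥ η) * (x * x) + (2 * (ξ ⬝ᵥ A⁻¹ *ᵥ η)) * x
      + ξ ⬝ᵥ A⁻¹ *ᵥ ξ := by
    intro x
    have := inv_quadratic_nonneg hA (ξ + x • η)
    simp only [mulVec_add, mulVec_smul, dotProduct_add, add_dotProduct, smul_dotProduct,
      dotProduct_smul, smul_eq_mul, hsymm] at this
    linarith
  have hd := discrim_le_zero hq
  rw [discrim] at hd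
  rw [← Real.sqrt_mul (inv_quadratic_nonneg hA ξ)]
  apply Real.abs_le_sqrt
  nlinarith

/-- Cauchy-Schwarz for `A⁻¹`, applied to `ξ` and a coordinate covector. -/
theorem abs_inv_mulVec_le {A : Matrix ι ι ℝ} (hA : A.PosDef) (ξ : ι → ℝ) (i : ι) :
    |(A⁻¹ *ᵥ ξ) i| ≤ √(A⁻¹ i i) * √(ξ ⬝ᵥ A⁻¹ *ᵥ ξ) := by
  have := abs_inv_bilin_le hA (Pi.single i 1) ξ
  simpa [single_dotProduct, mulVec_single] using this

/-- Each component of the gradient is controlled by the length of `ξ`. The point is that the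
constant depends continuously on `A⁻¹` and `B` and not on `ξ`, so that `k(∇u,∇u)` can be bounded by
`|∇u|²` locally uniformly, including near critical points. -/
theorem abs_quadratic_inv_le {A : Matrix ι ι ℝ} (hA : A.PosDef) (B : Matrix ι ι ℝ) (ξ : ι → ℝ) :
    |(A⁻¹ *ᵥ ξ) ⬝ᵥ B *ᵥ (A⁻¹ *ᵥ ξ)|
      ≤ (∑ i, ∑ j, √(A⁻¹ i i) * |B i j| * √(A⁻¹ j j)) * (ξ ⬝ᵥ A⁻¹ *ᵥ ξ) := by
  set q := ξ ⬝ᵥ A⁻¹ *ᵥ ξ with hq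
  have hq0 : 0 ≤ q := inv_quadratic_nonneg hA ξ
  have hz := abs_inv_mulVec_le hA ξ
  rw [← hq] at hz
  set ζ := A⁻¹ *ᵥ ξ
  simp only [mulVec, dotProduct, Finset.mul_sum, Finset.sum_mul]
  refine (Finset.abs_sum_le_sum_abs _ _).trans (Finset.sum_le_sum fun i _ => ?_)
  refine (Finset.abs_sum_le_sum_abs _ _).trans (Finset.sum_le_sum fun j _ => ?_)
  calc |ζ i * (B i j * ζ j)| = |ζ i| * |ζ j| * |B i j| := by rw [abs_mul, abs_mul]; ring
    _ ≤ (√(A⁻¹ i i) * √q) * (√(A⁻¹ j j) * √q) * |B i j| := by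
        gcongr
        · exact hz i
        · exact hz j
    _ = √(A⁻¹ i i) * |B i j| * √(A⁻¹ j j) * (√q * √q) := by ring
    _ = _ := by rw [Real.mul_self_sqrt hq0]

/-- The derivative of `s ↦ ⟨ξ, A⁻¹ ξ⟩^(p/2)` for `p > 1`, also at the zeros of `ξ`. -/
theorem hasDerivWithinAt_inv_quadratic_rpow {A : ℝ → Matrix ι ι ℝ} {A' : Matrix ι ι ℝ}
    {ξ : ℝ → ι → ℝ} {ξ' : ι → ℝ} {J : Set ℝ} {t : ℝ} (ht : t ∈ J)
    (hJ : UniqueDiffWithinAt ℝ J t)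
    (hA : ∀ i j, HasDerivWithinAt (fun s => A s i j) (A' i j) J t)
    (hξ : ∀ i, HasDerivWithinAt (fun s => ξ s i) (ξ' i) J t)
    (hpos : ∀ s ∈ J, (A s).PosDef) {p : ℝ} (hp : 1 < p) :
    HasDerivWithinAt (fun s => √(ξ s ⬝ᵥ (A s)⁻¹ *ᵥ ξ s) ^ p)
      (p * √(ξ t ⬝ᵥ (A t)⁻¹ *ᵥ ξ t) ^ (p - 2) * (ξ' ⬝ᵥ (A t)⁻¹ *ᵥ ξ t
        - 1 / 2 * (((A t)⁻¹ *ᵥ ξ t) ⬝ᵥ A' *ᵥ ((A t)⁻¹ *ᵥ ξ t)))) J t := by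
  have hq := hasDerivWithinAt_inv_quadratic ht hJ hA hξ hpos
  -- At a zero of the covector the norm is `O(|s - t|)`, so its `p`-th power is `o(s - t)` because
  -- `p > 1`. The claimed derivative also vanishes there, since its last factor does, whatever value
  -- `0 ^ (p - 2)` has. Away from zeros this is the chain rule.
  rcases (inv_quadratic_nonneg (hpos t ht) (ξ t)).eq_or_lt with h0 | h0
  · have hz : ξ t = 0 := inv_quadratic_eq_zero (hpos t ht) h0.symm
    have hξO : ∀ i, (fun s => ξ s i) =O[𝓝[J] t] fun s => s - t := by
      intro i
      have := (hξ i).isBigO_sub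
      simpa [hz, Function.comp_def] using this
    have hinvO : ∀ i j, (fun s => (A s)⁻¹ i j) =O[𝓝[J] t] fun _ => (1 : ℝ) := by
      intro i j
      have := (differentiableWithinAt_inv (fun i j => (hA i j).differentiableWithinAt)
        (hpos t ht).det_pos.ne' i j).continuousWithinAt
      exact this.isBigO_one ℝ
    have hqO : (fun s => ξ s ⬝ᵥ (A s)⁻¹ *ᵥ ξ s) =O[𝓝[J] t] fun s => (s - t) ^ 2 := by
      simp only [dotProduct, mulVec]
      refine Asymptotics.IsBigO.fun_sum fun i _ => ?_
      have h2 : (fun s => ∑ j, (A s)⁻¹ i j * ξ s j) =O[𝓝[J] t] fun s => (s - t) :=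
        Asymptotics.IsBigO.fun_sum fun j _ => by simpa using (hinvO i j).mul (hξO j)
      simpa [sq] using (hξO i).mul h2
    have hsO : (fun s => √(ξ s ⬝ᵥ (A s)⁻¹ *ᵥ ξ s)) =O[𝓝[J] t] fun s => |s - t| := by
      have := hqO.sqrt (Eventually.of_forall fun s => sq_nonneg (s - t))
      simpa [Real.sqrt_sq_eq_abs] using this
    have hpO : (fun s => √(ξ s ⬝ᵥ (A s)⁻¹ *ᵥ ξ s) ^ p) =O[𝓝[J] t] fun s => |s - t| ^ p :=
      hsO.rpow (by linarith) (Eventually.of_forall fun s => abs_nonneg _)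
    have habs : (fun x : ℝ => |x| ^ p) =o[𝓝 0] fun x => x := by
      have := (hasDerivAt_abs_rpow 0 hp)
      rw [hasDerivAt_iff_isLittleO] at this
      simpa [Real.zero_rpow (by linarith : p ≠ 0)] using this
    have htend : Tendsto (fun s => s - t) (𝓝[J] t) (𝓝 0) := by
      have : Tendsto (fun s => s - t) (𝓝 t) (𝓝 (t - t)) := by
        exact (continuous_id.sub continuous_const).tendsto t
      rw [sub_self] at this
      exact this.mono_left nhdsWithin_le_nhds
    rw [hasDerivWithinAt_iff_isLittleO]
    have hlit := hpO.trans_isLittleO (habs.comp_tendsto htend)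
    have hp0 : p ≠ 0 := by linarith
    refine hlit.congr' (Eventually.of_forall fun s => ?_) (Eventually.of_forall fun s => rfl)
    simp [hz, Real.zero_rpow hp0]
  · have h1 := (hq.sqrt h0.ne').rpow_const (p := p) (Or.inl (Real.sqrt_pos.2 h0).ne')
    convert! h1 using 1
    have hs := Real.sqrt_pos.2 h0
    have h2 : √(ξ t ⬝ᵥ (A t)⁻¹ *ᵥ ξ t) ^ (p - 1)
        = √(ξ t ⬝ᵥ (A t)⁻¹ *ᵥ ξ t) ^ (p - 2) * √(ξ t ⬝ᵥ (A t)⁻¹ *ᵥ ξ t) := by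
      rw [← Real.rpow_add_one hs.ne']
      ring_nf
    rw [h2]
    field_simp

/-- The derivative of the volume density. -/
theorem hasDerivWithinAt_sqrt_det {A : ℝ → Matrix ι ι ℝ} {A' : Matrix ι ι ℝ} {J : Set ℝ} {t : ℝ}
    (hA : ∀ i j, HasDerivWithinAt (fun s => A s i j) (A' i j) J t)
    (hpos : (A t).PosDef) {c : ℝ} (hc : 0 < c) :
    HasDerivWithinAt (fun s => √((A s).det / c))
      (√((A t).det / c) * (1 / 2 * ((A t)⁻¹ * A').trace)) J t := by
  have hd := hpos.det_pos
  have h1 := ((hasDerivWithinAt_det hA).div_const c).sqrt (div_pos hd hc).ne'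
  convert! h1 using 1
  have h2 : (A t).adjugate = (A t).det • (A t)⁻¹ := by
    rw [inv_def, Ring.inverse_eq_inv', smul_smul, mul_inv_cancel₀ hd.ne', one_smul]
  rw [h2, smul_mul, trace_smul, smul_eq_mul]
  have hs : 0 < √((A t).det / c) := Real.sqrt_pos.2 (div_pos hd hc)
  have h3 : (A t).det / c = √((A t).det / c) * √((A t).det / c) :=
    (Real.mul_self_sqrt (div_pos hd hc).le).symm
  rw [eq_div_iff (by positivity), mul_div_right_comm, h3]
  simp only [Real.sqrt_mul_self hs.le]
  ring

theorem continuousWithinAt_inv {X : Type*} [TopologicalSpace X] {A : X → Matrix ι ι ℝ} {U : Set X}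
    {x : X} (hA : ContinuousWithinAt A U x) (h0 : (A x).det ≠ 0) :
    ContinuousWithinAt (fun y => (A y)⁻¹) U x := by
  have hdet : ContinuousWithinAt (fun y => (A y).det) U x :=
    (continuous_id.matrix_det.tendsto (A x)).comp hA
  have hadj : ContinuousWithinAt (fun y => (A y).adjugate) U x :=
    (continuous_id.matrix_adjugate.tendsto (A x)).comp hA
  simp only [inv_def, Ring.inverse_eq_inv']
  exact (hdet.inv₀ h0).smul hadj

/-! Invariance under a change of basis -/

theorem congr_inv (A D : Matrix ι ι ℝ) :
    (Dᵀ * A * D)⁻¹ = D⁻¹ * A⁻¹ * (D⁻¹)ᵀ := by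
  rw [Matrix.mul_inv_rev, Matrix.mul_inv_rev, transpose_nonsing_inv, Matrix.mul_assoc]

/-- With `D` the Jacobian of an inverse chart, covectors transform by `Dᵀ` and bilinear forms by
congruence. The pointwise definitions use the preferred chart at each point, which need not vary
continuously; these identities move them to one fixed chart, where continuity can be seen. -/
theorem inv_bilin_congr {A D : Matrix ι ι ℝ} (hD : IsUnit D.det) (ξ η : ι → ℝ) :
    (Dᵀ *ᵥ ξ) ⬝ᵥ (Dᵀ * A * D)⁻¹ *ᵥ (Dᵀ *ᵥ η) = ξ ⬝ᵥ A⁻¹ *ᵥ η := by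
  have h1 : (D⁻¹)ᵀ * Dᵀ = 1 := by rw [← transpose_mul, mul_nonsing_inv _ hD, transpose_one]
  rw [congr_inv, mulVec_mulVec, Matrix.mul_assoc, h1, Matrix.mul_one, mulVec_transpose,
    ← dotProduct_mulVec, mulVec_mulVec, ← Matrix.mul_assoc, mul_nonsing_inv _ hD, Matrix.one_mul]

theorem inv_mulVec_congr {A D : Matrix ι ι ℝ} (hD : IsUnit D.det) (ξ : ι → ℝ) :
    D *ᵥ ((Dᵀ * A * D)⁻¹ *ᵥ (Dᵀ *ᵥ ξ)) = A⁻¹ *ᵥ ξ := by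
  have h1 : (D⁻¹)ᵀ * Dᵀ = 1 := by rw [← transpose_mul, mul_nonsing_inv _ hD, transpose_one]
  have h2 : D⁻¹ * A⁻¹ * (D⁻¹)ᵀ * Dᵀ = D⁻¹ * A⁻¹ := by
    rw [Matrix.mul_assoc, h1, Matrix.mul_one]
  rw [congr_inv, mulVec_mulVec ξ _ Dᵀ, h2, mulVec_mulVec, mul_nonsing_inv_cancel_left _ _ hD]

theorem quadratic_inv_congr {A B D : Matrix ι ι ℝ} (hD : IsUnit D.det) (ξ : ι → ℝ) :
    ((Dᵀ * A * D)⁻¹ *ᵥ (Dᵀ *ᵥ ξ)) ⬝ᵥ (Dᵀ * B * D) *ᵥ ((Dᵀ * A * D)⁻¹ *ᵥ (Dᵀ *ᵥ ξ))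
      = (A⁻¹ *ᵥ ξ) ⬝ᵥ B *ᵥ (A⁻¹ *ᵥ ξ) := by
  have h := inv_mulVec_congr (A := A) hD ξ
  generalize (Dᵀ * A * D)⁻¹ *ᵥ (Dᵀ *ᵥ ξ) = ζ at h ⊢
  rw [← h, ← mulVec_mulVec, ← mulVec_mulVec, dotProduct_mulVec ζ, vecMul_transpose]

theorem trace_inv_congr {A B D : Matrix ι ι ℝ} (hD : IsUnit D.det) :
    ((Dᵀ * A * D)⁻¹ * (Dᵀ * B * D)).trace = (A⁻¹ * B).trace := by
  have h1 : (D⁻¹)ᵀ * Dᵀ = 1 := by rw [← transpose_mul, mul_nonsing_inv _ hD, transpose_one]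
  calc ((Dᵀ * A * D)⁻¹ * (Dᵀ * B * D)).trace
      = (D⁻¹ * A⁻¹ * (((D⁻¹)ᵀ * Dᵀ) * B * D)).trace := by
        rw [congr_inv]; simp only [Matrix.mul_assoc]
    _ = (D * (D⁻¹ * (A⁻¹ * B))).trace := by
        rw [h1, Matrix.one_mul, trace_mul_comm D]; simp only [Matrix.mul_assoc]
    _ = (A⁻¹ * B).trace := by
        rw [← Matrix.mul_assoc, mul_nonsing_inv _ hD, Matrix.one_mul]

end MatrixCalculus

/-! ### Metrics, differentials and contractions in a fixed chart -/

section ChartFormulas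

open Matrix

variable {m : ℕ} {M : Type*} [TopologicalSpace M] [ChartedSpace (EuclideanSpace ℝ (Fin m)) M]

theorem sum_smul_coordVec (v : EuclideanSpace ℝ (Fin m)) : ∑ i, v i • coordVec i = v := by
  ext j
  simp [coordVec, Finset.sum_apply, Pi.single_apply]

theorem bilin_apply_eq_sum (B : EuclideanSpace ℝ (Fin m) →ₗ[ℝ] EuclideanSpace ℝ (Fin m) →ₗ[ℝ] ℝ)
    (v w : EuclideanSpace ℝ (Fin m)) :
    B v w = ∑ i, ∑ j, v i * w j * B (coordVec i) (coordVec j) := by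
  conv_lhs => rw [← sum_smul_coordVec v, ← sum_smul_coordVec w]
  simp only [map_sum, LinearMap.sum_apply, map_smul, LinearMap.smul_apply, smul_eq_mul,
    Finset.mul_sum]
  rw [Finset.sum_comm]
  exact Finset.sum_congr rfl fun i _ => Finset.sum_congr rfl fun j _ => by ring

/-- The derivative of the inverse of the preferred chart at `x₀`. -/
def symmDeriv (x₀ : M) (y : EuclideanSpace ℝ (Fin m)) :
    EuclideanSpace ℝ (Fin m) →L[ℝ] EuclideanSpace ℝ (Fin m) :=
  mfderiv 𝓘(ℝ, EuclideanSpace ℝ (Fin m)) (𝓡 m) (extChartAt (𝓡 m) x₀).symm y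

/-- The Jacobian matrix of the inverse of the preferred chart at `x₀`. -/
def chartJacobian (x₀ : M) (y : EuclideanSpace ℝ (Fin m)) : Matrix (Fin m) (Fin m) ℝ :=
  Matrix.of fun j i => symmDeriv x₀ y (coordVec i) j

/-- A tensor field which is bilinear on every tangent space. -/
def IsBilinearField (g : TensorField m M) : Prop :=
  ∀ x, ∃ B : EuclideanSpace ℝ (Fin m) →ₗ[ℝ] EuclideanSpace ℝ (Fin m) →ₗ[ℝ] ℝ,
    ∀ v w : EuclideanSpace ℝ (Fin m), g x v w = B v w

theorem IsBilinearField.apply_eq {g : TensorField m M} (hg : IsBilinearField g) (x : M)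
    (v w : EuclideanSpace ℝ (Fin m)) :
    g x v w = ∑ i, ∑ j, v i * w j * metricMatrix g x i j := by
  obtain ⟨B, hB⟩ := hg x
  rw [hB, bilin_apply_eq_sum]
  exact Finset.sum_congr rfl fun i _ => Finset.sum_congr rfl fun j _ => by rw [← hB]; rfl

theorem chartMatrix_apply (g : TensorField m M) (x₀ : M) (y : EuclideanSpace ℝ (Fin m))
    (i j : Fin m) : chartMatrix g x₀ y i j = g ((extChartAt (𝓡 m) x₀).symm y)
      (symmDeriv x₀ y (coordVec i)) (symmDeriv x₀ y (coordVec j)) := rfl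

theorem chartMatrix_eq {g : TensorField m M} (hg : IsBilinearField g) (x₀ : M)
    (y : EuclideanSpace ℝ (Fin m)) :
    chartMatrix g x₀ y = (chartJacobian x₀ y)ᵀ
      * metricMatrix g ((extChartAt (𝓡 m) x₀).symm y) * chartJacobian x₀ y := by
  ext i j
  rw [chartMatrix_apply, hg.apply_eq]
  simp only [mul_apply, transpose_apply, chartJacobian, of_apply, Finset.sum_mul]
  rw [Finset.sum_comm]
  refine Finset.sum_congr rfl fun k _ => Finset.sum_congr rfl fun l _ => ?_
  ring

theorem IsBilinearField.apply_symmDeriv {g : TensorField m M} (hg : IsBilinearField g) (x₀ : M)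
    (y v w : EuclideanSpace ℝ (Fin m)) :
    g ((extChartAt (𝓡 m) x₀).symm y) (symmDeriv x₀ y v) (symmDeriv x₀ y w)
      = ∑ i, ∑ j, v i * w j * chartMatrix g x₀ y i j := by
  obtain ⟨B, hB⟩ := hg ((extChartAt (𝓡 m) x₀).symm y)
  refine ((hB _ _).trans (bilin_apply_eq_sum (B.compl₁₂ (symmDeriv x₀ y).toLinearMap
    (symmDeriv x₀ y).toLinearMap) v w)).trans ?_
  exact Finset.sum_congr rfl fun i _ => Finset.sum_congr rfl fun j _ => by
    rw [chartMatrix_apply, hB]; rfl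

theorem chartJacobian_mulVec (x₀ : M) (y v : EuclideanSpace ℝ (Fin m)) (j : Fin m) :
    (chartJacobian x₀ y *ᵥ v) j = symmDeriv x₀ y v j := by
  conv_rhs => rw [← sum_smul_coordVec v]
  simp [mulVec, dotProduct, chartJacobian, map_sum, mul_comm]

/-- The tangent space at `x` is identified with the model space through the preferred chart at `x`,
so in that identification the differential of this chart at its centre is the identity. Hence the
components at `x` are honest coordinate components. -/
theorem symmDeriv_self [IsManifold (𝓡 m) ∞ M] (x : M) :
    symmDeriv x (extChartAt (𝓡 m) x x) = ContinuousLinearMap.id ℝ _ := by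
  have : IsManifold (𝓡 m) 1 M := IsManifold.of_le (n := ∞) (by simp)
  have h := mfderivWithin_range_extChartAt_symm (I := 𝓡 m) (x := x)
  rw [ModelWithCorners.range_eq_univ, mfderivWithin_univ] at h
  exact h

theorem chartJacobian_self [IsManifold (𝓡 m) ∞ M] (x : M) :
    chartJacobian x (extChartAt (𝓡 m) x x) = 1 := by
  ext i j
  rw [chartJacobian, symmDeriv_self]
  simp [coordVec, one_apply]

theorem chartMatrix_self [IsManifold (𝓡 m) ∞ M] {g : TensorField m M} (hg : IsBilinearField g)
    (x : M) : chartMatrix g x (extChartAt (𝓡 m) x x) = metricMatrix g x := by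
  rw [chartMatrix_eq hg, chartJacobian_self, extChartAt_to_inv]
  simp

theorem symmDeriv_injective [IsManifold (𝓡 m) ∞ M] (x₀ : M) {y : EuclideanSpace ℝ (Fin m)}
    (hy : y ∈ (extChartAt (𝓡 m) x₀).target) : Function.Injective (symmDeriv x₀ y) := by
  have : IsManifold (𝓡 m) 1 M := IsManifold.of_le (n := ∞) (by simp)
  have h := mfderiv_extChartAt_comp_mfderivWithin_extChartAt_symm (I := 𝓡 m) hy
  rw [ModelWithCorners.range_eq_univ, mfderivWithin_univ] at h
  exact Function.LeftInverse.injective fun v => DFunLike.congr_fun h v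

theorem isUnit_det_chartJacobian [IsManifold (𝓡 m) ∞ M] (x₀ : M) {y : EuclideanSpace ℝ (Fin m)}
    (hy : y ∈ (extChartAt (𝓡 m) x₀).target) : IsUnit (chartJacobian x₀ y).det := by
  rw [← isUnit_iff_isUnit_det, ← mulVec_injective_iff_isUnit]
  intro v w hvw
  have : symmDeriv x₀ y (WithLp.toLp 2 v) = symmDeriv x₀ y (WithLp.toLp 2 w) := by
    ext j
    rw [← chartJacobian_mulVec, ← chartJacobian_mulVec]
    exact congrFun hvw j
  exact (WithLp.toLp_injective 2) (symmDeriv_injective x₀ hy this)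

theorem target_mem_nhds (x₀ : M) {y : EuclideanSpace ℝ (Fin m)}
    (hy : y ∈ (extChartAt (𝓡 m) x₀).target) : (extChartAt (𝓡 m) x₀).target ∈ 𝓝 y :=
  (isOpen_extChartAt_target x₀).mem_nhds hy

theorem contMDiffAt_extChartAt_symm [IsManifold (𝓡 m) ∞ M] (x₀ : M)
    {y : EuclideanSpace ℝ (Fin m)} (hy : y ∈ (extChartAt (𝓡 m) x₀).target) :
    ContMDiffAt 𝓘(ℝ, EuclideanSpace ℝ (Fin m)) (𝓡 m) ∞ (extChartAt (𝓡 m) x₀).symm y :=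
  (contMDiffWithinAt_extChartAt_symm_target x₀ hy).contMDiffAt (target_mem_nhds x₀ hy)

theorem mdifferentiableAt_extChartAt_symm [IsManifold (𝓡 m) ∞ M] (x₀ : M)
    {y : EuclideanSpace ℝ (Fin m)} (hy : y ∈ (extChartAt (𝓡 m) x₀).target) :
    MDifferentiableAt 𝓘(ℝ, EuclideanSpace ℝ (Fin m)) (𝓡 m) (extChartAt (𝓡 m) x₀).symm y :=
  (contMDiffAt_extChartAt_symm x₀ hy).mdifferentiableAt (by simp)

/-- The differential of a function as a covector in coordinates. -/
theorem fderiv_comp_symm [IsManifold (𝓡 m) ∞ M] {u : M → ℝ} {x₀ : M}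
    {y : EuclideanSpace ℝ (Fin m)} (hy : y ∈ (extChartAt (𝓡 m) x₀).target)
    (hu : MDifferentiableAt (𝓡 m) 𝓘(ℝ, ℝ) u ((extChartAt (𝓡 m) x₀).symm y)) :
    (fun i => fderiv ℝ (fun z => u ((extChartAt (𝓡 m) x₀).symm z)) y (coordVec i))
      = (chartJacobian x₀ y)ᵀ *ᵥ partialAt (m := m) u ((extChartAt (𝓡 m) x₀).symm y) := by
  have h := mfderiv_comp y hu (mdifferentiableAt_extChartAt_symm x₀ hy)
  rw [mfderiv_eq_fderiv] at h
  funext i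
  have h2 := DFunLike.congr_fun h (coordVec i)
  -- `L` is the differential regarded as a functional on the model space, so that it can be expanded
  -- over the coordinate vectors.
  obtain ⟨L, hL⟩ : ∃ L : EuclideanSpace ℝ (Fin m) →L[ℝ] ℝ,
    L = mfderiv (𝓡 m) 𝓘(ℝ, ℝ) u ((extChartAt (𝓡 m) x₀).symm y) := ⟨_, rfl⟩
  have hp : ∀ j, partialAt (m := m) u ((extChartAt (𝓡 m) x₀).symm y) j = L (coordVec j) := by
    intro j
    rw [hL]
    rfl
  have h3 : fderiv ℝ (fun z => u ((extChartAt (𝓡 m) x₀).symm z)) y (coordVec i)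
      = L (symmDeriv x₀ y (coordVec i)) := by
    rw [hL]
    exact h2
  rw [h3]
  conv_lhs => rw [← sum_smul_coordVec (symmDeriv x₀ y (coordVec i))]
  simp only [map_sum, map_smul, mulVec, dotProduct, transpose_apply, chartJacobian, of_apply,
    smul_eq_mul, hp]

theorem partialAt_eq_fderiv [IsManifold (𝓡 m) ∞ M] {u : M → ℝ} {x : M}
    (hu : MDifferentiableAt (𝓡 m) 𝓘(ℝ, ℝ) u x) (i : Fin m) :
    partialAt (m := m) u x i
      = fderiv ℝ (fun z => u ((extChartAt (𝓡 m) x).symm z)) (extChartAt (𝓡 m) x x)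
        (coordVec i) := by
  have h := fderiv_comp_symm (u := u) (mem_extChartAt_target (I := 𝓡 m) x)
    (by rwa [extChartAt_to_inv])
  rw [extChartAt_to_inv, chartJacobian_self] at h
  have := congrFun h i
  simpa using this.symm

theorem gradInner_eq (g : TensorField m M) (u φ : M → ℝ) (x : M) :
    gradInner g u φ x = partialAt (m := m) u x ⬝ᵥ (metricMatrix g x)⁻¹
      *ᵥ partialAt (m := m) φ x := by
  simp only [gradInner, dotProduct, mulVec, Finset.mul_sum]
  exact Finset.sum_congr rfl fun i _ => Finset.sum_congr rfl fun j _ => by ring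

/-- The contraction pairs equal index positions while the trace of a product transposes one factor;
symmetry of the inverse metric reconciles them, so `h` need not be symmetric. -/
theorem traceWith_eq {g : TensorField m M} (h : TensorField m M) {x : M}
    (hg : (metricMatrix g x).IsHermitian) :
    traceWith g h x = ((metricMatrix g x)⁻¹ * metricMatrix h x).trace := by
  have hT : ∀ i j, (metricMatrix g x)⁻¹ i j = (metricMatrix g x)⁻¹ j i := by
    intro i j
    simpa using (hg.inv.apply i j).symm
  simp only [traceWith, trace, diag_apply, mul_apply]
  rw [Finset.sum_comm]
  exact Finset.sum_congr rfl fun i _ => Finset.sum_congr rfl fun j _ => by rw [hT]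

/-- Raising both indices of `h` and pairing with `du` twice is evaluating `h` on the gradient `g⁻¹
du`; this uses the symmetry of `g⁻¹` only. -/
theorem raisedQuad_eq {g : TensorField m M} (h : TensorField m M) (u : M → ℝ) {x : M}
    (hg : (metricMatrix g x).IsHermitian) :
    raisedQuad g h u x = ((metricMatrix g x)⁻¹ *ᵥ partialAt (m := m) u x) ⬝ᵥ metricMatrix h x
      *ᵥ ((metricMatrix g x)⁻¹ *ᵥ partialAt (m := m) u x) := by
  have hT : ∀ i j, (metricMatrix g x)⁻¹ i j = (metricMatrix g x)⁻¹ j i := by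
    intro i j
    simpa using (hg.inv.apply i j).symm
  set a := (metricMatrix g x)⁻¹
  set b := metricMatrix h x
  set ξ := partialAt (m := m) u x
  have lhs : raisedQuad g h u x
      = ∑ k, ∑ l, ∑ i, ∑ j, a i k * a j l * b k l * ξ i * ξ j := by
    simp only [raisedQuad, Finset.sum_mul]
    calc _ = ∑ i, ∑ j, ∑ k, ∑ l, a i k * a j l * b k l * ξ i * ξ j := rfl
      _ = ∑ i, ∑ k, ∑ j, ∑ l, a i k * a j l * b k l * ξ i * ξ j :=
        Finset.sum_congr rfl fun i _ => Finset.sum_comm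
      _ = ∑ k, ∑ i, ∑ j, ∑ l, a i k * a j l * b k l * ξ i * ξ j := Finset.sum_comm
      _ = ∑ k, ∑ i, ∑ l, ∑ j, a i k * a j l * b k l * ξ i * ξ j :=
        Finset.sum_congr rfl fun k _ => Finset.sum_congr rfl fun i _ => Finset.sum_comm
      _ = _ := Finset.sum_congr rfl fun k _ => Finset.sum_comm
  rw [lhs]
  simp only [dotProduct, mulVec]
  refine Finset.sum_congr rfl fun k _ => ?_
  rw [Finset.mul_sum]
  refine Finset.sum_congr rfl fun l _ => ?_
  rw [Finset.sum_mul]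
  refine Finset.sum_congr rfl fun i _ => ?_
  rw [Finset.mul_sum, Finset.mul_sum]
  refine Finset.sum_congr rfl fun j _ => ?_
  rw [hT i k, hT j l]
  ring

/-- The coordinate expression of a smooth metric is smooth. -/
theorem contDiffAt_chartMatrix [IsManifold (𝓡 m) ∞ M]
    (g : Bundle.ContMDiffRiemannianMetric (𝓡 m) ∞ (EuclideanSpace ℝ (Fin m))
      (fun x : M => TangentSpace (𝓡 m) x)) (x₀ : M) {y : EuclideanSpace ℝ (Fin m)}
    (hy : y ∈ (extChartAt (𝓡 m) x₀).target) (i j : Fin m) :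
    ContDiffAt ℝ ∞ (fun z => chartMatrix (metricField g) x₀ z i j) y := by
  have : IsManifold (𝓡 m) 1 M := IsManifold.of_le (n := ∞) (by simp)
  set φ := extChartAt (𝓡 m) x₀
  -- The coordinate vector fields are smooth sections of the tangent bundle, being the tangent map
  -- of the inverse chart applied to constant fields.
  have hsec : ∀ i : Fin m, ContMDiffWithinAt 𝓘(ℝ, EuclideanSpace ℝ (Fin m)) (𝓡 m).tangent ∞
      (fun z => (⟨φ.symm z, symmDeriv x₀ z (coordVec i)⟩ : TangentBundle (𝓡 m) M))
      φ.target y := by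
    intro i
    have h1 := (contMDiffOn_extChartAt_symm (I := 𝓡 m) (n := ∞) x₀).contMDiffOn_tangentMapWithin
      (m := ∞) (by simp) (isOpen_extChartAt_target x₀).uniqueMDiffOn
    have h2 : ContMDiffAt 𝓘(ℝ, EuclideanSpace ℝ (Fin m)) 𝓘(ℝ, EuclideanSpace ℝ (Fin m)).tangent ∞
        (fun z => (⟨z, (coordVec i : EuclideanSpace ℝ (Fin m))⟩ :
          TangentBundle 𝓘(ℝ, EuclideanSpace ℝ (Fin m)) (EuclideanSpace ℝ (Fin m)))) y :=
      contMDiffAt_vectorSpace_iff_contDiffAt.2 contDiffAt_const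
    have h3 := (h1 ⟨y, (coordVec i : EuclideanSpace ℝ (Fin m))⟩ hy).comp (s := φ.target) y
      h2.contMDiffWithinAt (fun z hz => hz)
    refine h3.congr_of_eventuallyEq ?_ ?_
    · filter_upwards [self_mem_nhdsWithin] with z hz
      simp only [Function.comp_def, tangentMapWithin]
      rw [mfderivWithin_of_isOpen (isOpen_extChartAt_target x₀) hz]
      rfl
    · simp only [Function.comp_def, tangentMapWithin]
      rw [mfderivWithin_of_isOpen (isOpen_extChartAt_target x₀) hy]
      rfl
  -- The metric is a smooth section of a bundle of bilinear forms; evaluated on smooth fields it is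
  -- a smooth section of the trivial line bundle, whose fibre component is the matrix entry.
  have h4 : ContMDiffWithinAt 𝓘(ℝ, EuclideanSpace ℝ (Fin m)) ((𝓡 m).prod 𝓘(ℝ)) ∞
      (fun z => Bundle.TotalSpace.mk' ℝ (E := Bundle.Trivial M ℝ) (φ.symm z)
        (g.inner (φ.symm z) (symmDeriv x₀ z (coordVec i)) (symmDeriv x₀ z (coordVec j))))
      φ.target y := by
    apply ContMDiffWithinAt.clm_bundle_apply₂ (F₁ := EuclideanSpace ℝ (Fin m))
      (F₂ := EuclideanSpace ℝ (Fin m))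
    · exact ContMDiffAt.comp_contMDiffWithinAt y g.contMDiff.contMDiffAt
        (contMDiffAt_extChartAt_symm x₀ hy).contMDiffWithinAt
    · exact hsec i
    · exact hsec j
  simp only [Bundle.contMDiffWithinAt_totalSpace] at h4
  exact (h4.2.contMDiffAt (target_mem_nhds x₀ hy)).contDiffAt

end ChartFormulas

/-! ### Space and time slices of functions on a product with an interval -/

section Slices

variable {E F : Type*} [NormedAddCommGroup E] [NormedSpace ℝ E] [NormedAddCommGroup F]
  [NormedSpace ℝ F] {J : Set ℝ} {G : E × ℝ → F} {y : E} {s : ℝ}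

theorem hasFDerivAt_slice (hs : s ∈ J)
    (hG : DifferentiableWithinAt ℝ G (univ ×ˢ J) (y, s)) :
    HasFDerivAt (fun y => G (y, s))
      ((fderivWithin ℝ G (univ ×ˢ J) (y, s)).comp (ContinuousLinearMap.inl ℝ E ℝ)) y := by
  rw [← hasFDerivWithinAt_univ]
  exact hG.hasFDerivWithinAt.comp y (hasFDerivAt_prodMk_left y s).hasFDerivWithinAt
    (fun z _ => (⟨mem_univ _, hs⟩ : ((z, s) : E × ℝ) ∈ univ ×ˢ J))

theorem hasDerivWithinAt_slice (hG : DifferentiableWithinAt ℝ G (univ ×ˢ J) (y, s)) :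
    HasDerivWithinAt (fun s => G (y, s)) (fderivWithin ℝ G (univ ×ˢ J) (y, s) (0, 1)) J s := by
  have h := hG.hasFDerivWithinAt.comp s (hasFDerivAt_prodMk_right y s).hasFDerivWithinAt
    (fun z hz => (⟨mem_univ _, hz⟩ : ((y, z) : E × ℝ) ∈ univ ×ˢ J))
  simpa using! h.hasDerivWithinAt

omit [NormedSpace ℝ E] in
theorem nhdsWithin_univ_prod (J : Set ℝ) (y : E) (s : ℝ) :
    𝓝[univ ×ˢ J] (y, s) = 𝓝 y ×ˢ 𝓝[J] s := by
  rw [nhdsWithin_prod_eq, nhdsWithin_univ]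

/-- Exchange of `∂ₛ` and `∂ᵧ` for a function of which `∂ₛ` is of class `C¹`. -/
theorem hasDerivWithinAt_fderiv_slice (hJ : Convex ℝ J) (hJu : UniqueDiffOn ℝ J) (hs : s ∈ J)
    {V : E × ℝ → F}
    (hG : ∀ᶠ q in 𝓝[univ ×ˢ J] (y, s), DifferentiableWithinAt ℝ G (univ ×ˢ J) q)
    (hV : ∀ᶠ q in 𝓝[univ ×ˢ J] (y, s), HasDerivWithinAt (fun r => G (q.1, r)) (V q) J q.2)
    (hVd : ∀ᶠ q in 𝓝[univ ×ˢ J] (y, s), ContDiffWithinAt ℝ 1 V (univ ×ˢ J) q) :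
    HasDerivWithinAt (fun r => fderiv ℝ (fun z => G (z, r)) y)
      (fderiv ℝ (fun z => V (z, s)) y) J s := by
  have hmem : (y, s) ∈ (univ : Set E) ×ˢ J := ⟨mem_univ _, hs⟩
  have hu : UniqueDiffOn ℝ ((univ : Set E) ×ˢ J) := uniqueDiffOn_univ.prod hJu
  have hswap : Tendsto Prod.swap (𝓝[J] s ×ˢ 𝓝 y) (𝓝[univ ×ˢ J] (y, s)) := by
    rw [nhdsWithin_univ_prod]
    exact tendsto_snd.prodMk tendsto_fst
  have hin : ∀ᶠ z in 𝓝[J] s ×ˢ 𝓝 y, z.1 ∈ J :=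
    tendsto_fst.eventually self_mem_nhdsWithin
  have hG0 : ∀ᶠ r in 𝓝[J] s, DifferentiableWithinAt ℝ G (univ ×ˢ J) (y, r) := by
    rw [nhdsWithin_univ_prod] at hG
    exact (hG.curry.self_of_nhds)
  have hb : ∀ᶠ z in 𝓝[J] s ×ˢ 𝓝 y, HasFDerivAt (fun w => V (w, z.1))
      ((fderivWithin ℝ V (univ ×ˢ J) (z.2, z.1)).comp (ContinuousLinearMap.inl ℝ E ℝ)) z.2 := by
    filter_upwards [hswap.eventually hVd, hin] with z hz hz1
    exact hasFDerivAt_slice hz1 (hz.differentiableWithinAt (by simp))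
  have hV0 : ContDiffWithinAt ℝ 1 V (univ ×ˢ J) (y, s) := hVd.self_of_nhdsWithin hmem
  have hcont : ContinuousWithinAt (fderivWithin ℝ V (univ ×ˢ J)) (univ ×ˢ J) (y, s) :=
    (hV0.fderivWithin_right (m := 0) hu (by simp) hmem).continuousWithinAt
  have key := hasDerivWithinAt_fderiv_of_mixed (u := fun r z => G (z, r)) (v := fun r z => V (z, r))
    (b := fun r z => (fderivWithin ℝ V (univ ×ˢ J) (z, r)).comp (ContinuousLinearMap.inl ℝ E ℝ))
    hJ hs (y₀ := y) ?_ ?_ hb ?_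
  · rw [(hasFDerivAt_slice hs (hV0.differentiableWithinAt (by simp))).fderiv]
    exact key
  · filter_upwards [hG0, self_mem_nhdsWithin] with r hr hrJ
    exact (hasFDerivAt_slice hrJ hr).differentiableAt
  · exact hswap.eventually hV
  · have h1 : Tendsto (fun L : E × ℝ →L[ℝ] F => L.comp (ContinuousLinearMap.inl ℝ E ℝ))
        (𝓝 (fderivWithin ℝ V (univ ×ˢ J) (y, s)))
        (𝓝 ((fderivWithin ℝ V (univ ×ˢ J) (y, s)).comp (ContinuousLinearMap.inl ℝ E ℝ))) :=
      (ContinuousLinearMap.precomp F (ContinuousLinearMap.inl ℝ E ℝ)).continuous.tendsto _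
    exact h1.comp (hcont.tendsto.comp hswap)

end Slices

/-! ### Derivatives of matrix-valued bilinear forms and the Christoffel symbols -/

section FormDerivative

variable {m : ℕ}

/-- The bilinear form of a matrix. -/
def matForm (A : Matrix (Fin m) (Fin m) ℝ) (v w : EuclideanSpace ℝ (Fin m)) : ℝ :=
  ∑ a, ∑ b, v a * w b * A a b

/-- The derivative in the direction `u` of the bilinear form of a matrix-valued function. -/
def matFormDeriv (G : EuclideanSpace ℝ (Fin m) → Matrix (Fin m) (Fin m) ℝ)
    (z u v w : EuclideanSpace ℝ (Fin m)) : ℝ :=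
  ∑ a, ∑ b, v a * w b * fderiv ℝ (fun y => G y a b) z u

theorem matForm_symm {A : Matrix (Fin m) (Fin m) ℝ} (hA : ∀ a b, A a b = A b a)
    (v w : EuclideanSpace ℝ (Fin m)) : matForm A v w = matForm A w v := by
  rw [matForm, Finset.sum_comm]
  exact Finset.sum_congr rfl fun a _ => Finset.sum_congr rfl fun b _ => by rw [hA]; ring

theorem matForm_add_left (A : Matrix (Fin m) (Fin m) ℝ) (v v' w : EuclideanSpace ℝ (Fin m)) :
    matForm A (v + v') w = matForm A v w + matForm A v' w := by
  simp [matForm, add_mul, Finset.sum_add_distrib]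

theorem hasDerivWithinAt_matForm {G : EuclideanSpace ℝ (Fin m) → Matrix (Fin m) (Fin m) ℝ}
    {z v w : ℝ → EuclideanSpace ℝ (Fin m)} {z' v' w' : EuclideanSpace ℝ (Fin m)} {J : Set ℝ} {t : ℝ}
    (hG : ∀ a b, DifferentiableAt ℝ (fun y => G y a b) (z t))
    (hz : HasDerivWithinAt z z' J t) (hv : HasDerivWithinAt v v' J t)
    (hw : HasDerivWithinAt w w' J t) :
    HasDerivWithinAt (fun s => matForm (G (z s)) (v s) (w s))
      (matForm (G (z t)) v' (w t) + matForm (G (z t)) (v t) w'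
        + matFormDeriv G (z t) z' (v t) (w t)) J t := by
  have hcoord : ∀ {c : ℝ → EuclideanSpace ℝ (Fin m)} {c' : EuclideanSpace ℝ (Fin m)},
      HasDerivWithinAt c c' J t → ∀ a, HasDerivWithinAt (fun s => c s a) (c' a) J t :=
    fun hc a => (EuclideanSpace.proj (𝕜 := ℝ) a).hasFDerivAt.comp_hasDerivWithinAt t hc
  have h := HasDerivWithinAt.fun_sum (u := Finset.univ) fun a _ =>
    HasDerivWithinAt.fun_sum (u := Finset.univ) fun b _ =>
      ((hcoord hv a).mul (hcoord hw b)).mul ((hG a b).hasFDerivAt.comp_hasDerivWithinAt t hz)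
  refine h.congr_deriv ?_
  simp only [matForm, matFormDeriv, ← Finset.sum_add_distrib]
  refine Finset.sum_congr rfl fun a _ => Finset.sum_congr rfl fun b _ => ?_
  simp only [Function.comp_apply, Pi.mul_apply]
  ring

theorem fderiv_eq_sum_partialDeriv (f : EuclideanSpace ℝ (Fin m) → ℝ)
    (z u : EuclideanSpace ℝ (Fin m)) : fderiv ℝ f z u = ∑ c, u c * partialDeriv c f z := by
  conv_lhs => rw [← sum_smul_coordVec u]
  simp [map_sum, partialDeriv]

/-- Lowering the upper index of the Christoffel symbols. -/
theorem sum_mul_christoffel {G : EuclideanSpace ℝ (Fin m) → Matrix (Fin m) (Fin m) ℝ}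
    {z : EuclideanSpace ℝ (Fin m)} (hsymm : ∀ a b, G z a b = G z b a) (hG : IsUnit (G z).det)
    (e c d : Fin m) :
    ∑ k, G z k e * christoffel G k c d z = 1 / 2 *
      (partialDeriv c (fun y => G y d e) z + partialDeriv d (fun y => G y c e) z
        - partialDeriv e (fun y => G y c d) z) := by
  have hinv : ∀ l, ∑ k, G z e k * (G z)⁻¹ k l = if e = l then 1 else 0 := by
    intro l
    have := congrFun (congrFun (Matrix.mul_nonsing_inv _ hG) e) l
    rwa [Matrix.mul_apply, Matrix.one_apply] at this
  simp only [christoffel]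
  set c₀ := fun l => partialDeriv c (fun y => G y d l) z + partialDeriv d (fun y => G y c l) z
        - partialDeriv l (fun y => G y c d) z with hc₀
  calc ∑ k, G z k e * (1 / 2 * ∑ l, (G z)⁻¹ k l * c₀ l)
      = 1 / 2 * ∑ l, (∑ k, G z e k * (G z)⁻¹ k l) * c₀ l := by
        simp only [Finset.mul_sum, Finset.sum_mul]
        rw [Finset.sum_comm]
        exact Finset.sum_congr rfl fun l _ => Finset.sum_congr rfl fun k _ => by
          rw [hsymm k e]; ring
    _ = _ := by simp [hinv, hc₀]

/-- The Koszul formula in coordinates: pairing with the metric cancels the inverse metric in the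
Christoffel symbols. What remains are first derivatives of `G`, of the kind produced by
differentiating an orthogonality relation. -/
theorem matForm_christoffel {G : EuclideanSpace ℝ (Fin m) → Matrix (Fin m) (Fin m) ℝ}
    {z : EuclideanSpace ℝ (Fin m)} (hsymm : ∀ a b, G z a b = G z b a) (hG : IsUnit (G z).det)
    (u v w : EuclideanSpace ℝ (Fin m)) :
    matForm (G z) (WithLp.toLp 2 fun k => ∑ a, ∑ b, christoffel G k a b z * v a * w b) u
      = 1 / 2 * (matFormDeriv G z v w u + matFormDeriv G z w v u - matFormDeriv G z u v w) := by
  have h1 : matForm (G z) (WithLp.toLp 2 fun k => ∑ a, ∑ b, christoffel G k a b z * v a * w b) u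
      = ∑ e, ∑ c, ∑ d, u e * v c * w d * ∑ k, G z k e * christoffel G k c d z := by
    simp only [matForm, Finset.sum_mul, Finset.mul_sum]
    rw [Finset.sum_comm]
    refine Finset.sum_congr rfl fun e _ => ?_
    rw [Finset.sum_comm]
    refine Finset.sum_congr rfl fun c _ => ?_
    rw [Finset.sum_comm]
    exact Finset.sum_congr rfl fun d _ => Finset.sum_congr rfl fun k _ => by ring
  rw [h1]
  simp only [sum_mul_christoffel hsymm hG, matFormDeriv, fderiv_eq_sum_partialDeriv]
  have h2 : ∑ a, ∑ b, w a * u b * ∑ c, v c * partialDeriv c (fun y => G y a b) z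
      = ∑ e, ∑ c, ∑ d, u e * v c * w d * partialDeriv c (fun y => G y d e) z := by
    simp only [Finset.mul_sum]
    rw [Finset.sum_comm]
    refine Finset.sum_congr rfl fun e _ => ?_
    rw [Finset.sum_comm]
    exact Finset.sum_congr rfl fun c _ => Finset.sum_congr rfl fun d _ => by ring
  have h3 : ∑ a, ∑ b, v a * u b * ∑ c, w c * partialDeriv c (fun y => G y a b) z
      = ∑ e, ∑ c, ∑ d, u e * v c * w d * partialDeriv d (fun y => G y c e) z := by
    simp only [Finset.mul_sum]
    rw [Finset.sum_comm]
    exact Finset.sum_congr rfl fun e _ => Finset.sum_congr rfl fun c _ =>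
      Finset.sum_congr rfl fun d _ => by ring
  have h4 : ∑ a, ∑ b, v a * w b * ∑ c, u c * partialDeriv c (fun y => G y a b) z
      = ∑ e, ∑ c, ∑ d, u e * v c * w d * partialDeriv e (fun y => G y c d) z := by
    simp only [Finset.mul_sum]
    refine Eq.trans ?_ Finset.sum_comm
    refine Finset.sum_congr rfl fun a _ => ?_
    rw [Finset.sum_comm]
    exact Finset.sum_congr rfl fun e _ => Finset.sum_congr rfl fun d _ => by ring
  rw [h2, h3, h4]
  simp only [← Finset.sum_add_distrib, ← Finset.sum_sub_distrib, Finset.mul_sum]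
  exact Finset.sum_congr rfl fun e _ => Finset.sum_congr rfl fun c _ =>
    Finset.sum_congr rfl fun d _ => by ring

theorem matFormDeriv_symm {G : EuclideanSpace ℝ (Fin m) → Matrix (Fin m) (Fin m) ℝ}
    {z : EuclideanSpace ℝ (Fin m)} (hsymm : ∀ᶠ y in 𝓝 z, ∀ a b, G y a b = G y b a)
    (u v w : EuclideanSpace ℝ (Fin m)) : matFormDeriv G z u v w = matFormDeriv G z u w v := by
  rw [matFormDeriv, Finset.sum_comm]
  refine Finset.sum_congr rfl fun a _ => Finset.sum_congr rfl fun b _ => ?_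
  have : (fun y => G y b a) =ᶠ[𝓝 z] fun y => G y a b := by
    filter_upwards [hsymm] with y hy using hy b a
  rw [this.fderiv_eq]
  ring

end FormDerivative

/-! ### Positive definiteness of the coordinate matrices -/

section Positivity

open Matrix

variable {m : ℕ} {M : Type*} [TopologicalSpace M] [ChartedSpace (EuclideanSpace ℝ (Fin m)) M]

theorem posDef_metricMatrix {g : TensorField m M} (hg : IsBilinearField g) {x : M}
    (hs : ∀ v w : EuclideanSpace ℝ (Fin m), g x v w = g x w v)
    (hp : ∀ v : EuclideanSpace ℝ (Fin m), v ≠ 0 → 0 < g x v v) : (metricMatrix g x).PosDef := by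
  refine PosDef.of_dotProduct_mulVec_pos ?_ fun v hv => ?_
  · ext i j
    simp only [conjTranspose_apply, star_trivial]
    exact hs _ _
  · have h := hp (WithLp.toLp 2 v) (by simpa using hv)
    have h2 := hg.apply_eq x (WithLp.toLp 2 v) (WithLp.toLp 2 v)
    rw [h2] at h
    refine h.trans_eq ?_
    simp only [dotProduct, mulVec, Finset.mul_sum, star_trivial]
    exact Finset.sum_congr rfl fun i _ => Finset.sum_congr rfl fun j _ => by ring

theorem posDef_chartMatrix [IsManifold (𝓡 m) ∞ M] {g : TensorField m M} (hg : IsBilinearField g)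
    (x₀ : M) {y : EuclideanSpace ℝ (Fin m)} (hy : y ∈ (extChartAt (𝓡 m) x₀).target)
    (hp : (metricMatrix g ((extChartAt (𝓡 m) x₀).symm y)).PosDef) :
    (chartMatrix g x₀ y).PosDef := by
  rw [chartMatrix_eq hg]
  exact hp.conjTranspose_mul_mul_same
    (mulVec_injective_iff_isUnit.2 ((isUnit_iff_isUnit_det _).2 (isUnit_det_chartJacobian x₀ hy)))

theorem isBilinearField_metricField [IsManifold (𝓡 m) ∞ M]
    (g : Bundle.ContMDiffRiemannianMetric (𝓡 m) ∞ (EuclideanSpace ℝ (Fin m))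
      (fun x : M => TangentSpace (𝓡 m) x)) : IsBilinearField (metricField g) := fun x =>
  ⟨LinearMap.mk₂ ℝ (fun v w => g.inner x v w)
    (fun v v' w => DFunLike.congr_fun ((g.inner x).map_add v v') w)
    (fun c v w => DFunLike.congr_fun ((g.inner x).map_smul c v) w)
    (fun v w w' => (g.inner x v).map_add w w')
    (fun c v w => (g.inner x v).map_smul c w), fun _ _ => rfl⟩

theorem posDef_metricMatrix_metricField [IsManifold (𝓡 m) ∞ M]
    (g : Bundle.ContMDiffRiemannianMetric (𝓡 m) ∞ (EuclideanSpace ℝ (Fin m))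
      (fun x : M => TangentSpace (𝓡 m) x)) (x : M) : (metricMatrix (metricField g) x).PosDef :=
  posDef_metricMatrix (isBilinearField_metricField g) (fun v w => g.symm x v w)
    (fun v hv => g.pos x v hv)

theorem posDef_chartMatrix_metricField [IsManifold (𝓡 m) ∞ M]
    (g : Bundle.ContMDiffRiemannianMetric (𝓡 m) ∞ (EuclideanSpace ℝ (Fin m))
      (fun x : M => TangentSpace (𝓡 m) x)) (x₀ : M) {y : EuclideanSpace ℝ (Fin m)}
    (hy : y ∈ (extChartAt (𝓡 m) x₀).target) : (chartMatrix (metricField g) x₀ y).PosDef :=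
  posDef_chartMatrix (isBilinearField_metricField g) x₀ hy (posDef_metricMatrix_metricField g _)

theorem chartMatrix_metricField_symm [IsManifold (𝓡 m) ∞ M]
    (g : Bundle.ContMDiffRiemannianMetric (𝓡 m) ∞ (EuclideanSpace ℝ (Fin m))
      (fun x : M => TangentSpace (𝓡 m) x)) (x₀ : M) (y : EuclideanSpace ℝ (Fin m))
    (a b : Fin m) :
    chartMatrix (metricField g) x₀ y a b = chartMatrix (metricField g) x₀ y b a :=
  g.symm _ _ _

end Positivity

/-! ### The induced metric of an immersion read in charts -/

section Immersion

variable {n : ℕ}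
  {S : Type*} [TopologicalSpace S] [ChartedSpace (EuclideanSpace ℝ (Fin n)) S]
  [IsManifold (𝓡 n) ∞ S]
  {N : Type*} [TopologicalSpace N] [ChartedSpace (EuclideanSpace ℝ (Fin (n + 1))) N]
  [IsManifold (𝓡 (n + 1)) ∞ N]

/-- The differential of a map, in the identifications of the tangent spaces with coordinate
spaces. -/
def coordDeriv (F : S → N) (x : S) :
    EuclideanSpace ℝ (Fin n) →L[ℝ] EuclideanSpace ℝ (Fin (n + 1)) :=
  mfderiv (𝓡 n) (𝓡 (n + 1)) F x

omit [IsManifold (𝓡 n) ∞ S] [IsManifold (𝓡 (n + 1)) ∞ N] in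
theorem isBilinearField_inducedMetric {gN : TensorField (n + 1) N} (hg : IsBilinearField gN)
    (F : S → N) : IsBilinearField (inducedMetric gN F) := fun x => by
  obtain ⟨B, hB⟩ := hg (F x)
  exact ⟨B.compl₁₂ (coordDeriv F x).toLinearMap (coordDeriv F x).toLinearMap,
    fun v w => hB _ _⟩

omit [IsManifold (𝓡 n) ∞ S] in
theorem posDef_metricMatrix_inducedMetric
    (gN : Bundle.ContMDiffRiemannianMetric (𝓡 (n + 1)) ∞ (EuclideanSpace ℝ (Fin (n + 1)))
      (fun y : N => TangentSpace (𝓡 (n + 1)) y)) {F : S → N} {x : S}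
    (hF : Function.Injective (mfderiv (𝓡 n) (𝓡 (n + 1)) F x)) :
    (metricMatrix (inducedMetric (metricField gN) F) x).PosDef :=
  posDef_metricMatrix (isBilinearField_inducedMetric (isBilinearField_metricField gN) F)
    (fun _ _ => gN.symm _ _ _) fun _ hv => gN.pos _ _ fun h0 =>
      hv (hF (h0.trans (coordDeriv F x).map_zero.symm))

omit [IsManifold (𝓡 n) ∞ S] in
theorem symmDeriv_comp_mfderiv (p : N) {q : N} (hq : q ∈ (extChartAt (𝓡 (n + 1)) p).source)
    (w : EuclideanSpace ℝ (Fin (n + 1))) :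
    symmDeriv p (extChartAt (𝓡 (n + 1)) p q)
      (mfderiv (𝓡 (n + 1)) 𝓘(ℝ, EuclideanSpace ℝ (Fin (n + 1))) (extChartAt (𝓡 (n + 1)) p) q w)
      = w := by
  have : IsManifold (𝓡 (n + 1)) 1 N := IsManifold.of_le (n := ∞) (by simp)
  have h := mfderivWithin_extChartAt_symm_comp_mfderiv_extChartAt' (I := 𝓡 (n + 1)) hq
  rw [ModelWithCorners.range_eq_univ, mfderivWithin_univ] at h
  exact DFunLike.congr_fun h w

/-- The differential of a map read in charts. -/
theorem coordDeriv_symmDeriv {F : S → N} {x₀ : S} {p : N} {y : EuclideanSpace ℝ (Fin n)}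
    (hy : y ∈ (extChartAt (𝓡 n) x₀).target)
    (hF : MDifferentiableAt (𝓡 n) (𝓡 (n + 1)) F ((extChartAt (𝓡 n) x₀).symm y))
    (hp : F ((extChartAt (𝓡 n) x₀).symm y) ∈ (extChartAt (𝓡 (n + 1)) p).source)
    (v : EuclideanSpace ℝ (Fin n)) :
    coordDeriv F ((extChartAt (𝓡 n) x₀).symm y) (symmDeriv x₀ y v)
      = symmDeriv p (extChartAt (𝓡 (n + 1)) p (F ((extChartAt (𝓡 n) x₀).symm y)))
          (fderiv ℝ (fun z => extChartAt (𝓡 (n + 1)) p (F ((extChartAt (𝓡 n) x₀).symm z))) y v) := by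
  have : IsManifold (𝓡 (n + 1)) 1 N := IsManifold.of_le (n := ∞) (by simp)
  have hψ : MDifferentiableAt (𝓡 (n + 1)) 𝓘(ℝ, EuclideanSpace ℝ (Fin (n + 1)))
      (extChartAt (𝓡 (n + 1)) p) (F ((extChartAt (𝓡 n) x₀).symm y)) :=
    mdifferentiableAt_extChartAt (by rwa [← extChartAt_source (I := 𝓡 (n + 1))])
  have hsymm := mdifferentiableAt_extChartAt_symm x₀ hy
  have h1 := mfderiv_comp y (hψ.comp _ hF) hsymm
  rw [mfderiv_comp _ hψ hF, mfderiv_eq_fderiv] at h1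
  have h2 := DFunLike.congr_fun h1 v
  have h3 := symmDeriv_comp_mfderiv p hp
    (coordDeriv F ((extChartAt (𝓡 n) x₀).symm y) (symmDeriv x₀ y v))
  rw [← h3]
  exact congrArg _ h2.symm

omit [IsManifold (𝓡 n) ∞ S] in
/-- The velocity of a curve read in a chart. -/
theorem mfderivWithin_eq_symmDeriv {c : ℝ → N} {p : N} {J : Set ℝ} {t : ℝ}
    (hc : MDifferentiableWithinAt 𝓘(ℝ, ℝ) (𝓡 (n + 1)) c J t) (hJ : UniqueDiffWithinAt ℝ J t)
    (hp : c t ∈ (extChartAt (𝓡 (n + 1)) p).source) :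
    (mfderivWithin 𝓘(ℝ, ℝ) (𝓡 (n + 1)) c J t (1 : ℝ) : EuclideanSpace ℝ (Fin (n + 1)))
      = symmDeriv p (extChartAt (𝓡 (n + 1)) p (c t))
          (derivWithin (fun s => extChartAt (𝓡 (n + 1)) p (c s)) J t) := by
  have : IsManifold (𝓡 (n + 1)) 1 N := IsManifold.of_le (n := ∞) (by simp)
  have hψ : MDifferentiableAt (𝓡 (n + 1)) 𝓘(ℝ, EuclideanSpace ℝ (Fin (n + 1)))
      (extChartAt (𝓡 (n + 1)) p) (c t) :=
    mdifferentiableAt_extChartAt (by rwa [← extChartAt_source (I := 𝓡 (n + 1))])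
  have h1 := mfderiv_comp_mfderivWithin t hψ hc hJ.uniqueMDiffWithinAt
  rw [mfderivWithin_eq_fderivWithin] at h1
  have h2 := DFunLike.congr_fun h1 (1 : ℝ)
  have h3 := symmDeriv_comp_mfderiv (n := n) p hp
    (mfderivWithin 𝓘(ℝ, ℝ) (𝓡 (n + 1)) c J t (1 : ℝ))
  rw [← h3]
  exact congrArg _ h2.symm

omit [IsManifold (𝓡 n) ∞ S] in
-- The chart at `p` is kept while `q` moves, so that the ambient metric along the immersion is read
-- through a single matrix function.
theorem metricField_symmDeriv
    (gN : Bundle.ContMDiffRiemannianMetric (𝓡 (n + 1)) ∞ (EuclideanSpace ℝ (Fin (n + 1)))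
      (fun y : N => TangentSpace (𝓡 (n + 1)) y)) (p : N) {q : N}
    (hq : q ∈ (extChartAt (𝓡 (n + 1)) p).source) (v w : EuclideanSpace ℝ (Fin (n + 1))) :
    metricField gN q (symmDeriv p (extChartAt (𝓡 (n + 1)) p q) v)
        (symmDeriv p (extChartAt (𝓡 (n + 1)) p q) w)
      = matForm (chartMatrix (metricField gN) p (extChartAt (𝓡 (n + 1)) p q)) v w := by
  have h := (isBilinearField_metricField gN).apply_symmDeriv p (extChartAt (𝓡 (n + 1)) p q) v w
  rw [← matForm] at h
  rw [← h]
  -- Going to the chart and back returns `q` only up to a propositional equality of base points; the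
  -- forms are compared by substituting that equality while the vectors stay in the model space.
  have hpt : ∀ {a b : N} (_ : a = b) (v w : EuclideanSpace ℝ (Fin (n + 1))),
      metricField gN b v w = metricField gN a v w := by
    rintro a b rfl v w
    rfl
  exact hpt ((extChartAt (𝓡 (n + 1)) p).left_inv hq) _ _

/-- The coordinate expression of the induced metric. -/
theorem chartMatrix_inducedMetric
    (gN : Bundle.ContMDiffRiemannianMetric (𝓡 (n + 1)) ∞ (EuclideanSpace ℝ (Fin (n + 1)))
      (fun y : N => TangentSpace (𝓡 (n + 1)) y)) {F : S → N} {x₀ : S} {p : N}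
    {y : EuclideanSpace ℝ (Fin n)} (hy : y ∈ (extChartAt (𝓡 n) x₀).target)
    (hF : MDifferentiableAt (𝓡 n) (𝓡 (n + 1)) F ((extChartAt (𝓡 n) x₀).symm y))
    (hp : F ((extChartAt (𝓡 n) x₀).symm y) ∈ (extChartAt (𝓡 (n + 1)) p).source) (i j : Fin n) :
    chartMatrix (inducedMetric (metricField gN) F) x₀ y i j
      = matForm (chartMatrix (metricField gN) p
          (extChartAt (𝓡 (n + 1)) p (F ((extChartAt (𝓡 n) x₀).symm y))))
        (fderiv ℝ (fun z => extChartAt (𝓡 (n + 1)) p (F ((extChartAt (𝓡 n) x₀).symm z))) y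
          (coordVec i))
        (fderiv ℝ (fun z => extChartAt (𝓡 (n + 1)) p (F ((extChartAt (𝓡 n) x₀).symm z))) y
          (coordVec j)) := by
  rw [← metricField_symmDeriv gN p hp, ← coordDeriv_symmDeriv hy hF hp,
    ← coordDeriv_symmDeriv hy hF hp]
  rfl

end Immersion

/-! ### Maps on a product with an interval: charts and slices -/

section LocalRepresentation

variable {n : ℕ}
  {S : Type*} [TopologicalSpace S] [ChartedSpace (EuclideanSpace ℝ (Fin n)) S]
  [IsManifold (𝓡 n) ∞ S]

/-- A map on `S × J` read in a chart of `S`. -/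
theorem contMDiffWithinAt_comp_symm {E' H' M' : Type*} [NormedAddCommGroup E'] [NormedSpace ℝ E']
    [TopologicalSpace H'] {I' : ModelWithCorners ℝ E' H'} [TopologicalSpace M'] [ChartedSpace H' M']
    {k : ℕ∞} {J : Set ℝ} {F : S × ℝ → M'}
    (hF : ContMDiffOn ((𝓡 n).prod 𝓘(ℝ, ℝ)) I' k F (univ ×ˢ J)) (x₀ : S)
    {q : EuclideanSpace ℝ (Fin n) × ℝ} (hq : q.1 ∈ (extChartAt (𝓡 n) x₀).target) (hqJ : q.2 ∈ J) :
    ContMDiffWithinAt 𝓘(ℝ, EuclideanSpace ℝ (Fin n) × ℝ) I' k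
      (fun q => F ((extChartAt (𝓡 n) x₀).symm q.1, q.2)) (univ ×ˢ J) q := by
  have h1 : ContMDiffAt (𝓘(ℝ, EuclideanSpace ℝ (Fin n)).prod 𝓘(ℝ, ℝ)) ((𝓡 n).prod 𝓘(ℝ, ℝ)) k
      (fun q : EuclideanSpace ℝ (Fin n) × ℝ => ((extChartAt (𝓡 n) x₀).symm q.1, q.2)) q :=
    (((contMDiffAt_extChartAt_symm x₀ hq).of_le (by exact_mod_cast le_top)).comp q
      contMDiffAt_fst).prodMk contMDiffAt_snd
  have h2 := (hF _ ⟨mem_univ _, hqJ⟩).comp (s := univ ×ˢ J) q h1.contMDiffWithinAt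
    (fun z hz => ⟨mem_univ _, hz.2⟩)
  rw [modelWithCornersSelf_prod, ← chartedSpaceSelf_prod]
  exact h2

theorem contDiffWithinAt_comp_symm {E' : Type*} [NormedAddCommGroup E'] [NormedSpace ℝ E']
    {k : ℕ∞} {J : Set ℝ} {F : S × ℝ → E'}
    (hF : ContMDiffOn ((𝓡 n).prod 𝓘(ℝ, ℝ)) 𝓘(ℝ, E') k F (univ ×ˢ J)) (x₀ : S)
    {q : EuclideanSpace ℝ (Fin n) × ℝ} (hq : q.1 ∈ (extChartAt (𝓡 n) x₀).target) (hqJ : q.2 ∈ J) :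
    ContDiffWithinAt ℝ k (fun q : EuclideanSpace ℝ (Fin n) × ℝ =>
      F ((extChartAt (𝓡 n) x₀).symm q.1, q.2)) (univ ×ˢ J) q :=
  (contMDiffWithinAt_comp_symm hF x₀ hq hqJ).contDiffWithinAt

omit [IsManifold (𝓡 n) ∞ S] in
theorem contMDiff_time_slice {E' H' M' : Type*} [NormedAddCommGroup E'] [NormedSpace ℝ E']
    [TopologicalSpace H'] {I' : ModelWithCorners ℝ E' H'} [TopologicalSpace M'] [ChartedSpace H' M']
    {k : ℕ∞ω} {J : Set ℝ} {F : S × ℝ → M'}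
    (hF : ContMDiffOn ((𝓡 n).prod 𝓘(ℝ, ℝ)) I' k F (univ ×ˢ J)) {t : ℝ} (ht : t ∈ J) :
    ContMDiff (𝓡 n) I' k (fun x => F (x, t)) := by
  have h1 : ContMDiff (𝓡 n) ((𝓡 n).prod 𝓘(ℝ, ℝ)) k (fun x : S => (x, t)) :=
    contMDiff_id.prodMk contMDiff_const
  rw [← contMDiffOn_univ] at h1 ⊢
  exact hF.comp h1 (fun x _ => ⟨mem_univ _, ht⟩)

omit [IsManifold (𝓡 n) ∞ S] in
theorem contMDiffOn_space_slice {E' H' M' : Type*} [NormedAddCommGroup E'] [NormedSpace ℝ E']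
    [TopologicalSpace H'] {I' : ModelWithCorners ℝ E' H'} [TopologicalSpace M'] [ChartedSpace H' M']
    {k : ℕ∞ω} {J : Set ℝ} {F : S × ℝ → M'}
    (hF : ContMDiffOn ((𝓡 n).prod 𝓘(ℝ, ℝ)) I' k F (univ ×ˢ J)) (x : S) :
    ContMDiffOn 𝓘(ℝ, ℝ) I' k (fun t => F (x, t)) J := by
  have h1 : ContMDiff 𝓘(ℝ, ℝ) ((𝓡 n).prod 𝓘(ℝ, ℝ)) k (fun t : ℝ => (x, t)) :=
    contMDiff_const.prodMk contMDiff_id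
  exact hF.comp h1.contMDiffOn (fun t ht => ⟨mem_univ _, ht⟩)

end LocalRepresentation

/-! ### The evolution equation of the induced metric -/

section Evolution

variable {n : ℕ}
  {S : Type*} [TopologicalSpace S] [ChartedSpace (EuclideanSpace ℝ (Fin n)) S]
  [IsManifold (𝓡 n) ∞ S]
  {N : Type*} [TopologicalSpace N] [ChartedSpace (EuclideanSpace ℝ (Fin (n + 1))) N]
  [IsManifold (𝓡 (n + 1)) ∞ N]

/-- A family of maps read in charts, jointly in space and time. -/
def localRep (X : ℝ → S → N) (x₀ : S) (p : N) (q : EuclideanSpace ℝ (Fin n) × ℝ) :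
    EuclideanSpace ℝ (Fin (n + 1)) :=
  extChartAt (𝓡 (n + 1)) p (X q.2 ((extChartAt (𝓡 n) x₀).symm q.1))

/-- The points at which `localRep` is meaningful. -/
def IsLocalPoint (X : ℝ → S → N) (J : Set ℝ) (x₀ : S) (p : N)
    (q : EuclideanSpace ℝ (Fin n) × ℝ) : Prop :=
  q.1 ∈ (extChartAt (𝓡 n) x₀).target ∧ q.2 ∈ J ∧
    X q.2 ((extChartAt (𝓡 n) x₀).symm q.1) ∈ (extChartAt (𝓡 (n + 1)) p).source

variable {X : ℝ → S → N} {J : Set ℝ}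

theorem contDiffWithinAt_localRep
    (hX : ContMDiffOn ((𝓡 n).prod 𝓘(ℝ, ℝ)) (𝓡 (n + 1)) ∞ (fun q : S × ℝ => X q.2 q.1) (univ ×ˢ J))
    {x₀ : S} {p : N} {q : EuclideanSpace ℝ (Fin n) × ℝ} (hq : IsLocalPoint X J x₀ p q) :
    ContDiffWithinAt ℝ ∞ (localRep X x₀ p) (univ ×ˢ J) q := by
  have h1 := contMDiffWithinAt_comp_symm (k := ⊤) hX x₀ hq.1 hq.2.1
  have h2 : ContMDiffAt (𝓡 (n + 1)) 𝓘(ℝ, EuclideanSpace ℝ (Fin (n + 1))) ∞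
      (extChartAt (𝓡 (n + 1)) p) (X q.2 ((extChartAt (𝓡 n) x₀).symm q.1)) :=
    contMDiffAt_extChartAt' (by
      rw [← extChartAt_source (I := 𝓡 (n + 1))]
      exact hq.2.2)
  exact (h2.comp_contMDiffWithinAt q h1).contDiffWithinAt

omit [IsManifold (𝓡 (n + 1)) ∞ N] in
theorem eventually_isLocalPoint
    (hX : ContMDiffOn ((𝓡 n).prod 𝓘(ℝ, ℝ)) (𝓡 (n + 1)) ∞ (fun q : S × ℝ => X q.2 q.1) (univ ×ˢ J))
    {x₀ : S} {p : N} {q : EuclideanSpace ℝ (Fin n) × ℝ} (hq : IsLocalPoint X J x₀ p q) :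
    ∀ᶠ q' in 𝓝[univ ×ˢ J] q, IsLocalPoint X J x₀ p q' := by
  have h1 := (contMDiffWithinAt_comp_symm (k := ⊤) hX x₀ hq.1 hq.2.1).continuousWithinAt
  have h2 := h1.preimage_mem_nhdsWithin
    ((isOpen_extChartAt_source (I := 𝓡 (n + 1)) p).mem_nhds hq.2.2)
  have h3 : ∀ᶠ q' in 𝓝[univ ×ˢ J] q, q'.1 ∈ (extChartAt (𝓡 n) x₀).target :=
    mem_nhdsWithin_of_mem_nhds (continuous_fst.continuousAt.preimage_mem_nhds
      (target_mem_nhds x₀ hq.1))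
  filter_upwards [h2, h3, self_mem_nhdsWithin] with q' h2 h3 h4
  exact ⟨h3, h4.2, h2⟩

omit [IsManifold (𝓡 n) ∞ S] [IsManifold (𝓡 (n + 1)) ∞ N] in
theorem mdifferentiableAt_time_slice
    (hX : ContMDiffOn ((𝓡 n).prod 𝓘(ℝ, ℝ)) (𝓡 (n + 1)) ∞ (fun q : S × ℝ => X q.2 q.1) (univ ×ˢ J))
    {t : ℝ} (ht : t ∈ J) (x : S) : MDifferentiableAt (𝓡 n) (𝓡 (n + 1)) (X t) x :=
  ((contMDiff_time_slice hX ht) x).mdifferentiableAt (by simp)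

/-- The induced metrics in a chart, jointly in space and time. -/
theorem contDiffWithinAt_chartMatrix_inducedMetric
    (gN : Bundle.ContMDiffRiemannianMetric (𝓡 (n + 1)) ∞ (EuclideanSpace ℝ (Fin (n + 1)))
      (fun y : N => TangentSpace (𝓡 (n + 1)) y))
    (hX : ContMDiffOn ((𝓡 n).prod 𝓘(ℝ, ℝ)) (𝓡 (n + 1)) ∞ (fun q : S × ℝ => X q.2 q.1) (univ ×ˢ J))
    (hJ : UniqueDiffOn ℝ J) (x₀ : S) {q : EuclideanSpace ℝ (Fin n) × ℝ}
    (hq : q.1 ∈ (extChartAt (𝓡 n) x₀).target) (hqJ : q.2 ∈ J) (i j : Fin n) :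
    ContDiffWithinAt ℝ ∞ (fun q : EuclideanSpace ℝ (Fin n) × ℝ =>
      chartMatrix (inducedMetric (metricField gN) (X q.2)) x₀ q.1 i j) (univ ×ˢ J) q := by
  set p := X q.2 ((extChartAt (𝓡 n) x₀).symm q.1) with hp
  have hloc : IsLocalPoint X J x₀ p q := ⟨hq, hqJ, mem_extChartAt_source (I := 𝓡 (n + 1)) p⟩
  have hu : UniqueDiffOn ℝ ((univ : Set (EuclideanSpace ℝ (Fin n))) ×ˢ J) :=
    uniqueDiffOn_univ.prod hJ
  have hF := contDiffWithinAt_localRep hX hloc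
  set F := localRep (n := n) X x₀ p with hFdef
  have hmem : q ∈ (univ : Set (EuclideanSpace ℝ (Fin n))) ×ˢ J := ⟨mem_univ _, hqJ⟩
  have hDF : ContDiffWithinAt ℝ ∞ (fderivWithin ℝ F (univ ×ˢ J)) (univ ×ˢ J) q :=
    hF.fderivWithin_right hu (by simp) hmem
  have hP : ∀ i, ContDiffWithinAt ℝ ∞ (fun q => fderivWithin ℝ F (univ ×ˢ J) q (coordVec i, 0))
      (univ ×ˢ J) q := fun i => hDF.clm_apply contDiffWithinAt_const
  have hPc : ∀ i a, ContDiffWithinAt ℝ ∞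
      (fun q => fderivWithin ℝ F (univ ×ˢ J) q (coordVec i, 0) a) (univ ×ˢ J) q := fun i a =>
    ((EuclideanSpace.proj (𝕜 := ℝ) a).contDiff.contDiffAt).comp_contDiffWithinAt q (hP i)
  have hG : ∀ a b, ContDiffWithinAt ℝ ∞
      ((fun z => chartMatrix (metricField gN) p z a b) ∘ F) (univ ×ˢ J) q := fun a b =>
    ContDiffAt.comp_contDiffWithinAt q
      (contDiffAt_chartMatrix gN p (mem_extChartAt_target (I := 𝓡 (n + 1)) p) a b) hF
  have hsum : ContDiffWithinAt ℝ ∞ (fun q => matForm (chartMatrix (metricField gN) p (F q))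
      (fderivWithin ℝ F (univ ×ˢ J) q (coordVec i, 0))
      (fderivWithin ℝ F (univ ×ˢ J) q (coordVec j, 0))) (univ ×ˢ J) q :=
    ContDiffWithinAt.sum fun a _ => ContDiffWithinAt.sum fun b _ =>
      ((hPc i a).mul (hPc j b)).mul (hG a b)
  -- The spatial derivative of a time slice is the joint derivative along `(eᵢ, 0)`, which makes
  -- smoothness in space and time together visible.
  have heq : ∀ q', IsLocalPoint X J x₀ p q' →
      chartMatrix (inducedMetric (metricField gN) (X q'.2)) x₀ q'.1 i j
        = matForm (chartMatrix (metricField gN) p (F q'))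
          (fderivWithin ℝ F (univ ×ˢ J) q' (coordVec i, 0))
          (fderivWithin ℝ F (univ ×ˢ J) q' (coordVec j, 0)) := by
    intro q' hq'
    rw [chartMatrix_inducedMetric gN hq'.1 (mdifferentiableAt_time_slice hX hq'.2.1 _) hq'.2.2]
    have := (hasFDerivAt_slice (y := q'.1) (s := q'.2) hq'.2.1
      ((contDiffWithinAt_localRep hX hq').differentiableWithinAt (by simp))).fderiv
    change matForm _ (fderiv ℝ (fun z => localRep X x₀ p (z, q'.2)) q'.1 _)
      (fderiv ℝ (fun z => localRep X x₀ p (z, q'.2)) q'.1 _) = _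
    rw [this]
    rfl
  refine hsum.congr_of_eventuallyEq ?_ (heq q hloc)
  filter_upwards [eventually_isLocalPoint hX hloc] with q' hq' using heq q' hq'

/-- The evolution `∂ₜ gᵢⱼ = 2 f hᵢⱼ` of the induced metric. -/
theorem hasDerivWithinAt_metricMatrix
    (gN : Bundle.ContMDiffRiemannianMetric (𝓡 (n + 1)) ∞ (EuclideanSpace ℝ (Fin (n + 1)))
      (fun y : N => TangentSpace (𝓡 (n + 1)) y)) {T : ℝ} {X : ℝ → S → N} {f : ℝ → S → ℝ}
    {ν : (t : ℝ) → (x : S) → TangentSpace (𝓡 (n + 1)) (X t x)}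
    (hX : IsNormalFlow (metricField gN) T X f ν) {t : ℝ} (ht : t ∈ Ico 0 T) (x : S)
    (i j : Fin n) :
    HasDerivWithinAt (fun s => metricMatrix (inducedMetric (metricField gN) (X s)) x i j)
      (2 * (f t x * metricMatrix (secondFundamentalForm (metricField gN) (X t) (ν t)) x i j))
      (Ico 0 T) t := by
  set J := Ico 0 T with hJdef
  have hJ : UniqueDiffOn ℝ J := uniqueDiffOn_Ico 0 T
  have hJc : Convex ℝ J := convex_Ico 0 T
  have hs := hX.smooth
  set p := X t x with hp
  set φ := extChartAt (𝓡 n) x with hφ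
  set y₀ := φ x with hy₀
  have hφy : φ.symm y₀ = x := extChartAt_to_inv (I := 𝓡 n) x
  set F := localRep (n := n) X x p with hFdef
  set G := chartMatrix (metricField gN) p with hGdef
  have hloc : IsLocalPoint X J x p (y₀, t) := by
    refine ⟨mem_extChartAt_target (I := 𝓡 n) x, ht, ?_⟩
    change X t (φ.symm y₀) ∈ _
    rw [hφy]
    exact mem_extChartAt_source (I := 𝓡 (n + 1)) p
  have hev := eventually_isLocalPoint hs hloc
  have hu : UniqueDiffOn ℝ ((univ : Set (EuclideanSpace ℝ (Fin n))) ×ˢ J) :=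
    uniqueDiffOn_univ.prod hJ
  have hFs : ∀ q, IsLocalPoint X J x p q → ContDiffWithinAt ℝ ∞ F (univ ×ˢ J) q :=
    fun q hq => contDiffWithinAt_localRep hs hq
  have hFd : ∀ q, IsLocalPoint X J x p q → DifferentiableWithinAt ℝ F (univ ×ˢ J) q :=
    fun q hq => (hFs q hq).differentiableWithinAt (by simp)
  -- `V` is the coordinate velocity and represents `f ν`. It is smooth because `X` is, so it can be
  -- differentiated in space although no regularity of `f` is assumed.
  set V : EuclideanSpace ℝ (Fin n) × ℝ → EuclideanSpace ℝ (Fin (n + 1)) :=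
    fun q => fderivWithin ℝ F (univ ×ˢ J) q (0, 1) with hV
  have hVs : ∀ q, IsLocalPoint X J x p q → ContDiffWithinAt ℝ ∞ V (univ ×ˢ J) q := fun q hq =>
    ((hFs q hq).fderivWithin_right hu (by simp) ⟨mem_univ _, hq.2.1⟩).clm_apply
      contDiffWithinAt_const
  have hVder : ∀ q, IsLocalPoint X J x p q →
      HasDerivWithinAt (fun s => F (q.1, s)) (V q) J q.2 := fun q hq =>
    hasDerivWithinAt_slice (hFd q hq)
  set z₀ := F (y₀, t) with hz₀
  have hz₀p : z₀ = extChartAt (𝓡 (n + 1)) p p := by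
    change extChartAt (𝓡 (n + 1)) p (X t (φ.symm y₀)) = _
    rw [hφy]
  have hz₀t : z₀ ∈ (extChartAt (𝓡 (n + 1)) p).target := by
    rw [hz₀p]
    exact mem_extChartAt_target (I := 𝓡 (n + 1)) p
  have hGd : ∀ a b, DifferentiableAt ℝ (fun z => G z a b) z₀ := fun a b =>
    (contDiffAt_chartMatrix gN p hz₀t a b).differentiableAt (by simp)
  have hGsymm : ∀ z a b, G z a b = G z b a := chartMatrix_metricField_symm gN p
  have hGdet : IsUnit (G z₀).det := (posDef_chartMatrix_metricField gN p hz₀t).det_pos.ne'.isUnit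
  set Q := fderiv ℝ (fun z => V (z, t)) y₀ with hQ
  set P : ℝ → Fin n → EuclideanSpace ℝ (Fin (n + 1)) :=
    fun s k => fderiv ℝ (fun z => F (z, s)) y₀ (coordVec k) with hPdef
  have hmixed : HasDerivWithinAt (fun s => fderiv ℝ (fun z => F (z, s)) y₀) Q J t :=
    hasDerivWithinAt_fderiv_slice hJc hJ ht (hev.mono hFd) (hev.mono hVder)
      (hev.mono fun q hq => (hVs q hq).of_le (by exact_mod_cast le_top))
  have hPd : ∀ k, HasDerivWithinAt (fun s => P s k) (Q (coordVec k)) J t := by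
    intro k
    have := hmixed.clm_apply (hasDerivWithinAt_const t J (coordVec k))
    simpa using! this
  -- the time derivative of the metric
  have hmetric := hasDerivWithinAt_matForm (G := G) (z := fun s => F (y₀, s)) hGd
    (hVder _ hloc) (hPd i) (hPd j)
  have hmetric_eq : ∀ s, IsLocalPoint X J x p (y₀, s) →
      metricMatrix (inducedMetric (metricField gN) (X s)) x i j
        = matForm (G (F (y₀, s))) (P s i) (P s j) := by
    intro s hs'
    rw [← chartMatrix_self (isBilinearField_inducedMetric (isBilinearField_metricField gN) (X s)),
      chartMatrix_inducedMetric gN hs'.1 (mdifferentiableAt_time_slice hs hs'.2.1 _) hs'.2.2]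
    rfl
  have hev_t : ∀ᶠ s in 𝓝[J] t, IsLocalPoint X J x p (y₀, s) := by
    rw [nhdsWithin_univ_prod] at hev
    exact hev.curry.self_of_nhds
  have hev_y : ∀ᶠ y in 𝓝 y₀, IsLocalPoint X J x p (y, t) := by
    rw [nhdsWithin_univ_prod] at hev
    exact hev.curry.mono fun y hy => hy.self_of_nhdsWithin ht
  have hD := hmetric.congr_of_eventuallyEq (hev_t.mono hmetric_eq) (hmetric_eq t hloc)
  refine hD.congr_deriv ?_
  -- orthogonality of the velocity
  have hsymmV : ∀ y, IsLocalPoint X J x p (y, t) →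
      symmDeriv p (F (y, t)) (V (y, t)) = f t (φ.symm y) • ν t (φ.symm y) := by
    intro y hy
    have h1 := hX.evolution t ht (φ.symm y)
    have h2 := mfderivWithin_eq_symmDeriv (n := n) (p := p)
      (((contMDiffOn_space_slice hs (φ.symm y)).mdifferentiableOn (by simp)) t ht) (hJ t ht) hy.2.2
    rw [← (hVder _ hy).derivWithin (hJ t ht)]
    exact h2.symm.trans h1
  have horth : ∀ k, ∀ᶠ y in 𝓝 y₀, matForm (G (F (y, t))) (V (y, t))
      (fderiv ℝ (fun z => F (z, t)) y (coordVec k)) = 0 := by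
    intro k
    filter_upwards [hev_y] with y hy
    have h1 := metricField_symmDeriv gN p hy.2.2 (V (y, t))
      (fderiv ℝ (fun z => F (z, t)) y (coordVec k))
    refine h1.symm.trans ?_
    have h2 := coordDeriv_symmDeriv hy.1 (mdifferentiableAt_time_slice hs ht _) hy.2.2 (coordVec k)
    have h3 := hX.normal t ht (φ.symm y) (symmDeriv x y (coordVec k))
    have h4 : gN.inner (X t (φ.symm y)) (f t (φ.symm y) • ν t (φ.symm y))
        (coordDeriv (X t) (φ.symm y) (symmDeriv x y (coordVec k))) = 0 :=
      (DFunLike.congr_fun ((gN.inner (X t (φ.symm y))).map_smul (f t (φ.symm y))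
        (ν t (φ.symm y))) _).trans ((congrArg (f t (φ.symm y) * ·) h3).trans (mul_zero _))
    have h5 := hsymmV y hy
    change gN.inner (X t (φ.symm y)) (symmDeriv p (F (y, t)) (V (y, t)))
      (symmDeriv p (F (y, t)) (fderiv ℝ (fun z => F (z, t)) y (coordVec k))) = 0
    rw [h5]
    refine Eq.trans ?_ h4
    exact congrArg _ h2.symm
  have hFt : ∀ᶠ y in 𝓝 y₀, ContDiffAt ℝ ∞ (fun z => F (z, t)) y := by
    filter_upwards [hev_y] with y hy
    have h1 := (hFs _ hy).comp y (t := univ ×ˢ J) (s := univ) (f := fun z => (z, t))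
      (contDiff_prodMk_left t).contDiffWithinAt (fun z _ => ⟨mem_univ _, ht⟩)
    exact contDiffWithinAt_univ.1 h1
  have hFt0 := hFt.self_of_nhds
  set B : Fin n → Fin n → EuclideanSpace ℝ (Fin (n + 1)) := fun k l =>
    fderiv ℝ (fun z => fderiv ℝ (fun z => F (z, t)) z (coordVec l)) y₀ (coordVec k) with hB
  have hfd : ContDiffAt ℝ ∞ (fderiv ℝ (fun z => F (z, t))) y₀ := hFt0.fderiv_right (by simp)
  -- Symmetry of second derivatives lets the two orthogonality relations, for `(i, j)` and `(j, i)`,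
  -- contribute the same second-order term.
  have hBsymm : ∀ k l, B k l = B l k := by
    intro k l
    have hval : ∀ k l, B k l
        = fderiv ℝ (fderiv ℝ (fun z => F (z, t))) y₀ (coordVec k) (coordVec l) := by
      intro k l
      simp only [hB]
      rw [fderiv_clm_apply (hfd.differentiableAt (by simp)) (differentiableAt_const _)]
      simp
    rw [hval, hval]
    exact (hFt0.isSymmSndFDerivAt (by
      simpa using (ENat.LEInfty.out : (2 : ℕ∞ω) ≤ ∞))).eq _ _
  -- Orthogonality of `V` to `∂ₗF` holds in a neighbourhood of `y₀`, so it may be differentiated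
  -- along the line `y₀ + r eₖ`.
  have horth' : ∀ k l, matForm (G z₀) (Q (coordVec k)) (P t l) + matForm (G z₀) (V (y₀, t)) (B k l)
      + matFormDeriv G z₀ (P t k) (V (y₀, t)) (P t l) = 0 := by
    intro k l
    have hline : ∀ {c : EuclideanSpace ℝ (Fin n) → EuclideanSpace ℝ (Fin (n + 1))},
        DifferentiableAt ℝ c y₀ → HasDerivWithinAt (fun r : ℝ => c (y₀ + r • coordVec k))
          (fderiv ℝ c y₀ (coordVec k)) univ 0 := fun hc =>
      (hc.hasFDerivAt.hasLineDerivAt (coordVec k)).hasDerivWithinAt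
    have hVd : DifferentiableAt ℝ (fun z => V (z, t)) y₀ :=
      (hasFDerivAt_slice ht ((hVs _ hloc).differentiableWithinAt (by simp))).differentiableAt
    have h1 := hasDerivWithinAt_matForm (G := G) (z := fun r : ℝ => F (y₀ + r • coordVec k, t))
      (v := fun r : ℝ => V (y₀ + r • coordVec k, t))
      (w := fun r : ℝ => fderiv ℝ (fun z => F (z, t)) (y₀ + r • coordVec k) (coordVec l))
      (by simpa using hGd) (hline (hFt0.differentiableAt (by simp))) (hline hVd)
      (hline ((hfd.differentiableAt (by simp)).clm_apply (differentiableAt_const (coordVec l))))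
    have htend : Tendsto (fun r : ℝ => y₀ + r • (coordVec k : EuclideanSpace ℝ (Fin n)))
        (𝓝 0) (𝓝 y₀) := by
      have : Continuous fun r : ℝ => y₀ + r • (coordVec k : EuclideanSpace ℝ (Fin n)) := by
        fun_prop
      simpa using this.tendsto 0
    have h2 : (fun r : ℝ => matForm (G (F (y₀ + r • coordVec k, t))) (V (y₀ + r • coordVec k, t))
        (fderiv ℝ (fun z => F (z, t)) (y₀ + r • coordVec k) (coordVec l))) =ᶠ[𝓝 0] fun _ => 0 :=
      htend.eventually (horth l)
    have h3 := (h1.hasDerivAt univ_mem).unique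
      ((hasDerivAt_const (0 : ℝ) (0 : ℝ)).congr_of_eventuallyEq h2)
    simpa using h3
  -- the second fundamental form
  have hΓ := matForm_christoffel (hGsymm z₀) hGdet (V (y₀, t)) (P t i) (P t j)
  have hh : f t x * metricMatrix (secondFundamentalForm (metricField gN) (X t) (ν t)) x i j
      = -matForm (G z₀) (B i j + WithLp.toLp 2 fun k => ∑ a, ∑ b,
          christoffel G k a b z₀ * P t i a * P t j b) (V (y₀, t)) := by
    set W : EuclideanSpace ℝ (Fin (n + 1)) := B i j + WithLp.toLp 2 fun k => ∑ a, ∑ b,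
          christoffel G k a b z₀ * P t i a * P t j b with hW
    -- The charts chosen here, centred at `x` and at `X t x`, are the ones in which `covSecondDeriv`
    -- is defined, so after rewriting the base point both sides agree by definition.
    have hcov : covSecondDeriv (metricField gN) (X t) x (coordVec i) (coordVec j) = W := by
      rw [hW, hz₀p]
      rfl
    have h1 := metricField_symmDeriv gN p (mem_extChartAt_source (I := 𝓡 (n + 1)) p) W (V (y₀, t))
    rw [symmDeriv_self, ← hz₀p] at h1
    have h2 := hsymmV y₀ hloc
    rw [← hz₀, hz₀p, symmDeriv_self, hφy] at h2
    rw [hGdef, ← h1]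
    change f t x * -(gN.inner p (covSecondDeriv (metricField gN) (X t) x (coordVec i) (coordVec j))
      (ν t x)) = -(gN.inner p W (V (y₀, t)))
    rw [hcov]
    have h3 : gN.inner p W (V (y₀, t)) = gN.inner p W (f t x • ν t x) := congrArg _ h2
    rw [h3, map_smul, smul_eq_mul]
    ring
  -- Write `Qₖ = ∂ₖV` and `Pₖ = ∂ₖF`. The time derivative of the metric is `G(Qᵢ,Pⱼ) + G(Pᵢ,Qⱼ) +
  -- D_V G(Pᵢ,Pⱼ)`. The two orthogonality relations replace the first two terms by `-2 G(V,Bᵢⱼ)` and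
  -- derivatives of `G` along `Pᵢ` and `Pⱼ`. By the Koszul formula the result is `-2 G(Bᵢⱼ +
  -- Γ(Pᵢ,Pⱼ), V)`, that is, `2 f hᵢⱼ`.
  rw [hh, matForm_add_left, hΓ]
  have e1 := horth' i j
  have e2 := horth' j i
  rw [hBsymm j i] at e2
  have s1 := matForm_symm (hGsymm z₀) (V (y₀, t)) (B i j)
  have s2 := matForm_symm (hGsymm z₀) (P t i) (Q (coordVec j))
  have hGs : ∀ᶠ y in 𝓝 z₀, ∀ a b, G y a b = G y b a := Eventually.of_forall hGsymm
  have s3 := matFormDeriv_symm hGs (P t i) (V (y₀, t)) (P t j)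
  have s4 := matFormDeriv_symm hGs (P t j) (V (y₀, t)) (P t i)
  simp only [← hz₀]
  linarith

end Evolution

/-! ### Flows of metrics: continuity and bounds of the pointwise quantities -/

section MetricFlow

open Matrix

variable {n : ℕ} {S : Type*} [TopologicalSpace S] [ChartedSpace (EuclideanSpace ℝ (Fin n)) S]
  [IsManifold (𝓡 n) ∞ S]

/-- A family of Riemannian metrics, of class `C¹` jointly in space and time, with `∂ₜ gᵢⱼ = kᵢⱼ` in
the preferred chart at every point. -/
structure IsMetricFlow (g : ℝ → TensorField n S) (k : ℝ → S → Matrix (Fin n) (Fin n) ℝ)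
    (J : Set ℝ) : Prop where
  convex : Convex ℝ J
  uniqueDiffOn : UniqueDiffOn ℝ J
  bilinear : ∀ s, IsBilinearField (g s)
  posDef : ∀ s ∈ J, ∀ x, (metricMatrix (g s) x).PosDef
  contDiffWithinAt : ∀ (x₀ : S) (q : EuclideanSpace ℝ (Fin n) × ℝ),
    q.1 ∈ (extChartAt (𝓡 n) x₀).target → q.2 ∈ J → ∀ i j, ContDiffWithinAt ℝ 1
      (fun q : EuclideanSpace ℝ (Fin n) × ℝ => chartMatrix (g q.2) x₀ q.1 i j) (univ ×ˢ J) q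
  hasDerivWithinAt : ∀ s ∈ J, ∀ x i j,
    HasDerivWithinAt (fun s => metricMatrix (g s) x i j) (k s x i j) J s

/-- The quadratic form of `k` on the gradient of `u`. -/
def velocityQuad (g : TensorField n S) (k : S → Matrix (Fin n) (Fin n) ℝ) (u : S → ℝ) (x : S) : ℝ :=
  ((metricMatrix g x)⁻¹ *ᵥ partialAt (m := n) u x) ⬝ᵥ k x
    *ᵥ ((metricMatrix g x)⁻¹ *ᵥ partialAt (m := n) u x)

/-- The trace of `k` with respect to `g`. -/
def velocityTrace (g : TensorField n S) (k : S → Matrix (Fin n) (Fin n) ℝ) (x : S) : ℝ :=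
  ((metricMatrix g x)⁻¹ * k x).trace

/-- The density of the volume of `g'` with respect to the volume of `g`. -/
def volumeRatio (g' g : TensorField n S) (x : S) : ℝ :=
  √((metricMatrix g' x).det / (metricMatrix g x).det)

omit [IsManifold (𝓡 n) ∞ S] in
/-- A function on `S × J` is continuous if it is so in charts. -/
theorem continuousOn_of_charts {J : Set ℝ} {Φ : S × ℝ → ℝ}
    (h : ∀ (x₀ : S) (q : EuclideanSpace ℝ (Fin n) × ℝ),
      q.1 ∈ (extChartAt (𝓡 n) x₀).target → q.2 ∈ J →
      ContinuousWithinAt (fun q : EuclideanSpace ℝ (Fin n) × ℝ =>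
        Φ ((extChartAt (𝓡 n) x₀).symm q.1, q.2)) (univ ×ˢ J) q) :
    ContinuousOn Φ (univ ×ˢ J) := by
  rintro ⟨x, t⟩ ⟨-, ht⟩
  set φ := extChartAt (𝓡 n) x
  have hmap : ContinuousWithinAt (fun z : S × ℝ => (φ z.1, z.2)) (univ ×ˢ J) (x, t) :=
    (((continuousAt_extChartAt (I := 𝓡 n) x).comp (x := (x, t)) continuousAt_fst).prodMk
      continuousAt_snd).continuousWithinAt
  have hc := (h x (φ x, t) (mem_extChartAt_target (I := 𝓡 n) x) ht).comp (x := (x, t)) (t := univ ×ˢ J) hmap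
    (fun z hz => ⟨mem_univ _, hz.2⟩)
  have hsrc : ∀ᶠ z : S × ℝ in 𝓝[univ ×ˢ J] (x, t), z.1 ∈ φ.source :=
    mem_nhdsWithin_of_mem_nhds (continuous_fst.continuousAt.preimage_mem_nhds
      (extChartAt_source_mem_nhds (I := 𝓡 n) x))
  refine hc.congr_of_eventuallyEq ?_ ?_
  · filter_upwards [hsrc] with z hz
    simp only [Function.comp_apply]
    rw [φ.left_inv hz]
  · simp only [Function.comp_apply]
    rw [φ.left_inv (mem_extChartAt_source (I := 𝓡 n) x)]

omit [IsManifold (𝓡 n) ∞ S] in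
/-- A local property near a point of `S × J` may be checked in a chart. -/
theorem eventually_of_chart {J : Set ℝ} {P : S × ℝ → Prop} {x : S} {t : ℝ}
    (h : ∀ᶠ q in 𝓝[univ ×ˢ J] (extChartAt (𝓡 n) x x, t),
      P ((extChartAt (𝓡 n) x).symm q.1, q.2)) :
    ∀ᶠ z in 𝓝[univ ×ˢ J] (x, t), P z := by
  set φ := extChartAt (𝓡 n) x
  have hmap : ContinuousWithinAt (fun z : S × ℝ => (φ z.1, z.2)) (univ ×ˢ J) (x, t) :=
    (((continuousAt_extChartAt (I := 𝓡 n) x).comp (x := (x, t)) continuousAt_fst).prodMk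
      continuousAt_snd).continuousWithinAt
  have h1 := (hmap.tendsto_nhdsWithin
    (t := univ ×ˢ J) (fun z hz => ⟨mem_univ _, hz.2⟩)).eventually h
  have hsrc : ∀ᶠ z : S × ℝ in 𝓝[univ ×ˢ J] (x, t), z.1 ∈ φ.source :=
    mem_nhdsWithin_of_mem_nhds (continuous_fst.continuousAt.preimage_mem_nhds
      (extChartAt_source_mem_nhds (I := 𝓡 n) x))
  filter_upwards [h1, hsrc] with z hz hzs
  simpa only [φ.left_inv hzs] using hz

/-- The differential of a `C¹` function on `S × J` in a chart. -/
theorem continuousWithinAt_coord_partialAt {J : Set ℝ} (hJ : UniqueDiffOn ℝ J) {w : ℝ → S → ℝ}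
    (hw : ContMDiffOn ((𝓡 n).prod 𝓘(ℝ, ℝ)) 𝓘(ℝ, ℝ) 1 (fun q : S × ℝ => w q.2 q.1) (univ ×ˢ J))
    {x₀ : S} {q : EuclideanSpace ℝ (Fin n) × ℝ} (hq : q.1 ∈ (extChartAt (𝓡 n) x₀).target)
    (hqJ : q.2 ∈ J) :
    ContinuousWithinAt (fun q : EuclideanSpace ℝ (Fin n) × ℝ => (chartJacobian x₀ q.1)ᵀ
      *ᵥ partialAt (m := n) (w q.2) ((extChartAt (𝓡 n) x₀).symm q.1)) (univ ×ˢ J) q := by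
  set F : EuclideanSpace ℝ (Fin n) × ℝ → ℝ := fun q => w q.2 ((extChartAt (𝓡 n) x₀).symm q.1)
  have hu : UniqueDiffOn ℝ ((univ : Set (EuclideanSpace ℝ (Fin n))) ×ˢ J) :=
    uniqueDiffOn_univ.prod hJ
  have hF : ∀ q : EuclideanSpace ℝ (Fin n) × ℝ, q.1 ∈ (extChartAt (𝓡 n) x₀).target → q.2 ∈ J →
      ContDiffWithinAt ℝ 1 F (univ ×ˢ J) q := fun q hq hqJ =>
    contDiffWithinAt_comp_symm (k := 1) hw x₀ hq hqJ
  -- The transposed Jacobian converts components in the chart at each point into components in the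
  -- fixed chart at `x₀`, which are derivatives of one `C¹` function.
  have heq : ∀ q : EuclideanSpace ℝ (Fin n) × ℝ, q.1 ∈ (extChartAt (𝓡 n) x₀).target → q.2 ∈ J →
      (chartJacobian x₀ q.1)ᵀ *ᵥ partialAt (m := n) (w q.2) ((extChartAt (𝓡 n) x₀).symm q.1)
        = fun i => fderivWithin ℝ F (univ ×ˢ J) q (coordVec i, 0) := by
    intro q hq hqJ
    rw [← fderiv_comp_symm hq ((contMDiff_time_slice hw hqJ _).mdifferentiableAt (by simp))]
    have h1 := (hasFDerivAt_slice (y := q.1) (s := q.2) hqJ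
      ((hF q hq hqJ).differentiableWithinAt (by simp))).fderiv
    funext i
    exact DFunLike.congr_fun h1 (coordVec i)
  have hDF : ContinuousWithinAt (fderivWithin ℝ F (univ ×ˢ J)) (univ ×ˢ J) q :=
    ((hF q hq hqJ).fderivWithin_right (m := 0) hu (by simp) ⟨mem_univ _, hqJ⟩).continuousWithinAt
  have hc : ContinuousWithinAt (fun q => fun i : Fin n =>
      fderivWithin ℝ F (univ ×ˢ J) q (coordVec i, 0)) (univ ×ˢ J) q :=
    continuousWithinAt_pi.2 fun i => hDF.clm_apply continuousWithinAt_const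
  refine hc.congr_of_eventuallyEq ?_ (heq q hq hqJ)
  have h3 : ∀ᶠ q' in 𝓝[univ ×ˢ J] q, q'.1 ∈ (extChartAt (𝓡 n) x₀).target :=
    mem_nhdsWithin_of_mem_nhds (continuous_fst.continuousAt.preimage_mem_nhds
      (target_mem_nhds x₀ hq))
  filter_upwards [h3, self_mem_nhdsWithin] with q' h3 h4 using heq q' h3 h4.2

variable {g : ℝ → TensorField n S} {k : ℝ → S → Matrix (Fin n) (Fin n) ℝ} {J : Set ℝ}

omit [IsManifold (𝓡 n) ∞ S] in
theorem IsMetricFlow.continuousWithinAt_chartMatrix (hg : IsMetricFlow g k J) {x₀ : S}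
    {q : EuclideanSpace ℝ (Fin n) × ℝ} (hq : q.1 ∈ (extChartAt (𝓡 n) x₀).target)
    (hqJ : q.2 ∈ J) :
    ContinuousWithinAt (fun q : EuclideanSpace ℝ (Fin n) × ℝ => chartMatrix (g q.2) x₀ q.1)
      (univ ×ˢ J) q :=
  continuousWithinAt_pi.2 fun i => continuousWithinAt_pi.2 fun j =>
    (hg.contDiffWithinAt x₀ q hq hqJ i j).continuousWithinAt

theorem IsMetricFlow.posDef_chartMatrix (hg : IsMetricFlow g k J) {x₀ : S}
    {y : EuclideanSpace ℝ (Fin n)} (hy : y ∈ (extChartAt (𝓡 n) x₀).target) {s : ℝ} (hs : s ∈ J) :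
    (chartMatrix (g s) x₀ y).PosDef :=
  EigenvalueFlow.posDef_chartMatrix (hg.bilinear s) x₀ hy (hg.posDef s hs _)

theorem IsMetricFlow.continuousWithinAt_inv_chartMatrix (hg : IsMetricFlow g k J) {x₀ : S}
    {q : EuclideanSpace ℝ (Fin n) × ℝ} (hq : q.1 ∈ (extChartAt (𝓡 n) x₀).target)
    (hqJ : q.2 ∈ J) :
    ContinuousWithinAt (fun q : EuclideanSpace ℝ (Fin n) × ℝ => (chartMatrix (g q.2) x₀ q.1)⁻¹)
      (univ ×ˢ J) q :=
  continuousWithinAt_inv (hg.continuousWithinAt_chartMatrix hq hqJ)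
    (hg.posDef_chartMatrix hq hqJ).det_pos.ne'

omit [IsManifold (𝓡 n) ∞ S] in
/-- The velocity `k` in a chart. -/
theorem IsMetricFlow.continuousWithinAt_chart_velocity (hg : IsMetricFlow g k J) {x₀ : S}
    {q : EuclideanSpace ℝ (Fin n) × ℝ} (hq : q.1 ∈ (extChartAt (𝓡 n) x₀).target)
    (hqJ : q.2 ∈ J) :
    ContinuousWithinAt (fun q : EuclideanSpace ℝ (Fin n) × ℝ => (chartJacobian x₀ q.1)ᵀ
      * k q.2 ((extChartAt (𝓡 n) x₀).symm q.1) * chartJacobian x₀ q.1) (univ ×ˢ J) q := by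
  have hu : UniqueDiffOn ℝ ((univ : Set (EuclideanSpace ℝ (Fin n))) ×ˢ J) :=
    uniqueDiffOn_univ.prod hg.uniqueDiffOn
  refine continuousWithinAt_pi.2 fun i => continuousWithinAt_pi.2 fun j => ?_
  set F : EuclideanSpace ℝ (Fin n) × ℝ → ℝ := fun q => chartMatrix (g q.2) x₀ q.1 i j with hF
  have hs := fun q hq hqJ => hg.contDiffWithinAt x₀ q hq hqJ i j
  have hDF : ContinuousWithinAt (fun q => fderivWithin ℝ F (univ ×ˢ J) q (0, 1)) (univ ×ˢ J) q :=
    ((hs q hq hqJ).fderivWithin_right (m := 0) hu (by simp)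
      ⟨mem_univ _, hqJ⟩).continuousWithinAt.clm_apply continuousWithinAt_const
  -- Nothing is assumed about the continuity of `k`. Uniqueness of derivatives identifies its
  -- expression in the fixed chart with the time derivative of the `C¹` matrix of the metric, which
  -- is continuous.
  have heq : ∀ q : EuclideanSpace ℝ (Fin n) × ℝ, q.1 ∈ (extChartAt (𝓡 n) x₀).target → q.2 ∈ J →
      ((chartJacobian x₀ q.1)ᵀ * k q.2 ((extChartAt (𝓡 n) x₀).symm q.1)
        * chartJacobian x₀ q.1) i j = fderivWithin ℝ F (univ ×ˢ J) q (0, 1) := by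
    intro q hq hqJ
    have h1 : HasDerivWithinAt (fun s => F (q.1, s)) _ J q.2 := hasDerivWithinAt_slice
      ((hs q hq hqJ).differentiableWithinAt (by simp))
    have h2 : HasDerivWithinAt (fun s => F (q.1, s)) (((chartJacobian x₀ q.1)ᵀ
        * k q.2 ((extChartAt (𝓡 n) x₀).symm q.1) * chartJacobian x₀ q.1) i j) J q.2 := by
      simp only [hF, chartMatrix_eq (hg.bilinear _), mul_apply]
      exact HasDerivWithinAt.fun_sum fun a _ => (HasDerivWithinAt.fun_sum fun b _ =>
        (hg.hasDerivWithinAt q.2 hqJ _ b a).const_mul _).mul_const _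
    exact (hg.uniqueDiffOn q.2 hqJ).eq_deriv _ h2 h1
  refine hDF.congr_of_eventuallyEq ?_ (heq q hq hqJ)
  have h3 : ∀ᶠ q' in 𝓝[univ ×ˢ J] q, q'.1 ∈ (extChartAt (𝓡 n) x₀).target :=
    mem_nhdsWithin_of_mem_nhds (continuous_fst.continuousAt.preimage_mem_nhds
      (target_mem_nhds x₀ hq))
  filter_upwards [h3, self_mem_nhdsWithin] with q' h3 h4 using heq q' h3 h4.2

theorem gradInner_eq_chart {g : TensorField n S} (hg : IsBilinearField g) (u φ : S → ℝ) (x₀ : S)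
    {y : EuclideanSpace ℝ (Fin n)} (hy : y ∈ (extChartAt (𝓡 n) x₀).target) :
    gradInner g u φ ((extChartAt (𝓡 n) x₀).symm y)
      = ((chartJacobian x₀ y)ᵀ *ᵥ partialAt (m := n) u ((extChartAt (𝓡 n) x₀).symm y)) ⬝ᵥ
        (chartMatrix g x₀ y)⁻¹ *ᵥ
        ((chartJacobian x₀ y)ᵀ *ᵥ partialAt (m := n) φ ((extChartAt (𝓡 n) x₀).symm y)) := by
  rw [gradInner_eq, chartMatrix_eq hg, inv_bilin_congr (isUnit_det_chartJacobian x₀ hy)]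

/-- Both determinants acquire the same squared Jacobian factor under a change of chart, and it
cancels in the quotient; the ratio is thus a function on the manifold. -/
theorem volumeRatio_eq_chart {g g' : TensorField n S} (hg : IsBilinearField g)
    (hg' : IsBilinearField g') (x₀ : S) {y : EuclideanSpace ℝ (Fin n)}
    (hy : y ∈ (extChartAt (𝓡 n) x₀).target) :
    volumeRatio g' g ((extChartAt (𝓡 n) x₀).symm y)
      = √((chartMatrix g' x₀ y).det / (chartMatrix g x₀ y).det) := by
  have h0 := (isUnit_det_chartJacobian x₀ hy).ne_zero
  rw [chartMatrix_eq hg, chartMatrix_eq hg', volumeRatio]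
  simp only [det_mul, det_transpose]
  congr 1
  field_simp

omit [IsManifold (𝓡 n) ∞ S] in
theorem continuousWithinAt_target_congr {F : Type*} [TopologicalSpace F]
    {Φ Ψ : EuclideanSpace ℝ (Fin n) × ℝ → F} {x₀ : S}
    (h : ∀ q : EuclideanSpace ℝ (Fin n) × ℝ, q.1 ∈ (extChartAt (𝓡 n) x₀).target → q.2 ∈ J →
      Φ q = Ψ q) {q : EuclideanSpace ℝ (Fin n) × ℝ}
    (hΨ : ContinuousWithinAt Ψ (univ ×ˢ J) q)
    (hq : q.1 ∈ (extChartAt (𝓡 n) x₀).target) (hqJ : q.2 ∈ J) :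
    ContinuousWithinAt Φ (univ ×ˢ J) q := by
  refine hΨ.congr_of_eventuallyEq ?_ (h q hq hqJ)
  have h3 : ∀ᶠ q' in 𝓝[univ ×ˢ J] q, q'.1 ∈ (extChartAt (𝓡 n) x₀).target :=
    mem_nhdsWithin_of_mem_nhds (continuous_fst.continuousAt.preimage_mem_nhds
      (target_mem_nhds x₀ hq))
  filter_upwards [h3, self_mem_nhdsWithin] with q' h3 h4 using h q' h3 h4.2

theorem _root_.ContinuousWithinAt.trace_mul {Y : Type*} [TopologicalSpace Y] {U : Set Y} {y : Y}
    {A B : Y → Matrix (Fin n) (Fin n) ℝ} (hA : ContinuousWithinAt A U y)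
    (hB : ContinuousWithinAt B U y) : ContinuousWithinAt (fun y => (A y * B y).trace) U y := by
  have hc : Continuous fun z : Matrix (Fin n) (Fin n) ℝ × Matrix (Fin n) (Fin n) ℝ =>
      (z.1 * z.2).trace := (continuous_fst.matrix_mul continuous_snd).matrix_trace
  have hAB : ContinuousWithinAt (fun y => (A y, B y)) U y := hA.prodMk hB
  exact Filter.Tendsto.comp (f := fun y => (A y, B y))
    (g := fun z : Matrix (Fin n) (Fin n) ℝ × Matrix (Fin n) (Fin n) ℝ => (z.1 * z.2).trace)
    (hc.tendsto (A y, B y)) hAB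

theorem _root_.ContinuousWithinAt.matrix_mulVec {Y : Type*} [TopologicalSpace Y] {U : Set Y} {y : Y}
    {A : Y → Matrix (Fin n) (Fin n) ℝ} {ξ : Y → Fin n → ℝ} (hA : ContinuousWithinAt A U y)
    (hξ : ContinuousWithinAt ξ U y) : ContinuousWithinAt (fun y => A y *ᵥ ξ y) U y := by
  have hc : Continuous fun z : Matrix (Fin n) (Fin n) ℝ × (Fin n → ℝ) => z.1 *ᵥ z.2 :=
    continuous_fst.matrix_mulVec continuous_snd
  exact hc.continuousAt.comp_continuousWithinAt (hA.prodMk hξ)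

theorem _root_.ContinuousWithinAt.dotProduct_mulVec {Y : Type*} [TopologicalSpace Y] {U : Set Y} {y : Y}
    {A : Y → Matrix (Fin n) (Fin n) ℝ} {ξ η : Y → Fin n → ℝ} (hξ : ContinuousWithinAt ξ U y)
    (hA : ContinuousWithinAt A U y) (hη : ContinuousWithinAt η U y) :
    ContinuousWithinAt (fun y => ξ y ⬝ᵥ A y *ᵥ η y) U y := by
  have hc : Continuous fun z : (Fin n → ℝ) × Matrix (Fin n) (Fin n) ℝ × (Fin n → ℝ) =>
      z.1 ⬝ᵥ z.2.1 *ᵥ z.2.2 :=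
    continuous_fst.dotProduct (continuous_snd.fst.matrix_mulVec continuous_snd.snd)
  exact hc.continuousAt.comp_continuousWithinAt (hξ.prodMk (hA.prodMk hη))

theorem IsMetricFlow.continuousOn_gradInner (hg : IsMetricFlow g k J) {w w' : ℝ → S → ℝ}
    (hw : ContMDiffOn ((𝓡 n).prod 𝓘(ℝ, ℝ)) 𝓘(ℝ, ℝ) 1 (fun q : S × ℝ => w q.2 q.1) (univ ×ˢ J))
    (hw' : ContMDiffOn ((𝓡 n).prod 𝓘(ℝ, ℝ)) 𝓘(ℝ, ℝ) 1 (fun q : S × ℝ => w' q.2 q.1) (univ ×ˢ J)) :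
    ContinuousOn (fun z : S × ℝ => gradInner (g z.2) (w z.2) (w' z.2) z.1) (univ ×ˢ J) := by
  refine continuousOn_of_charts (n := n) fun x₀ q hq hqJ => ?_
  refine continuousWithinAt_target_congr (x₀ := x₀)
    (fun q hq _ => gradInner_eq_chart (hg.bilinear q.2) (w q.2) (w' q.2) x₀ hq) ?_ hq hqJ
  exact ContinuousWithinAt.dotProduct_mulVec
    (continuousWithinAt_coord_partialAt hg.uniqueDiffOn hw hq hqJ)
    (hg.continuousWithinAt_inv_chartMatrix hq hqJ)
    (continuousWithinAt_coord_partialAt hg.uniqueDiffOn hw' hq hqJ)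

theorem IsMetricFlow.continuousOn_volumeRatio (hg : IsMetricFlow g k J) {t : ℝ} (ht : t ∈ J) :
    ContinuousOn (fun z : S × ℝ => volumeRatio (g z.2) (g t) z.1) (univ ×ˢ J) := by
  refine continuousOn_of_charts (n := n) fun x₀ q hq hqJ => ?_
  refine continuousWithinAt_target_congr (x₀ := x₀)
    (fun q hq _ => volumeRatio_eq_chart (hg.bilinear t) (hg.bilinear q.2) x₀ hq) ?_ hq hqJ
  have hdet : Continuous fun A : Matrix (Fin n) (Fin n) ℝ => A.det := continuous_id.matrix_det
  have h1 := hdet.continuousAt.comp_continuousWithinAt (hg.continuousWithinAt_chartMatrix hq hqJ)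
  have hmap : ContinuousWithinAt (fun q : EuclideanSpace ℝ (Fin n) × ℝ => (q.1, t)) (univ ×ˢ J) q :=
    (continuous_fst.prodMk continuous_const).continuousWithinAt
  have h2 := hdet.continuousAt.comp_continuousWithinAt
    (ContinuousWithinAt.comp (x := q) (f := fun q : EuclideanSpace ℝ (Fin n) × ℝ => (q.1, t))
      (g := fun q : EuclideanSpace ℝ (Fin n) × ℝ => chartMatrix (g q.2) x₀ q.1) (t := univ ×ˢ J)
      (hg.continuousWithinAt_chartMatrix (q := (q.1, t)) hq ht) hmap
      (fun z _ => ⟨mem_univ _, ht⟩))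
  exact (h1.div h2 (hg.posDef_chartMatrix hq ht).det_pos.ne').sqrt

theorem IsMetricFlow.continuousOn_velocityTrace (hg : IsMetricFlow g k J) :
    ContinuousOn (fun z : S × ℝ => velocityTrace (g z.2) (k z.2) z.1) (univ ×ˢ J) := by
  refine continuousOn_of_charts (n := n) fun x₀ q hq hqJ => ?_
  refine continuousWithinAt_target_congr (x₀ := x₀) (Ψ := fun q =>
    ((chartMatrix (g q.2) x₀ q.1)⁻¹ * ((chartJacobian x₀ q.1)ᵀ
      * k q.2 ((extChartAt (𝓡 n) x₀).symm q.1) * chartJacobian x₀ q.1)).trace)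
    (fun q hq _ => ?_) ?_ hq hqJ
  · rw [velocityTrace, chartMatrix_eq (hg.bilinear q.2),
      trace_inv_congr (isUnit_det_chartJacobian x₀ hq)]
  · exact (hg.continuousWithinAt_inv_chartMatrix hq hqJ).trace_mul
      (hg.continuousWithinAt_chart_velocity hq hqJ)

theorem velocityQuad_eq_chart {g : TensorField n S} (hg : IsBilinearField g)
    (k : S → Matrix (Fin n) (Fin n) ℝ) (u : S → ℝ) (x₀ : S)
    {y : EuclideanSpace ℝ (Fin n)} (hy : y ∈ (extChartAt (𝓡 n) x₀).target) :
    velocityQuad g k u ((extChartAt (𝓡 n) x₀).symm y)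
      = ((chartMatrix g x₀ y)⁻¹ *ᵥ ((chartJacobian x₀ y)ᵀ
          *ᵥ partialAt (m := n) u ((extChartAt (𝓡 n) x₀).symm y))) ⬝ᵥ
        ((chartJacobian x₀ y)ᵀ * k ((extChartAt (𝓡 n) x₀).symm y) * chartJacobian x₀ y) *ᵥ
        ((chartMatrix g x₀ y)⁻¹ *ᵥ ((chartJacobian x₀ y)ᵀ
          *ᵥ partialAt (m := n) u ((extChartAt (𝓡 n) x₀).symm y))) := by
  rw [velocityQuad, chartMatrix_eq hg, quadratic_inv_congr (isUnit_det_chartJacobian x₀ hy)]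

theorem IsMetricFlow.continuousOn_velocityQuad (hg : IsMetricFlow g k J) {w : ℝ → S → ℝ}
    (hw : ContMDiffOn ((𝓡 n).prod 𝓘(ℝ, ℝ)) 𝓘(ℝ, ℝ) 1 (fun q : S × ℝ => w q.2 q.1) (univ ×ˢ J)) :
    ContinuousOn (fun z : S × ℝ => velocityQuad (g z.2) (k z.2) (w z.2) z.1) (univ ×ˢ J) := by
  refine continuousOn_of_charts (n := n) fun x₀ q hq hqJ => ?_
  refine continuousWithinAt_target_congr (x₀ := x₀)
    (fun q hq _ => velocityQuad_eq_chart (hg.bilinear q.2) (k q.2) (w q.2) x₀ hq) ?_ hq hqJ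
  have hζ := (hg.continuousWithinAt_inv_chartMatrix hq hqJ).matrix_mulVec
    (continuousWithinAt_coord_partialAt hg.uniqueDiffOn hw hq hqJ)
  exact ContinuousWithinAt.dotProduct_mulVec hζ (hg.continuousWithinAt_chart_velocity hq hqJ) hζ

/-- Near every point, the velocity is bounded by the metric. -/
theorem IsMetricFlow.abs_velocityQuad_le (hg : IsMetricFlow g k J) (w : ℝ → S → ℝ) (x : S) {t : ℝ}
    (ht : t ∈ J) : ∃ C, ∀ᶠ z : S × ℝ in 𝓝[univ ×ˢ J] (x, t),
      |velocityQuad (g z.2) (k z.2) (w z.2) z.1| ≤ C * gradInner (g z.2) (w z.2) (w z.2) z.1 := by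
  set φ := extChartAt (𝓡 n) x
  have hx : ((φ x, t) : EuclideanSpace ℝ (Fin n) × ℝ).1 ∈ φ.target :=
    mem_extChartAt_target (I := 𝓡 n) x
  have hinv := hg.continuousWithinAt_inv_chartMatrix hx ht
  have hvel := hg.continuousWithinAt_chart_velocity hx ht
  have hc : Continuous fun z : Matrix (Fin n) (Fin n) ℝ × Matrix (Fin n) (Fin n) ℝ =>
      ∑ i, ∑ j, √(z.1 i i) * |z.2 i j| * √(z.1 j j) := by fun_prop
  have hb := hc.continuousAt.comp_continuousWithinAt (hinv.prodMk hvel)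
  -- Any number above the bound at the centre remains a bound nearby by continuity. It involves only
  -- the metric and its velocity, not `w`.
  obtain ⟨C, hC⟩ := exists_gt (∑ i, ∑ j, √(((chartMatrix (g t) x (φ x))⁻¹) i i)
    * |((chartJacobian x (φ x))ᵀ * k t (φ.symm (φ x)) * chartJacobian x (φ x)) i j|
    * √(((chartMatrix (g t) x (φ x))⁻¹) j j))
  refine ⟨C, eventually_of_chart (n := n) ?_⟩
  have h1 := hb.eventually_lt continuousWithinAt_const hC
  have h3 : ∀ᶠ q' : EuclideanSpace ℝ (Fin n) × ℝ in 𝓝[univ ×ˢ J] (φ x, t), q'.1 ∈ φ.target :=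
    mem_nhdsWithin_of_mem_nhds (continuous_fst.continuousAt.preimage_mem_nhds
      (target_mem_nhds x hx))
  filter_upwards [h1, h3, self_mem_nhdsWithin] with q h1 h3 h4
  have hpos := hg.posDef_chartMatrix h3 h4.2
  rw [velocityQuad_eq_chart (hg.bilinear q.2) _ _ x h3,
    gradInner_eq_chart (hg.bilinear q.2) _ _ x h3]
  refine (abs_quadratic_inv_le hpos _ _).trans ?_
  exact mul_le_mul_of_nonneg_right h1.le (inv_quadratic_nonneg hpos _)

end MetricFlow

/-! ### Comparison and finiteness of the Riemannian volumes -/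

section Volume

/-- Almost everywhere measurability is the natural hypothesis: an inverse chart is known to be
continuous only on its target. Preimages are then merely null measurable. -/
theorem map_withDensity_comp {α β : Type*} [MeasurableSpace α] [MeasurableSpace β] {μ : Measure α}
    {φ : α → β} (hφ : AEMeasurable φ μ) {ρ : β → ENNReal} (hρ : Measurable ρ) :
    (μ.map φ).withDensity ρ = (μ.withDensity (ρ ∘ φ)).map φ := by
  have hφ' : AEMeasurable φ (μ.withDensity (ρ ∘ φ)) :=
    hφ.mono_ac (withDensity_absolutelyContinuous _ _)
  ext s hs
  rw [withDensity_apply _ hs, Measure.restrict_map_of_aemeasurable hφ hs,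
    lintegral_map' hρ.aemeasurable (hφ.mono_measure Measure.restrict_le_self),
    Measure.map_apply_of_aemeasurable hφ' hs]
  have hns : NullMeasurableSet (φ ⁻¹' s) μ := hφ.nullMeasurable hs
  rw [withDensity_apply₀ _ hns]
  rfl

variable {n : ℕ} {S : Type*} [TopologicalSpace S] [ChartedSpace (EuclideanSpace ℝ (Fin n)) S]
  [IsManifold (𝓡 n) ∞ S] [CompactSpace S] [T2Space S] [MeasurableSpace S] [BorelSpace S]

omit [IsManifold (𝓡 n) ∞ S] [CompactSpace S] [T2Space S] in
theorem aemeasurable_extChartAt_symm (x₀ : S) :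
    AEMeasurable (extChartAt (𝓡 n) x₀).symm
      ((volume : Measure (EuclideanSpace ℝ (Fin n))).restrict (extChartAt (𝓡 n) x₀).target) :=
  (continuousOn_extChartAt_symm (I := 𝓡 n) x₀).aemeasurable
    (isOpen_extChartAt_target x₀).measurableSet

omit [IsManifold (𝓡 n) ∞ S] [CompactSpace S] [T2Space S] [MeasurableSpace S] [BorelSpace S] in
theorem aemeasurable_volumeDensity {g : TensorField n S} {x₀ : S}
    (hc : ContinuousOn (fun y => (chartMatrix g x₀ y).det) (extChartAt (𝓡 n) x₀).target) :
    AEMeasurable (fun y => ENNReal.ofReal √(chartMatrix g x₀ y).det)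
      ((volume : Measure (EuclideanSpace ℝ (Fin n))).restrict (extChartAt (𝓡 n) x₀).target) :=
  (hc.sqrt.aemeasurable (isOpen_extChartAt_target x₀).measurableSet).ennreal_ofReal

omit [CompactSpace S] [T2Space S] in
-- On the target of the chart, `√det g' = √det g · √(det g' / det g)`, and the last factor is the
-- chart-independent ratio.
theorem chartVolume_eq_withDensity {g g' : TensorField n S} (hg : IsBilinearField g)
    (hg' : IsBilinearField g') (hpos : ∀ x, (metricMatrix g x).PosDef) {x₀ : S}
    (hc : ContinuousOn (fun y => (chartMatrix g x₀ y).det) (extChartAt (𝓡 n) x₀).target)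
    (hr : Measurable (volumeRatio g' g)) :
    chartVolume g' x₀
      = (chartVolume g x₀).withDensity fun x => ENNReal.ofReal (volumeRatio g' g x) := by
  have hφ := aemeasurable_extChartAt_symm (n := n) x₀
  have hρ : Measurable fun x => ENNReal.ofReal (volumeRatio g' g x) := hr.ennreal_ofReal
  rw [chartVolume, chartVolume, map_withDensity_comp
    (hφ.mono_ac (withDensity_absolutelyContinuous _ _)) hρ,
    ← withDensity_mul₀ (aemeasurable_volumeDensity hc) (hρ.comp_aemeasurable hφ)]
  congr 1
  refine withDensity_congr_ae ?_
  filter_upwards [ae_restrict_mem (isOpen_extChartAt_target x₀).measurableSet] with y hy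
  simp only [Pi.mul_apply, Function.comp_apply]
  have hd := (posDef_chartMatrix hg x₀ hy (hpos _)).det_pos
  rw [volumeRatio_eq_chart hg hg' x₀ hy, ← ENNReal.ofReal_mul (Real.sqrt_nonneg _),
    ← Real.sqrt_mul hd.le, mul_div_cancel₀ _ hd.ne']

omit [BorelSpace S] in
theorem measurable_chartPartition [OpensMeasurableSpace S] (x₀ : S) :
    Measurable fun x => ENNReal.ofReal (chartPartition n S x₀ x) :=
  ((chartPartition n S x₀).contMDiff.continuous.measurable).ennreal_ofReal

/-- The volumes of two Riemannian metrics have the density `volumeRatio`. -/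
theorem riemVolume_eq_withDensity {g g' : TensorField n S} (hg : IsBilinearField g)
    (hg' : IsBilinearField g') (hpos : ∀ x, (metricMatrix g x).PosDef)
    (hc : ∀ x₀, ContinuousOn (fun y => (chartMatrix g x₀ y).det) (extChartAt (𝓡 n) x₀).target)
    (hr : Measurable (volumeRatio g' g)) :
    riemVolume g' = (riemVolume g).withDensity fun x => ENNReal.ofReal (volumeRatio g' g x) := by
  have hρ : Measurable fun x => ENNReal.ofReal (volumeRatio g' g x) := hr.ennreal_ofReal
  rw [riemVolume, riemVolume, withDensity_sum]
  congr 1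
  funext x₀
  rw [chartVolume_eq_withDensity hg hg' hpos (hc x₀) hr,
    ← withDensity_mul _ hρ (measurable_chartPartition x₀),
    ← withDensity_mul _ (measurable_chartPartition x₀) hρ, mul_comm]

/-- By compactness only finitely many partition functions are nonzero. Each is at most `1` and has,
in its chart, compact support inside the target, where the continuous density is integrable. -/
theorem isFiniteMeasure_riemVolume {g : TensorField n S}
    (hc : ∀ x₀, ContinuousOn (fun y => (chartMatrix g x₀ y).det) (extChartAt (𝓡 n) x₀).target) :
    IsFiniteMeasure (riemVolume g) := by
  set χ := chartPartition n S with hχ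
  have hsub : ∀ x₀, tsupport (χ x₀) ⊆ (chartAt (EuclideanSpace ℝ (Fin n)) x₀).source :=
    (SmoothPartitionOfUnity.exists_isSubordinate_chartAt_source (𝓡 n) S).choose_spec
  have hfin : {x₀ | (Function.support (χ x₀)).Nonempty}.Finite :=
    χ.locallyFinite.finite_nonempty_of_compact
  have hzero : ∀ x₀ ∉ hfin.toFinset, ((chartVolume g x₀).withDensity
      fun x => ENNReal.ofReal (χ x₀ x)) univ = 0 := by
    intro x₀ hx₀
    have h0 : ∀ x, χ x₀ x = 0 := by
      simp only [Finite.mem_toFinset, mem_ofPred_eq, not_nonempty_iff_eq_empty,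
        Function.support_eq_empty_iff] at hx₀
      exact fun x => congrFun hx₀ x
    simp [h0]
  have hlt : ∀ x₀, ((chartVolume g x₀).withDensity fun x => ENNReal.ofReal (χ x₀ x)) univ < ⊤ := by
    intro x₀
    set φ := extChartAt (𝓡 n) x₀ with hφdef
    have hφ := aemeasurable_extChartAt_symm (n := n) x₀
    set K := φ '' tsupport (χ x₀) with hK
    have hsrc : tsupport (χ x₀) ⊆ φ.source := by
      rw [extChartAt_source]
      exact hsub x₀
    have hKc : IsCompact K := (isClosed_tsupport _).isCompact.image_of_continuousOn
      ((continuousOn_extChartAt (I := 𝓡 n) x₀).mono hsrc)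
    have hKt : K ⊆ φ.target := by
      rintro _ ⟨x, hx, rfl⟩
      exact φ.map_source (hsrc hx)
    rw [withDensity_apply _ MeasurableSet.univ, Measure.restrict_univ, chartVolume,
      lintegral_map' (measurable_chartPartition x₀).aemeasurable
        (hφ.mono_ac (withDensity_absolutelyContinuous _ _))]
    set a := fun y => ENNReal.ofReal √(chartMatrix g x₀ y).det with ha
    have hle : ∫⁻ y, ENNReal.ofReal (χ x₀ (φ.symm y)) ∂((volume.restrict φ.target).withDensity a)
        ≤ ∫⁻ y, K.indicator 1 y ∂((volume.restrict φ.target).withDensity a) := by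
      refine lintegral_mono_ae ?_
      have hmem : ∀ᵐ y ∂((volume.restrict φ.target).withDensity a), y ∈ φ.target :=
        (withDensity_absolutelyContinuous _ _).ae_le
          (ae_restrict_mem (isOpen_extChartAt_target x₀).measurableSet)
      filter_upwards [hmem] with y hy
      by_cases h0 : χ x₀ (φ.symm y) = 0
      · simp [h0]
      · have hyK : y ∈ K := ⟨φ.symm y, subset_tsupport _ h0, φ.right_inv hy⟩
        rw [indicator_of_mem hyK]
        exact ENNReal.ofReal_le_one.2 (χ.le_one _ _)
    refine hle.trans_lt ?_
    rw [lintegral_indicator_one hKc.measurableSet, withDensity_apply _ hKc.measurableSet,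
      Measure.restrict_restrict hKc.measurableSet, inter_eq_left.2 hKt]
    have hint : IntegrableOn (fun y => √(chartMatrix g x₀ y).det) K volume :=
      ((hc x₀).sqrt.mono hKt).integrableOn_compact hKc
    exact hint.lintegral_lt_top
  refine ⟨?_⟩
  rw [riemVolume, Measure.sum_apply _ MeasurableSet.univ, tsum_eq_sum hzero]
  exact ENNReal.sum_lt_top.2 fun x₀ _ => hlt x₀

end Volume

/-! ### First variation of the energy and of the mass -/

section Variation

open Matrix

/-- At `a = 0` both sides vanish because `p - 1 > 0`, whatever the value of `0 ^ (p - 2)`. This is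
how the singular power is absorbed for `p < 2`. -/
theorem rpow_sub_two_mul_self {a p : ℝ} (ha : 0 ≤ a) (hp : 1 < p) :
    a ^ (p - 2) * a = a ^ (p - 1) := by
  rcases ha.eq_or_lt with rfl | ha
  · rw [mul_zero, Real.zero_rpow (by linarith)]
  · rw [← Real.rpow_add_one ha.ne']
    ring_nf

/-- Continuity bounds `F` near each `(x, t)`, and compactness of `X` makes the bound uniform in `x`;
this supplies the constants for dominated convergence. -/
theorem exists_eventually_forall_le {X : Type*} [TopologicalSpace X] [CompactSpace X] {J : Set ℝ}
    {F : X × ℝ → ℝ} (hF : ContinuousOn F (univ ×ˢ J)) {t : ℝ} (ht : t ∈ J) :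
    ∃ C, ∀ᶠ s in 𝓝[J] t, ∀ x, F (x, s) ≤ C := by
  refine eventually_forall_le_of_locally_bounded (P := fun s x C => F (x, s) ≤ C)
    (fun s x C C' h h' => h'.trans h) fun x => ⟨F (x, t) + 1, ?_⟩
  have h1 : ∀ᶠ z in 𝓝[univ ×ˢ J] (x, t), F z < F (x, t) + 1 :=
    (hF (x, t) ⟨mem_univ _, ht⟩).eventually_lt continuousWithinAt_const (lt_add_one _)
  rw [nhdsWithin_prod_eq, nhdsWithin_univ] at h1
  exact (tendsto_snd.prodMk tendsto_fst).eventually (h1.mono fun z hz => hz.le)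

theorem continuous_slice {X : Type*} [TopologicalSpace X] {J : Set ℝ}
    {F : X × ℝ → ℝ} (hF : ContinuousOn F (univ ×ˢ J)) {s : ℝ} (hs : s ∈ J) :
    Continuous fun x => F (x, s) :=
  hF.comp_continuous (continuous_id.prodMk continuous_const) fun _ => ⟨mem_univ _, hs⟩

variable {n : ℕ} {S : Type*} [TopologicalSpace S] [ChartedSpace (EuclideanSpace ℝ (Fin n)) S]
  [IsManifold (𝓡 n) ∞ S] {g : ℝ → TensorField n S} {k : ℝ → S → Matrix (Fin n) (Fin n) ℝ}
  {J : Set ℝ} {u : ℝ → S → ℝ}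

/-- `u` and `∂u/∂t` are of class `C¹` on `S × J`. -/
structure IsC1Family (n : ℕ) {S : Type*} [TopologicalSpace S]
    [ChartedSpace (EuclideanSpace ℝ (Fin n)) S] (J : Set ℝ) (u : ℝ → S → ℝ) : Prop where
  contMDiffOn : ContMDiffOn ((𝓡 n).prod 𝓘(ℝ, ℝ)) 𝓘(ℝ, ℝ) 1
    (fun q : S × ℝ => u q.2 q.1) (univ ×ˢ J)
  contMDiffOn_deriv : ContMDiffOn ((𝓡 n).prod 𝓘(ℝ, ℝ)) 𝓘(ℝ, ℝ) 1
    (fun q : S × ℝ => derivWithin (fun s => u s q.1) J q.2) (univ ×ˢ J)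

/-- The time derivative of a family of functions. -/
def timeDeriv (J : Set ℝ) (u : ℝ → S → ℝ) (t : ℝ) (x : S) : ℝ := derivWithin (fun s => u s x) J t

omit [IsManifold (𝓡 n) ∞ S] in
theorem IsC1Family.hasDerivWithinAt (hu : IsC1Family n J u) {s : ℝ} (hs : s ∈ J) (x : S) :
    HasDerivWithinAt (fun s => u s x) (timeDeriv J u s x) J s := by
  have h := (contMDiffOn_space_slice hu.contMDiffOn x s hs).contDiffWithinAt
  exact (h.differentiableWithinAt (by simp)).hasDerivWithinAt

/-- `u` need not be `C²`: the exchange of space and time derivatives rests on `∂u/∂t` being `C¹`. -/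
theorem IsC1Family.hasDerivWithinAt_partialAt (hu : IsC1Family n J u) (hJ : Convex ℝ J)
    (hJu : UniqueDiffOn ℝ J) {s : ℝ} (hs : s ∈ J) (x : S) (i : Fin n) :
    HasDerivWithinAt (fun s => partialAt (m := n) (u s) x i)
      (partialAt (m := n) (timeDeriv J u s) x i) J s := by
  set φ := extChartAt (𝓡 n) x with hφ
  have hx : φ x ∈ φ.target := mem_extChartAt_target (I := 𝓡 n) x
  have htar : ∀ᶠ q : EuclideanSpace ℝ (Fin n) × ℝ in 𝓝[univ ×ˢ J] (φ x, s),
      q.1 ∈ φ.target ∧ q.2 ∈ J := by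
    have h3 : ∀ᶠ q : EuclideanSpace ℝ (Fin n) × ℝ in 𝓝[univ ×ˢ J] (φ x, s), q.1 ∈ φ.target :=
      mem_nhdsWithin_of_mem_nhds (continuous_fst.continuousAt.preimage_mem_nhds
        (target_mem_nhds x hx))
    filter_upwards [h3, self_mem_nhdsWithin] with q h3 h4 using ⟨h3, h4.2⟩
  have h := hasDerivWithinAt_fderiv_slice (y := φ x) (s := s)
    (G := fun q : EuclideanSpace ℝ (Fin n) × ℝ => u q.2 (φ.symm q.1))
    (V := fun q : EuclideanSpace ℝ (Fin n) × ℝ => timeDeriv J u q.2 (φ.symm q.1)) hJ hJu hs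
    (htar.mono fun q hq => (contDiffWithinAt_comp_symm (k := 1) hu.contMDiffOn x hq.1
      hq.2).differentiableWithinAt (by simp))
    (htar.mono fun q hq => hu.hasDerivWithinAt hq.2 (φ.symm q.1))
    (htar.mono fun q hq => contDiffWithinAt_comp_symm (k := 1) hu.contMDiffOn_deriv x hq.1 hq.2)
  have h2 := h.clm_apply (hasDerivWithinAt_const s J (coordVec i))
  rw [map_zero, add_zero] at h2
  have hval : ∀ {w : ℝ → S → ℝ} (_ : ContMDiffOn ((𝓡 n).prod 𝓘(ℝ, ℝ)) 𝓘(ℝ, ℝ) 1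
      (fun q : S × ℝ => w q.2 q.1) (univ ×ˢ J)), ∀ r ∈ J, partialAt (m := n) (w r) x i
        = fderiv ℝ (fun z => w r (φ.symm z)) (φ x) (coordVec i) := fun hw r hr =>
    partialAt_eq_fderiv ((contMDiff_time_slice hw hr x).mdifferentiableAt (by simp)) i
  rw [hval (w := timeDeriv J u) hu.contMDiffOn_deriv s hs]
  exact h2.congr (hval hu.contMDiffOn) (hval hu.contMDiffOn s hs)

omit [IsManifold (𝓡 n) ∞ S] in
theorem IsMetricFlow.gradInner_self_nonneg (hg : IsMetricFlow g k J) {s : ℝ} (hs : s ∈ J)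
    (w : S → ℝ) (x : S) : 0 ≤ gradInner (g s) w w x := by
  rw [gradInner_eq]
  exact inv_quadratic_nonneg (hg.posDef s hs x) _

omit [IsManifold (𝓡 n) ∞ S] in
theorem IsMetricFlow.abs_gradInner_le (hg : IsMetricFlow g k J) {s : ℝ} (hs : s ∈ J)
    (w w' : S → ℝ) (x : S) :
    |gradInner (g s) w w' x| ≤ gradNorm (g s) w x * gradNorm (g s) w' x := by
  rw [gradNorm, gradNorm, gradInner_eq, gradInner_eq, gradInner_eq]
  exact abs_inv_bilin_le (hg.posDef s hs x) _ _

/-- The pointwise variation of `|∇u|ᵖ dμ`. -/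
def energyVariation (g : TensorField n S) (k : S → Matrix (Fin n) (Fin n) ℝ) (p : ℝ) (u v : S → ℝ)
    (x : S) : ℝ :=
  p * gradNorm g u x ^ (p - 2) * (gradInner g u v x - 1 / 2 * velocityQuad g k u x)
    + gradNorm g u x ^ p * (1 / 2 * velocityTrace g k x)

/-- The pointwise variation of `|u|ᵖ dμ`. -/
def massVariation (g : TensorField n S) (k : S → Matrix (Fin n) (Fin n) ℝ) (p : ℝ) (u v : S → ℝ)
    (x : S) : ℝ :=
  p * |u x| ^ (p - 2) * u x * v x + |u x| ^ p * (1 / 2 * velocityTrace g k x)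

theorem IsMetricFlow.hasDerivWithinAt_gradNorm_rpow (hg : IsMetricFlow g k J)
    (hu : IsC1Family n J u) {p : ℝ} (hp : 1 < p) {s : ℝ} (hs : s ∈ J) (x : S) :
    HasDerivWithinAt (fun s => gradNorm (g s) (u s) x ^ p)
      (p * gradNorm (g s) (u s) x ^ (p - 2) * (gradInner (g s) (u s) (timeDeriv J u s) x
        - 1 / 2 * velocityQuad (g s) (k s) (u s) x)) J s := by
  have h := hasDerivWithinAt_inv_quadratic_rpow hs (hg.uniqueDiffOn s hs)
    (hg.hasDerivWithinAt s hs x)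
    (hu.hasDerivWithinAt_partialAt hg.convex hg.uniqueDiffOn hs x) (fun s hs => hg.posDef s hs x) hp
  simp only [gradNorm, gradInner_eq]
  convert! h using 3
  have hT : ((metricMatrix (g s) x)⁻¹)ᵀ = (metricMatrix (g s) x)⁻¹ := by
    simpa using (hg.posDef s hs x).inv.isHermitian.eq
  rw [dotProduct_mulVec, ← mulVec_transpose, hT, dotProduct_comm]

omit [IsManifold (𝓡 n) ∞ S] in
theorem IsMetricFlow.hasDerivWithinAt_volumeRatio (hg : IsMetricFlow g k J) {t : ℝ} (ht : t ∈ J)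
    {s : ℝ} (hs : s ∈ J) (x : S) :
    HasDerivWithinAt (fun s => volumeRatio (g s) (g t) x)
      (volumeRatio (g s) (g t) x * (1 / 2 * velocityTrace (g s) (k s) x)) J s :=
  hasDerivWithinAt_sqrt_det (hg.hasDerivWithinAt s hs x) (hg.posDef s hs x)
    (hg.posDef t ht x).det_pos

omit [IsManifold (𝓡 n) ∞ S] in
theorem volumeRatio_nonneg (g' g : TensorField n S) (x : S) : 0 ≤ volumeRatio g' g x :=
  Real.sqrt_nonneg _

omit [IsManifold (𝓡 n) ∞ S] in
theorem volumeRatio_self {g : TensorField n S} {x : S} (h : (metricMatrix g x).PosDef) :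
    volumeRatio g g x = 1 := by
  rw [volumeRatio, div_self h.det_pos.ne', Real.sqrt_one]

theorem IsMetricFlow.continuousOn_gradNorm (hg : IsMetricFlow g k J) {w : ℝ → S → ℝ}
    (hw : ContMDiffOn ((𝓡 n).prod 𝓘(ℝ, ℝ)) 𝓘(ℝ, ℝ) 1 (fun q : S × ℝ => w q.2 q.1) (univ ×ˢ J)) :
    ContinuousOn (fun z : S × ℝ => gradNorm (g z.2) (w z.2) z.1) (univ ×ˢ J) :=
  (hg.continuousOn_gradInner hw hw).sqrt

omit [IsManifold (𝓡 n) ∞ S] in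
-- A quantity carrying a factor `|∇w|` absorbs the possibly singular power, leaving the exponent `p
-- - 1 > 0`.
theorem abs_gradNorm_rpow_mul_le {g : TensorField n S} {w : S → ℝ} {x : S} {p a b : ℝ}
    (hp : 1 < p) (h : |a| ≤ gradNorm g w x * b) :
    |gradNorm g w x ^ (p - 2) * a| ≤ gradNorm g w x ^ (p - 1) * b := by
  have h0 : 0 ≤ gradNorm g w x := Real.sqrt_nonneg _
  rw [abs_mul, abs_of_nonneg (Real.rpow_nonneg h0 _), ← rpow_sub_two_mul_self h0 hp, mul_assoc]
  exact mul_le_mul_of_nonneg_left h (Real.rpow_nonneg h0 _)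

theorem abs_rpow_mul_self_mul {a b p : ℝ} (hp : 1 < p) :
    |(|a| ^ (p - 2) * a * b)| = |a| ^ (p - 1) * |b| := by
  rw [abs_mul, abs_mul, abs_of_nonneg (Real.rpow_nonneg (abs_nonneg a) _),
    rpow_sub_two_mul_self (abs_nonneg a) hp]

variable [CompactSpace S]

/-- The local comparison of `k` with the metric, made uniform over the compact manifold. It keeps
the domination valid across the critical points of `w`. -/
theorem IsMetricFlow.exists_velocityQuad_bound (hg : IsMetricFlow g k J) (w : ℝ → S → ℝ) {t : ℝ}
    (ht : t ∈ J) : ∃ C, ∀ᶠ s in 𝓝[J] t, ∀ x,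
      |velocityQuad (g s) (k s) (w s) x| ≤ C * gradNorm (g s) (w s) x ^ 2 := by
  obtain ⟨C, hC⟩ := eventually_forall_le_of_locally_bounded (l := 𝓝[J] t)
    (P := fun s x C => |velocityQuad (g s) (k s) (w s) x| ≤ C * gradNorm (g s) (w s) x ^ 2)
    (fun s x C C' h h' => h'.trans (mul_le_mul_of_nonneg_right h (sq_nonneg _)))
    (fun x => by
      obtain ⟨C, hC⟩ := hg.abs_velocityQuad_le w x ht
      refine ⟨C, ?_⟩
      have h1 : ∀ᶠ z : S × ℝ in 𝓝[univ ×ˢ J] (x, t), |velocityQuad (g z.2) (k z.2) (w z.2) z.1|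
          ≤ C * gradNorm (g z.2) (w z.2) z.1 ^ 2 := by
        filter_upwards [hC, self_mem_nhdsWithin] with z hz hzJ
        rwa [gradNorm, Real.sq_sqrt (hg.gradInner_self_nonneg hzJ.2 _ _)]
      rw [nhdsWithin_prod_eq, nhdsWithin_univ] at h1
      exact (tendsto_snd.prodMk tendsto_fst).eventually h1)
  exact ⟨C, hC⟩

variable [T2Space S] [MeasurableSpace S] [BorelSpace S]

omit [CompactSpace S] [T2Space S] [MeasurableSpace S] [BorelSpace S] [IsManifold (𝓡 n) ∞ S] in
theorem IsMetricFlow.continuousOn_det (hg : IsMetricFlow g k J) {s : ℝ} (hs : s ∈ J) (x₀ : S) :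
    ContinuousOn (fun y => (chartMatrix (g s) x₀ y).det) (extChartAt (𝓡 n) x₀).target := by
  intro y hy
  have h1 := (hg.continuousWithinAt_chartMatrix (q := (y, s)) hy hs).comp (t := univ ×ˢ J) (x := y)
    (f := fun z : EuclideanSpace ℝ (Fin n) => (z, s)) (s := (extChartAt (𝓡 n) x₀).target)
    (continuous_id.prodMk continuous_const).continuousWithinAt (fun z _ => ⟨mem_univ _, hs⟩)
  have hdet : Continuous fun A : Matrix (Fin n) (Fin n) ℝ => A.det := continuous_id.matrix_det
  exact hdet.continuousAt.comp_continuousWithinAt h1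

theorem IsMetricFlow.isFiniteMeasure (hg : IsMetricFlow g k J) {s : ℝ} (hs : s ∈ J) :
    IsFiniteMeasure (riemVolume (g s)) :=
  isFiniteMeasure_riemVolume (hg.continuousOn_det hs)

/-- The time dependence passes from the measure to the integrand, so integrals at different times
are taken over one finite measure. -/
theorem IsMetricFlow.integral_riemVolume (hg : IsMetricFlow g k J) {s t : ℝ} (hs : s ∈ J)
    (ht : t ∈ J) (F : S → ℝ) :
    ∫ x, F x ∂riemVolume (g s) = ∫ x, F x * volumeRatio (g s) (g t) x ∂riemVolume (g t) := by
  have hr : Measurable (volumeRatio (g s) (g t)) :=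
    (continuous_slice (hg.continuousOn_volumeRatio ht) hs).measurable
  rw [riemVolume_eq_withDensity (hg.bilinear t) (hg.bilinear s) (hg.posDef t ht)
    (hg.continuousOn_det ht) hr, integral_withDensity_eq_integral_toReal_smul hr.ennreal_ofReal
    (Eventually.of_forall fun _ => ENNReal.ofReal_lt_top)]
  refine integral_congr_ae (Eventually.of_forall fun x => ?_)
  simp only [smul_eq_mul]
  rw [ENNReal.toReal_ofReal (volumeRatio_nonneg _ _ x), mul_comm]

theorem IsMetricFlow.integrable_of_continuous (hg : IsMetricFlow g k J) {s : ℝ} (hs : s ∈ J)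
    {F : S → ℝ} (hF : Continuous F) : Integrable F (riemVolume (g s)) := by
  have := hg.isFiniteMeasure hs
  exact hF.integrable_of_hasCompactSupport (HasCompactSupport.of_compactSpace F)

/-- The first variation of an integral. -/
theorem IsMetricFlow.hasDerivWithinAt_integral (hg : IsMetricFlow g k J) {t : ℝ} (ht : t ∈ J)
    {F F' : ℝ → S → ℝ} {B : S × ℝ → ℝ}
    (hF : ContinuousOn (fun z : S × ℝ => F z.2 z.1) (univ ×ˢ J))
    (hF' : ∀ s ∈ J, ∀ x, HasDerivWithinAt (fun s => F s x) (F' s x) J s)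
    (hB : ContinuousOn B (univ ×ˢ J)) (hFB : ∀ᶠ s in 𝓝[J] t, ∀ x, |F' s x| ≤ B (x, s)) :
    HasDerivWithinAt (fun s => ∫ x, F s x ∂riemVolume (g s))
      (∫ x, (F' t x + F t x * (1 / 2 * velocityTrace (g t) (k t) x)) ∂riemVolume (g t)) J t := by
  have := hg.isFiniteMeasure ht
  have hρ := hg.continuousOn_volumeRatio ht
  have hFρ : ContinuousOn (fun z : S × ℝ => F z.2 z.1 * volumeRatio (g z.2) (g t) z.1)
      (univ ×ˢ J) := hF.mul hρ
  -- A continuous majorant of the derivative of `F` times the volume ratio, hence bounded uniformly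
  -- near `t`. Only `B` has to be continuous: `F'` is not required to be, which matters for the
  -- energy when `p < 2`.
  have hM : ContinuousOn (fun z : S × ℝ => B z * volumeRatio (g z.2) (g t) z.1
      + |F z.2 z.1 * (volumeRatio (g z.2) (g t) z.1
        * (1 / 2 * velocityTrace (g z.2) (k z.2) z.1))|) (univ ×ˢ J) :=
    (hB.mul hρ).add (hF.mul (hρ.mul (continuousOn_const.mul hg.continuousOn_velocityTrace))).abs
  obtain ⟨C, hC⟩ := exists_eventually_forall_le hM ht
  have key := hasDerivWithinAt_integral_of_bounded (μ := riemVolume (g t)) hg.convex ht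
    (F := fun s x => F s x * volumeRatio (g s) (g t) x)
    (F' := fun s x => F' s x * volumeRatio (g s) (g t) x + F s x * (volumeRatio (g s) (g t) x
        * (1 / 2 * velocityTrace (g s) (k s) x))) (C := C)
    (fun s hs => (continuous_slice hFρ hs).aestronglyMeasurable)
    (fun s hs => hg.integrable_of_continuous ht (continuous_slice hFρ hs))
    (fun s hs x => (hF' s hs x).mul (hg.hasDerivWithinAt_volumeRatio ht hs x)) ?_
  · have h1 : ∀ s ∈ J, ∫ x, F s x ∂riemVolume (g s)
        = ∫ x, F s x * volumeRatio (g s) (g t) x ∂riemVolume (g t) := fun s hs =>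
      hg.integral_riemVolume hs ht _
    refine (key.congr h1 (h1 t ht)).congr_deriv ?_
    refine integral_congr_ae (Eventually.of_forall fun x => ?_)
    simp only [volumeRatio_self (hg.posDef t ht x)]
    ring
  · filter_upwards [hC, hFB] with s hs hsB x
    refine le_trans ?_ (hs x)
    refine (abs_add_le _ _).trans (add_le_add ?_ le_rfl)
    rw [abs_mul, abs_of_nonneg (volumeRatio_nonneg (g s) (g t) x)]
    exact mul_le_mul_of_nonneg_right (hsB x) (volumeRatio_nonneg _ _ x)

theorem IsMetricFlow.hasDerivWithinAt_pEnergy (hg : IsMetricFlow g k J) (hu : IsC1Family n J u)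
    {p : ℝ} (hp : 1 < p) {t : ℝ} (ht : t ∈ J) :
    HasDerivWithinAt (fun s => pEnergy (g s) p (u s))
      (∫ x, energyVariation (g t) (k t) p (u t) (timeDeriv J u t) x ∂riemVolume (g t)) J t := by
  obtain ⟨C, hC⟩ := hg.exists_velocityQuad_bound u ht
  have hN := hg.continuousOn_gradNorm hu.contMDiffOn
  have hN' := hg.continuousOn_gradNorm (w := timeDeriv J u) hu.contMDiffOn_deriv
  -- The majorant `B` combines Cauchy-Schwarz for `⟨∇u, ∇∂ₜu⟩` with the bound `C|∇u|²` for the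
  -- velocity term; one factor `|∇u|` of each has raised the exponent from `p - 2` to `p - 1`.
  refine hg.hasDerivWithinAt_integral ht
    (F := fun s x => gradNorm (g s) (u s) x ^ p)
    (B := fun z => p * (gradNorm (g z.2) (u z.2) z.1 ^ (p - 1)
      * (gradNorm (g z.2) (timeDeriv J u z.2) z.1 + 1 / 2 * (C * gradNorm (g z.2) (u z.2) z.1))))
    (hN.rpow_const fun _ _ => Or.inr (by linarith))
    (fun s hs x => hg.hasDerivWithinAt_gradNorm_rpow hu hp hs x) ?_ ?_
  · exact continuousOn_const.mul ((hN.rpow_const fun _ _ => Or.inr (by linarith)).mul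
      (hN'.add (continuousOn_const.mul (continuousOn_const.mul hN))))
  · filter_upwards [hC, self_mem_nhdsWithin] with s hs hsJ x
    rw [mul_assoc, abs_mul, abs_of_pos (by linarith : 0 < p)]
    refine mul_le_mul_of_nonneg_left (abs_gradNorm_rpow_mul_le hp ?_) (by linarith)
    refine (abs_sub _ _).trans ?_
    have h1 := hg.abs_gradInner_le hsJ (u s) (timeDeriv J u s) x
    have h2 := hs x
    rw [abs_mul, abs_of_pos (by norm_num : (0 : ℝ) < 1 / 2)]
    nlinarith

theorem IsMetricFlow.hasDerivWithinAt_mass (hg : IsMetricFlow g k J) (hu : IsC1Family n J u)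
    {p : ℝ} (hp : 1 < p) {t : ℝ} (ht : t ∈ J) :
    HasDerivWithinAt (fun s => ∫ x, |u s x| ^ p ∂riemVolume (g s))
      (∫ x, massVariation (g t) (k t) p (u t) (timeDeriv J u t) x ∂riemVolume (g t)) J t := by
  have hN : ContinuousOn (fun z : S × ℝ => |u z.2 z.1|) (univ ×ˢ J) :=
    hu.contMDiffOn.continuousOn.abs
  have hN' : ContinuousOn (fun z : S × ℝ => |timeDeriv J u z.2 z.1|) (univ ×ˢ J) :=
    hu.contMDiffOn_deriv.continuousOn.abs
  refine hg.hasDerivWithinAt_integral ht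
    (F := fun s x => |u s x| ^ p) (F' := fun s x => p * |u s x| ^ (p - 2) * u s x
      * timeDeriv J u s x)
    (B := fun z => p * (|u z.2 z.1| ^ (p - 1) * |timeDeriv J u z.2 z.1|))
    (hN.rpow_const fun _ _ => Or.inr (by linarith))
    (fun s hs x => (hasDerivAt_abs_rpow _ hp).comp_hasDerivWithinAt s
      (hu.hasDerivWithinAt hs x)) ?_ ?_
  · exact continuousOn_const.mul ((hN.rpow_const fun _ _ => Or.inr (by linarith)).mul hN')
  · refine Eventually.of_forall fun s x => ?_
    rw [← abs_rpow_mul_self_mul hp, mul_assoc, mul_assoc, abs_mul, abs_of_pos (by linarith : 0 < p),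
      mul_assoc]

end Variation

/-! ### Use of the eigenvalue equation, and specialisation to normal flows -/

section Eigenvalue

open Matrix

variable {n : ℕ} {S : Type*} [TopologicalSpace S] [ChartedSpace (EuclideanSpace ℝ (Fin n)) S]
  [IsManifold (𝓡 n) ∞ S] [CompactSpace S] [T2Space S] [MeasurableSpace S] [BorelSpace S]
  {g : ℝ → TensorField n S} {k : ℝ → S → Matrix (Fin n) (Fin n) ℝ} {J : Set ℝ} {u : ℝ → S → ℝ}

/-- The integrand need not be known continuous at critical points when `p < 2`; it is measurable and
dominated by the continuous function `|∇u|^(p-1) b`. -/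
theorem IsMetricFlow.integrable_gradNorm_rpow_mul (hg : IsMetricFlow g k J)
    (hu : IsC1Family n J u) {p : ℝ} (hp : 1 < p) {t : ℝ} (ht : t ∈ J) {a b : S → ℝ}
    (ha : Continuous a) (hb : Continuous b) (hab : ∀ x, |a x| ≤ gradNorm (g t) (u t) x * b x) :
    Integrable (fun x => gradNorm (g t) (u t) x ^ (p - 2) * a x) (riemVolume (g t)) := by
  have hN := continuous_slice (hg.continuousOn_gradNorm hu.contMDiffOn) ht
  refine (hg.integrable_of_continuous ht
    ((hN.rpow_const fun _ => Or.inr (by linarith : 0 ≤ p - 1)).mul hb)).mono'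
    ((hN.measurable.pow_const _).mul ha.measurable).aestronglyMeasurable
    (Eventually.of_forall fun x => ?_)
  exact abs_gradNorm_rpow_mul_le hp (hab x)

/-- The first variation of the energy of a normalised family through an eigenfunction. -/
theorem IsMetricFlow.hasDerivWithinAt_pEnergy_of_isEigenfunction (hg : IsMetricFlow g k J)
    (hu : IsC1Family n J u) {p : ℝ} (hp : 1 < p)
    (hnorm : ∀ t ∈ J, ∫ x, |u t x| ^ p ∂riemVolume (g t) = 1) {t lam : ℝ} (ht : t ∈ J)
    (heig : IsEigenfunction (g t) p lam (u t)) :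
    HasDerivWithinAt (fun s => pEnergy (g s) p (u s))
      (-p * ∫ x, gradNorm (g t) (u t) x ^ (p - 2) * (1 / 2 * velocityQuad (g t) (k t) (u t) x)
          ∂riemVolume (g t)
        + ∫ x, gradNorm (g t) (u t) x ^ p * (1 / 2 * velocityTrace (g t) (k t) x)
          ∂riemVolume (g t)
        - lam * ∫ x, |u t x| ^ p * (1 / 2 * velocityTrace (g t) (k t) x) ∂riemVolume (g t)) J t := by
  refine (hg.hasDerivWithinAt_pEnergy hu hp ht).congr_deriv ?_
  -- The mass is constantly `1`, so its variation vanishes.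
  have hmass : ∫ x, massVariation (g t) (k t) p (u t) (timeDeriv J u t) x ∂riemVolume (g t) = 0 :=
    (hg.uniqueDiffOn t ht).eq_deriv _ (hg.hasDerivWithinAt_mass hu hp ht)
      ((hasDerivWithinAt_const t J (1 : ℝ)).congr hnorm (hnorm t ht))
  have hv : ContMDiff (𝓡 n) 𝓘(ℝ, ℝ) 1 (timeDeriv J u t) :=
    contMDiff_time_slice hu.contMDiffOn_deriv ht
  have huc : Continuous (u t) := heig.contMDiff.continuous
  have hN := continuous_slice (hg.continuousOn_gradNorm hu.contMDiffOn) ht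
  have hN' := continuous_slice
    (hg.continuousOn_gradNorm (w := timeDeriv J u) hu.contMDiffOn_deriv) ht
  have hT := (continuous_slice hg.continuousOn_velocityTrace ht).const_mul (1 / 2)
  have hQ := (continuous_slice (hg.continuousOn_velocityQuad hu.contMDiffOn) ht).const_mul (1 / 2)
  obtain ⟨C, hC⟩ := hg.exists_velocityQuad_bound u ht
  have hA : Integrable (fun x => gradNorm (g t) (u t) x ^ (p - 2)
      * gradInner (g t) (u t) (timeDeriv J u t) x) (riemVolume (g t)) := hg.integrable_gradNorm_rpow_mul hu hp ht
    (continuous_slice (hg.continuousOn_gradInner (w' := timeDeriv J u) hu.contMDiffOn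
      hu.contMDiffOn_deriv) ht) hN' fun x => hg.abs_gradInner_le ht _ _ x
  have hB : Integrable (fun x => gradNorm (g t) (u t) x ^ (p - 2)
      * (1 / 2 * velocityQuad (g t) (k t) (u t) x)) (riemVolume (g t)) := hg.integrable_gradNorm_rpow_mul hu hp ht hQ
    ((hN.const_mul C).const_mul (1 / 2)) fun x => by
      have h := hC.self_of_nhdsWithin ht x
      rw [abs_mul, abs_of_pos (by norm_num : (0 : ℝ) < 1 / 2)]
      linarith
  have hE : Integrable (fun x => gradNorm (g t) (u t) x ^ p
      * (1 / 2 * velocityTrace (g t) (k t) x)) (riemVolume (g t)) := hg.integrable_of_continuous ht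
    ((hN.rpow_const fun _ => Or.inr (by linarith : 0 ≤ p)).mul hT)
  have hM : Integrable (fun x => |u t x| ^ p * (1 / 2 * velocityTrace (g t) (k t) x))
      (riemVolume (g t)) := hg.integrable_of_continuous ht
    ((huc.abs.rpow_const fun _ => Or.inr (by linarith : 0 ≤ p)).mul hT)
  have hD : Integrable (fun x => |u t x| ^ (p - 2) * u t x * timeDeriv J u t x)
      (riemVolume (g t)) := by
    refine (hg.integrable_of_continuous ht ((huc.abs.rpow_const
      fun _ => Or.inr (by linarith : 0 ≤ p - 1)).mul hv.continuous.abs)).mono'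
      (((huc.abs.measurable.pow_const _).mul huc.measurable).mul
        hv.continuous.measurable).aestronglyMeasurable (Eventually.of_forall fun x => ?_)
    exact (abs_rpow_mul_self_mul hp).le
  have hAB : Integrable (fun x => p * (gradNorm (g t) (u t) x ^ (p - 2)
        * gradInner (g t) (u t) (timeDeriv J u t) x)
      - p * (gradNorm (g t) (u t) x ^ (p - 2) * (1 / 2 * velocityQuad (g t) (k t) (u t) x)))
      (riemVolume (g t)) := (hA.const_mul p).sub (hB.const_mul p)
  -- The decisive step: the time derivative of `u` serves as the test function. It trades the term
  -- with `∇∂ₜu` for `lam * ∫|u|^(p-2) u ∂ₜu`, which `lam` times the vanishing mass variation then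
  -- eliminates.
  have heq := heig.equation _ hv
  have hsplitM : ∀ x, massVariation (g t) (k t) p (u t) (timeDeriv J u t) x
      = p * (|u t x| ^ (p - 2) * u t x * timeDeriv J u t x)
        + |u t x| ^ p * (1 / 2 * velocityTrace (g t) (k t) x) := fun x => by
    rw [massVariation]
    ring
  have hsplitE : ∀ x, energyVariation (g t) (k t) p (u t) (timeDeriv J u t) x
      = p * (gradNorm (g t) (u t) x ^ (p - 2) * gradInner (g t) (u t) (timeDeriv J u t) x)
        - p * (gradNorm (g t) (u t) x ^ (p - 2) * (1 / 2 * velocityQuad (g t) (k t) (u t) x))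
        + gradNorm (g t) (u t) x ^ p * (1 / 2 * velocityTrace (g t) (k t) x) := fun x => by
    rw [energyVariation]
    ring
  simp only [hsplitM] at hmass
  simp only [hsplitE]
  rw [integral_add (hD.const_mul p) hM, integral_const_mul] at hmass
  rw [integral_add hAB hE,
    integral_sub (hA.const_mul p) (hB.const_mul p), integral_const_mul, integral_const_mul, heq]
  linear_combination lam * hmass

omit [CompactSpace S] [T2Space S] [BorelSpace S] [MeasurableSpace S] [IsManifold (𝓡 n) ∞ S] in
-- The factor `½` from the variation of the inverse metric cancels the `2` in `∂ₜg = 2fh`; here `c`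
-- is the value of `f` at `x`.
theorem half_velocityQuad {g h : TensorField n S} {k : S → Matrix (Fin n) (Fin n) ℝ} {c : ℝ}
    {x : S} (hg : (metricMatrix g x).IsHermitian) (hk : k x = (2 * c) • metricMatrix h x)
    (u : S → ℝ) : 1 / 2 * velocityQuad g k u x = c * raisedQuad g h u x := by
  rw [raisedQuad_eq h u hg, velocityQuad, hk, smul_mulVec, dotProduct_smul, smul_eq_mul]
  ring

omit [CompactSpace S] [T2Space S] [BorelSpace S] [MeasurableSpace S] [IsManifold (𝓡 n) ∞ S] in
theorem half_velocityTrace {g h : TensorField n S} {k : S → Matrix (Fin n) (Fin n) ℝ} {c : ℝ}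
    {x : S} (hg : (metricMatrix g x).IsHermitian) (hk : k x = (2 * c) • metricMatrix h x) :
    1 / 2 * velocityTrace g k x = c * traceWith g h x := by
  rw [traceWith_eq h hg, velocityTrace, hk, Matrix.mul_smul, trace_smul, smul_eq_mul]
  ring

omit [BorelSpace S] in
-- Test the equation with `u` itself. For `p = 2` the power factors have exponent zero and equal `1`
-- everywhere, also at zeros of `u` and `∇u`.
theorem IsEigenfunction.eq_pEnergy {g : TensorField n S} {lam : ℝ} {u : S → ℝ}
    (hu : IsEigenfunction g 2 lam u) (hg : ∀ x, (metricMatrix g x).PosDef)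
    (hnorm : ∫ x, |u x| ^ 2 ∂riemVolume g = 1) : lam = pEnergy g 2 u := by
  have h := hu.equation u hu.contMDiff
  simp only [sub_self, Real.rpow_zero, one_mul] at h
  have hm : ∫ x, u x * u x ∂riemVolume g = 1 := by
    simpa only [sq_abs, ← sq] using hnorm
  rw [hm, mul_one] at h
  rw [← h, pEnergy]
  refine integral_congr_ae (Eventually.of_forall fun x => ?_)
  have h0 : 0 ≤ gradInner g u u x := by
    rw [gradInner_eq]
    exact inv_quadratic_nonneg (hg x) _
  simp only [Real.rpow_two, gradNorm, Real.sq_sqrt h0]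

variable {N : Type*} [TopologicalSpace N] [ChartedSpace (EuclideanSpace ℝ (Fin (n + 1))) N]
  [IsManifold (𝓡 (n + 1)) ∞ N]

omit [CompactSpace S] [T2Space S] [BorelSpace S] [MeasurableSpace S] in
/-- The induced metrics of a normal flow evolve by `∂ₜ gᵢⱼ = 2 f hᵢⱼ`. -/
theorem IsNormalFlow.isMetricFlow
    {gN : Bundle.ContMDiffRiemannianMetric (𝓡 (n + 1)) ∞ (EuclideanSpace ℝ (Fin (n + 1)))
      (fun y : N => TangentSpace (𝓡 (n + 1)) y)} {T : ℝ} {X : ℝ → S → N} {f : ℝ → S → ℝ}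
    {ν : (t : ℝ) → (x : S) → TangentSpace (𝓡 (n + 1)) (X t x)}
    (hX : IsNormalFlow (metricField gN) T X f ν) :
    IsMetricFlow (fun s => inducedMetric (metricField gN) (X s))
      (fun s x => (2 * f s x) • metricMatrix (secondFundamentalForm (metricField gN) (X s) (ν s)) x)
      (Ico 0 T) where
  convex := convex_Ico 0 T
  uniqueDiffOn := uniqueDiffOn_Ico 0 T
  bilinear s := isBilinearField_inducedMetric (isBilinearField_metricField gN) (X s)
  posDef s hs x := posDef_metricMatrix_inducedMetric gN (hX.immersion s hs x)
  contDiffWithinAt x₀ q hq hqJ i j :=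
    (contDiffWithinAt_chartMatrix_inducedMetric gN hX.smooth (uniqueDiffOn_Ico 0 T) x₀ hq hqJ
      i j).of_le (by simp)
  hasDerivWithinAt s hs x i j :=
    (hasDerivWithinAt_metricMatrix gN hX hs x i j).congr_deriv (by
      rw [Matrix.smul_apply, smul_eq_mul, mul_assoc])

/-- The abstract variation formula with `k = 2fh`. Since `lam` is an arbitrary eigenvalue at the
single time `t`, the same statement serves both parts of the theorem. -/
theorem IsNormalFlow.hasDerivWithinAt_pEnergy
    {gN : Bundle.ContMDiffRiemannianMetric (𝓡 (n + 1)) ∞ (EuclideanSpace ℝ (Fin (n + 1)))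
      (fun y : N => TangentSpace (𝓡 (n + 1)) y)} {T : ℝ} {X : ℝ → S → N} {f : ℝ → S → ℝ}
    {ν : (t : ℝ) → (x : S) → TangentSpace (𝓡 (n + 1)) (X t x)}
    (hX : IsNormalFlow (metricField gN) T X f ν) {g h : ℝ → TensorField n S} {H : ℝ → S → ℝ}
    (hg : ∀ t, g t = inducedMetric (metricField gN) (X t))
    (hh : ∀ t, h t = secondFundamentalForm (metricField gN) (X t) (ν t))
    (hH : ∀ t, H t = meanCurvature (metricField gN) (X t) (ν t))
    {p : ℝ} (hp : 1 < p) (hu : IsRegularFamily n T u)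
    (hnorm : ∀ t ∈ Ico 0 T, ∫ x, |u t x| ^ p ∂riemVolume (g t) = 1) {t lam : ℝ}
    (ht : t ∈ Ico 0 T) (heig : IsEigenfunction (g t) p lam (u t)) :
    HasDerivWithinAt (fun s => pEnergy (g s) p (u s))
      (-p * ∫ x, f t x * gradNorm (g t) (u t) x ^ (p - 2) * raisedQuad (g t) (h t) (u t) x
          ∂riemVolume (g t)
        + ∫ x, f t x * H t x * gradNorm (g t) (u t) x ^ p ∂riemVolume (g t)
        - lam * ∫ x, f t x * H t x * |u t x| ^ p ∂riemVolume (g t)) (Ico 0 T) t := by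
  obtain rfl : g = fun t => inducedMetric (metricField gN) (X t) := funext hg
  obtain rfl : h = fun t => secondFundamentalForm (metricField gN) (X t) (ν t) := funext hh
  obtain rfl : H = fun t => meanCurvature (metricField gN) (X t) (ν t) := funext hH
  have hflow := hX.isMetricFlow
  refine (hflow.hasDerivWithinAt_pEnergy_of_isEigenfunction
    ⟨hu.contMDiffOn, hu.contMDiffOn_deriv⟩ hp hnorm ht heig).congr_deriv ?_
  have hherm := fun x => (hflow.posDef t ht x).isHermitian
  have hQ := fun x => half_velocityQuad (c := f t x)
    (h := secondFundamentalForm (metricField gN) (X t) (ν t)) (hherm x)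
    (k := fun x => (2 * f t x) •
      metricMatrix (secondFundamentalForm (metricField gN) (X t) (ν t)) x) rfl (u t)
  have hT := fun x => half_velocityTrace (c := f t x)
    (h := secondFundamentalForm (metricField gN) (X t) (ν t)) (hherm x)
    (k := fun x => (2 * f t x) •
      metricMatrix (secondFundamentalForm (metricField gN) (X t) (ν t)) x) rfl
  simp only [hQ, hT, meanCurvature]
  have hmul : ∀ a b c : ℝ, a * (b * c) = b * a * c := fun a b c => by ring
  have hcomm : ∀ a b c : ℝ, a * (b * c) = b * c * a := fun a b c => by ring
  exact congrArg₂ (· - ·) (congrArg₂ (· + ·)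
    (congrArg _ (integral_congr_ae (Eventually.of_forall fun x => hmul _ _ _)))
    (integral_congr_ae (Eventually.of_forall fun x => hcomm _ _ _)))
    (congrArg _ (integral_congr_ae (Eventually.of_forall fun x => hcomm _ _ _)))

end Eigenvalue

end EigenvalueFlow

end

/-! ### The variation formulas for the first eigenvalue -/

open EigenvalueFlow in
theorem proposition2p1 {n : ℕ}
    {S : Type*} [TopologicalSpace S] [ChartedSpace (EuclideanSpace ℝ (Fin n)) S]
    [IsManifold (𝓡 n) ∞ S] [CompactSpace S] [T2Space S] [MeasurableSpace S] [BorelSpace S]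
    {N : Type*} [TopologicalSpace N] [ChartedSpace (EuclideanSpace ℝ (Fin (n + 1))) N]
    [IsManifold (𝓡 (n + 1)) ∞ N]
    (gN : Bundle.ContMDiffRiemannianMetric (𝓡 (n + 1)) ∞ (EuclideanSpace ℝ (Fin (n + 1)))
      (fun y : N => TangentSpace (𝓡 (n + 1)) y))
    (K : ℝ) (_hK : HasConstantSectionalCurvature (metricField gN) K)
    (T : ℝ) (X : ℝ → S → N) (f : ℝ → S → ℝ)
    (ν : (t : ℝ) → (x : S) → TangentSpace (𝓡 (n + 1)) (X t x))
    (hX : IsNormalFlow (metricField gN) T X f ν)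
    (g h : ℝ → TensorField n S) (H : ℝ → S → ℝ)
    (hg : ∀ t, g t = inducedMetric (metricField gN) (X t))
    (hh : ∀ t, h t = secondFundamentalForm (metricField gN) (X t) (ν t))
    (hH : ∀ t, H t = meanCurvature (metricField gN) (X t) (ν t)) :
    (∀ (p : ℝ) (_hp : 1 < p) (u : ℝ → S → ℝ) (_hu : IsRegularFamily n T u)
        (_hnorm : ∀ t ∈ Ico 0 T, ∫ x, |u t x| ^ p ∂riemVolume (g t) = 1),
        ∀ t ∈ Ico 0 T, IsEigenfunction (g t) p (firstEigenvalue (g t) p) (u t) →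
          HasDerivWithinAt (fun s => pEnergy (g s) p (u s))
            (-p * ∫ x, f t x * gradNorm (g t) (u t) x ^ (p - 2) * raisedQuad (g t) (h t) (u t) x
                ∂riemVolume (g t)
              + ∫ x, f t x * H t x * gradNorm (g t) (u t) x ^ p ∂riemVolume (g t)
              - firstEigenvalue (g t) p *
                ∫ x, f t x * H t x * |u t x| ^ p ∂riemVolume (g t))
            (Ico 0 T) t) ∧
    (∀ (u : ℝ → S → ℝ) (_hu : IsRegularFamily n T u)
        (_hnorm : ∀ t ∈ Ico 0 T, ∫ x, |u t x| ^ 2 ∂riemVolume (g t) = 1)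
        (_heig : ∀ t ∈ Ico 0 T, IsEigenfunction (g t) 2 (firstEigenvalue (g t) 2) (u t)),
        ∀ t ∈ Ico 0 T,
          HasDerivWithinAt (fun s => firstEigenvalue (g s) 2)
            (-2 * ∫ x, f t x * raisedQuad (g t) (h t) (u t) x ∂riemVolume (g t)
              + ∫ x, f t x * H t x * gradNorm (g t) (u t) x ^ 2 ∂riemVolume (g t)
              - firstEigenvalue (g t) 2 *
                ∫ x, f t x * H t x * |u t x| ^ 2 ∂riemVolume (g t))
            (Ico 0 T) t) := by
  refine ⟨fun p hp u hu hnorm t ht heig =>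
    hX.hasDerivWithinAt_pEnergy hg hh hH hp hu hnorm ht heig, fun u hu hnorm heig t ht => ?_⟩
  have hpos : ∀ s ∈ Ico 0 T, ∀ x, (metricMatrix (g s) x).PosDef := fun s hs x => by
    rw [hg s]
    exact hX.isMetricFlow.posDef s hs x
  -- Because `u` is a normalised eigenfunction at every time, the eigenvalue and the energy agree on
  -- the whole interval, so differentiability transfers from the energy.
  have hlam : ∀ s ∈ Ico 0 T, firstEigenvalue (g s) 2 = pEnergy (g s) 2 (u s) := fun s hs =>
    (heig s hs).eq_pEnergy (hpos s hs) (hnorm s hs)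
  have key := hX.hasDerivWithinAt_pEnergy hg hh hH one_lt_two hu
    (by simpa only [Real.rpow_two] using hnorm) ht (heig t ht)
  simp only [Real.rpow_two, sub_self, Real.rpow_zero, mul_one] at key
  exact key.congr hlam (hlam t ht)
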